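/- **Theorem 1.** Let $n>1$, let $I\subseteq(0,\infty)$ and $J\subseteq\mathbb R$ be open intervals (the ranges of density and entropy), and let $P$ be a smooth function on $I\times J$ with $P_S\not\equiv 0$ and such that there is no non-empty open subset $U\subseteq J$ for which $P_\rho\equiv 0$ on $I\times U$. Consider the non-isentropic compressible Euler equations for velocity $u(t,x)\in\mathbb R^n$, density $\rho(t,x)\in I$ and entropy $S(t,x)\in J$, $$u_t+u\cdot\nabla u+\tfrac1\rho\nabla p=0,\qquad \rho_t+\nabla\cdot(\rho u)=0,\qquad S_t+u\cdot\nabla S=0,\qquad p=P(\rho,S),\qquad x\in\mathbb R^n .$$ A smooth function $T(t,x,u,\rho,S)$ is a *conserved density of kinematic form* if there is a vector $X$, a smooth function of $t,x,u,\rho,S$ and finitely many $x$-derivatives of $u,\rho,S$, such that $\mathcal D_tT+D_x\cdot X=0$ identically, where $\mathcal D_t$ is the total time derivative in which $u_t,\rho_t,S_t$ are eliminated by the Euler equations. A density is *trivial* if it equals $D_x\cdot\Theta$ for such a vector function $\Theta$. Let $e(\rho,S)$ be any smooth function with $e_\rho=\rho^{-2}P$. (i) The following laws hold; here $T$ is the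 conserved density and $\xi=X-Tu$ is the flux through boundaries moving with the fluid: - mass: $T=\rho$, $\xi=0$; - momentum: $T=\rho u^k$, $\xi=p\,\hat e_k$; - angular momentum: $T=\rho(u^jx^k-u^kx^j)$, $\xi=p(x^k\hat e_j-x^j\hat e_k)$; - Galilean momentum: $T=\rho(tu^k-x^k)$, $\xi=t\,p\,\hat e_k$; - energy: $T=\rho(\tfrac12|u|^2+e)$, $\xi=p\,u$; - generalized entropy: $T=\rho f(S)$ with $f$ an arbitrary smooth function on $J$, $\xi=0$. Unless $P=\kappa(S)\rho^{1+2/n}+p_0$ for some function $\kappa$ and some constant $p_0$, a smooth function $T(t,x,u,\rho,S)$ is a conserved density if and only if it is, modulo trivial densities, a linear combination with constant coefficients of these densities (*standard*). (ii) There is a conserved density of kinematic form that is not standard if and only if, up to a constant shift of the pressure, the equation of state is polytropic, $P=\kappa(S)\rho^{1+2/n}+p_0$. In that case put $\tilde p=P-p_0$, $\tilde e=\tfrac n2\kappa(S)\rho^{2/n}$ (an internal energy for $\tilde p$) and $E=\rho(\tfrac12|u|^2+\tilde e)=\tfrac12\rho|u|^2+\tfrac n2\tilde p$. Then the similarity energy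 and the dilational energy, $$T_1=tE-\tfrac12\rho\,u\cdot x,\quad \xi_1=\tilde p\,(tu-\tfrac12x),\qquad\quad T_2=t^2E-t\rho\,u\cdot x+\tfrac12\rho|x|^2,\quad \xi_2=\tilde p\,t\,(tu-x),$$ are conservation laws; a smooth function $T(t,x,u,\rho,S)$ is a conserved density if and only if $T-b_1T_1-b_2T_2$ is standard for some constants $b_1,b_2$; and $b_1T_1+b_2T_2$ is standard only if $b_1=b_2=0$. -/

import Mathlib

open Set
open scoped ContDiff

noncomputable section

namespace Euler

/-- Physical space `ℝⁿ` with its Euclidean structure. -/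
abbrev Space (n : ℕ) := EuclideanSpace ℝ (Fin n)

/-- The values `(u, ρ, S)` of velocity, density and entropy. -/
abbrev State (n : ℕ) := Space n × ℝ × ℝ

/-- The `k`-jet `(w, ∂w, …, ∂ᵏw)` at a point of a field `w = (u, ρ, S)` on space. -/
abbrev Jet (n k : ℕ) :=
  State n × ((j : Fin k) → ContinuousMultilinearMap ℝ (fun _ : Fin (j.val + 1) => Space n) (State n))

/-- The `k`-jet at `x` of the field `w`. -/
def jet {n : ℕ} (k : ℕ) (w : Space n → State n) (x : Space n) : Jet n k :=
  (w x, fun j => iteratedFDeriv ℝ (j.val + 1) w x)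

/-- Divergence of a vector field on `ℝⁿ`. -/
def divergence {n : ℕ} (F : Space n → Space n) (x : Space n) : ℝ :=
  ∑ i, (fderiv ℝ F x (EuclideanSpace.single i 1)) i

/-- `w = (u, ρ, S)` is a smooth field on `ℝⁿ` with densities in `I` and entropies in `J`. -/
def IsField {n : ℕ} (I J : Set ℝ) (w : Space n → State n) : Prop :=
  ContDiff ℝ ∞ w ∧ ∀ x, (w x).2.1 ∈ I ∧ (w x).2.2 ∈ J

/-- Functions of kinematic form `T(t, x, u, ρ, S)`. -/
abbrev Kinematic (n : ℕ) (F : Type) := ℝ → Space n → Space n → ℝ → ℝ → F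

/-- A kinematic function regarded as a function of one variable in the product space. -/
def uncurried {n : ℕ} {F : Type} (T : Kinematic n F) : ℝ × Space n × State n → F :=
  fun q => T q.1 q.2.1 q.2.2.1 q.2.2.2.1 q.2.2.2.2

/-- `T(t, x, u, ρ, S)` is smooth for `t ∈ ℝ`, `x, u ∈ ℝⁿ`, `ρ ∈ I`, `S ∈ J`. -/
def IsSmoothKinematic {n : ℕ} (I J : Set ℝ) (T : Kinematic n ℝ) : Prop :=
  ContDiffOn ℝ ∞ (uncurried T) {q | q.2.2.2.1 ∈ I ∧ q.2.2.2.2 ∈ J}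

/-- The value at `x` of a kinematic function on a field `w = (u, ρ, S)` at time `t`. -/
def onField {n : ℕ} {F : Type} (T : Kinematic n F) (t : ℝ) (w : Space n → State n)
    (x : Space n) : F :=
  T t x (w x).1 (w x).2.1 (w x).2.2

/-- A smooth vector function of `t`, `x`, `u`, `ρ`, `S` and the `x`-derivatives of `u`, `ρ`, `S`
up to order `k`. -/
def IsSmoothLocal {n k : ℕ} (I J : Set ℝ) (X : ℝ → Space n → Jet n k → Space n) : Prop :=
  ContDiffOn ℝ ∞ (fun q : ℝ × Space n × Jet n k => X q.1 q.2.1 q.2.2)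
    {q | q.2.2.1.2.1 ∈ I ∧ q.2.2.1.2.2 ∈ J}

/-- The time derivative `(u_t, ρ_t, S_t)` that the Euler equations with pressure `p = P(ρ, S)`
assign to the field `w = (u, ρ, S)`:
`u_t = -(u·∇)u - ρ⁻¹∇p`, `ρ_t = -∇·(ρu)`, `S_t = -u·∇S`. -/
def eulerRHS {n : ℕ} (P : ℝ → ℝ → ℝ) (w : Space n → State n) (x : Space n) : State n :=
  (-(fderiv ℝ (fun y => (w y).1) x (w x).1)
      - ((w x).2.1)⁻¹ • gradient (fun y => P (w y).2.1 (w y).2.2) x,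
   -divergence (fun y => (w y).2.1 • (w y).1) x,
   -(fderiv ℝ (fun y => (w y).2.2) x (w x).1))

/-- The total time derivative of `T(t, x, u, ρ, S)` at fixed `x`, with the time derivatives of
`u, ρ, S` eliminated by the Euler equations:
`T_t + T_u · u_t + T_ρ ρ_t + T_S S_t`. -/
def timeDeriv {n : ℕ} (P : ℝ → ℝ → ℝ) (T : Kinematic n ℝ) (t : ℝ) (w : Space n → State n)
    (x : Space n) : ℝ :=
  fderiv ℝ (uncurried T) (t, x, w x) (1, 0, eulerRHS P w x)

/-- `T` is a conserved density: the total time derivative of `T` on solutions plus the spatial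
divergence of some flux `X` vanishes identically, the flux being a smooth function of
`t, x, u, ρ, S` and finitely many `x`-derivatives of `u, ρ, S`. The spatial fields are arbitrary,
because the Euler equations determine the time derivatives and do not restrict the fields at a
given time. -/
def IsConserved {n : ℕ} (I J : Set ℝ) (P : ℝ → ℝ → ℝ) (T : Kinematic n ℝ) : Prop :=
  ∃ (k : ℕ) (X : ℝ → Space n → Jet n k → Space n), IsSmoothLocal I J X ∧
    ∀ (t : ℝ) (w : Space n → State n), IsField I J w → ∀ x,
      timeDeriv P T t w x + divergence (fun y => X t y (jet k w y)) x = 0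

/-- `T` is a trivial density: it is the spatial divergence of a smooth function of
`t, x, u, ρ, S` and finitely many `x`-derivatives of `u, ρ, S`. -/
def IsTrivial {n : ℕ} (I J : Set ℝ) (T : Kinematic n ℝ) : Prop :=
  ∃ (k : ℕ) (Θ : ℝ → Space n → Jet n k → Space n), IsSmoothLocal I J Θ ∧
    ∀ (t : ℝ) (w : Space n → State n), IsField I J w → ∀ x,
      onField T t w x = divergence (fun y => Θ t y (jet k w y)) x

/-- The local conservation law with density `T` and flux `ξ` through boundaries that move with the
fluid, so that the flux through a fixed boundary is `T u + ξ`. -/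
def HasMovingFlux {n : ℕ} (I J : Set ℝ) (P : ℝ → ℝ → ℝ) (T : Kinematic n ℝ)
    (ξ : Kinematic n (Space n)) : Prop :=
  ∀ (t : ℝ) (w : Space n → State n), IsField I J w → ∀ x,
    timeDeriv P T t w x
      + divergence (fun y => onField T t w y • (w y).1 + onField ξ t w y) x = 0

/-- `e` is an internal energy for the pressure `P`: `∂e/∂ρ = ρ⁻² P`. -/
def IsInternalEnergy (I J : Set ℝ) (P e : ℝ → ℝ → ℝ) : Prop :=
  ContDiffOn ℝ ∞ (fun q : ℝ × ℝ => e q.1 q.2) (I ×ˢ J) ∧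
    ∀ ρ ∈ I, ∀ S ∈ J, HasDerivAt (fun r => e r S) ((ρ ^ 2)⁻¹ * P ρ S) ρ

variable {n : ℕ}

/-- Mass density. -/
def mass : Kinematic n ℝ := fun _ _ _ ρ _ => ρ

/-- Momentum density, `k`-th component of `ρu`. -/
def momentum (k : Fin n) : Kinematic n ℝ := fun _ _ u ρ _ => ρ * u k

/-- Angular momentum density, component `(j, k)` of `ρ u ∧ x`. -/
def angularMomentum (j k : Fin n) : Kinematic n ℝ := fun _ x u ρ _ => ρ * (u j * x k - u k * x j)

/-- Galilean momentum density, `k`-th component of `ρ(tu - x)`. -/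
def galileanMomentum (k : Fin n) : Kinematic n ℝ := fun t x u ρ _ => ρ * (t * u k - x k)

/-- Energy density `E = ρ(½|u|² + e)`. -/
def energy (e : ℝ → ℝ → ℝ) : Kinematic n ℝ := fun _ _ u ρ S => ρ * (‖u‖ ^ 2 / 2 + e ρ S)

/-- Generalized entropy density `ρ f(S)`. -/
def entropy (f : ℝ → ℝ) : Kinematic n ℝ := fun _ _ _ ρ S => ρ * f S

/-- Similarity energy density `tE - ½ρ u·x`. -/
def similarityEnergy (e : ℝ → ℝ → ℝ) : Kinematic n ℝ := fun t x u ρ S =>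
  t * energy e t x u ρ S - ρ * inner ℝ u x / 2

/-- Dilational energy density `t²E - tρ u·x + ½ρ|x|²`. -/
def dilationalEnergy (e : ℝ → ℝ → ℝ) : Kinematic n ℝ := fun t x u ρ S =>
  t ^ 2 * energy e t x u ρ S - t * (ρ * inner ℝ u x) + ρ * ‖x‖ ^ 2 / 2

/-- Modulo trivial densities, `T` is a linear combination of mass, momentum, angular momentum,
Galilean momentum, energy and generalized entropy. -/
def IsStandard (I J : Set ℝ) (e : ℝ → ℝ → ℝ) (T : Kinematic n ℝ) : Prop :=
  ∃ (m b : ℝ) (a g : Fin n → ℝ) (c : Fin n → Fin n → ℝ) (f : ℝ → ℝ), ContDiffOn ℝ ∞ f J ∧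
    IsTrivial I J (T - (m • mass + ∑ k, a k • momentum k + ∑ j, ∑ k, c j k • angularMomentum j k
      + ∑ k, g k • galileanMomentum k + b • energy e + entropy f))

/-- Up to the constant shift `p₀`, the equation of state is `p = κ(S) ρ^(1 + 2/n)`. -/
def IsShiftedPolytropic (n : ℕ) (I J : Set ℝ) (P : ℝ → ℝ → ℝ) (κ : ℝ → ℝ) (p₀ : ℝ) : Prop :=
  ∀ ρ ∈ I, ∀ S ∈ J, P ρ S = κ S * ρ ^ (1 + 2 / (n : ℝ)) + p₀

/-- The polytropic internal energy `e = (n/2) κ(S) ρ^(2/n)`. -/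
def polytropicEnergy (n : ℕ) (κ : ℝ → ℝ) : ℝ → ℝ → ℝ := fun ρ S =>
  (n : ℝ) / 2 * κ S * ρ ^ (2 / (n : ℝ))

end Euler

end

open Euler

noncomputable section

open MeasureTheory Filter Topology

namespace Euler

/-! ### Calculus -/

/-! In a frame that moves with the fluid, a density changes at the rate `T_t + u·∇ₓT + (T - ρT_ρ)
div u - ρ⁻¹ T_u·∇p`, which is affine in the first derivatives of `w = (u, ρ, S)`. Conservation of
`T` means that this expression is the divergence of `Tu - X` for arbitrary fields, so that it is a
null Lagrangian. Its first variation under compactly supported perturbations vanishes, whatever the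
order of the jets in `X`, and `affine_null_lagrangian` extracts the consequence: with `W = T - ρT_ρ`
and `νᵢ = ρ⁻¹T_{uⁱ}`, the forms `W duⁱ - νᵢ dP` on the space of states are closed for fixed `(t,
x)`.

These forms determine the dependence on the state (`eq_of_closed`). Since `n > 1`, the `duᵏ ∧ duⁱ`
components with `i ≠ k` show that `W` does not depend on `u`; hence `ν` does not depend on `ρ`. The
`dρ ∧ dS` component gives `ν_S P_ρ = 0`, and non-degeneracy of `P_ρ` gives `ν_S = 0`. The mixed
components then force `ν = βu + α` and `W = w₀ - βP`, so that `T = w₀ + ρ(β(½|u|² + e) + α·u +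
h(S))`, with coefficients depending on `(t, x)`. The term `w₀` is trivial, because every smooth
function of `(t, x)` is a divergence. Conversely, a trivial kinematic density depends on `(t, x)`
only (`IsTrivial.eq`).

For such a density the explicit flux `Tu + P(βu + α)` absorbs all derivatives of the fields and
leaves a source without derivatives. A divergence of this kind cannot depend on the state, and
comparison of the powers of `u` gives `DeterminingEquations`: `β` depends on time only, the
symmetric part of `∇α` is `-½β'` times the identity, `α_t + ∇h = 0`, and `ρ(β'e + h_t) - (n/2)β'P`
does not depend on `(ρ, S)`.

If `β' = 0`, then `α` is an infinitesimal rigid motion plus a uniform drift linear in `t`, and the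
density is standard. If `β' ≠ 0` at some time, differentiation of the last equation in `ρ` gives
`ρP_ρ = (1 + 2/n)(P + const)`, the shifted polytropic law. Under that law `β` is a quadratic
polynomial in `t`; its linear and quadratic terms are carried by the similarity and dilational
energies, and subtracting them reduces to the case `β' = 0`. Second differences in `u` recover `β`
from a density, whence the independence of the two additional laws. -/

theorem eq_of_fderiv_apply_sub_eq_zero {F : Type*} [NormedAddCommGroup F] [NormedSpace ℝ F]
    {s : Set F} (hs : IsOpen s) (hc : Convex ℝ s) {f : F → ℝ}
    (hf : DifferentiableOn ℝ f s) {x y : F} (hx : x ∈ s) (hy : y ∈ s)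
    (h : ∀ z ∈ s, fderiv ℝ f z (y - x) = 0) : f y = f x := by
  obtain ⟨z, hz, hzf⟩ := domain_mvt (f' := fderiv ℝ f)
    (fun z hz => ((hf z hz).differentiableAt (hs.mem_nhds hz)).hasFDerivAt.hasFDerivWithinAt)
    hc hx hy
  rw [h z (hc.segment_subset hx hy hz)] at hzf
  linarith

theorem hasFDerivAt_integral_of_contDiff {H F : Type*} [NormedAddCommGroup H] [NormedSpace ℝ H]
    [FiniteDimensional ℝ H] [NormedAddCommGroup F] [NormedSpace ℝ F] [CompleteSpace F]
    {g : ℝ × H → F} (hg : ContDiff ℝ 1 g) (q : H) :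
    HasFDerivAt (fun q => ∫ s in (0 : ℝ)..1, g (s, q))
      (∫ s in (0 : ℝ)..1, (fderiv ℝ g (s, q)).comp (ContinuousLinearMap.inr ℝ ℝ H)) q := by
  have hc : Continuous fun p : ℝ × H =>
      (fderiv ℝ g p).comp (ContinuousLinearMap.inr ℝ ℝ H) := by
    have := hg.continuous_fderiv one_ne_zero
    fun_prop
  obtain ⟨C, hC⟩ := (isCompact_Icc.prod (isCompact_closedBall q 1) :
    IsCompact (Icc (0 : ℝ) 1 ×ˢ Metric.closedBall q 1)).exists_bound_of_continuousOn
      hc.continuousOn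
  refine intervalIntegral.hasFDerivAt_integral_of_dominated_of_fderiv_le
    (F' := fun q s => (fderiv ℝ g (s, q)).comp (ContinuousLinearMap.inr ℝ ℝ H))
    (bound := fun _ => C) (Metric.ball_mem_nhds q one_pos) ?_ ?_ ?_ ?_ ?_ ?_
  · exact Eventually.of_forall fun q =>
      (by have := hg.continuous; fun_prop : Continuous fun s => g (s, q)).aestronglyMeasurable
  · exact (by have := hg.continuous; fun_prop :
      Continuous fun s => g (s, q)).intervalIntegrable _ _
  · exact (by fun_prop : Continuous fun s : ℝ =>
      (fderiv ℝ g (s, q)).comp (ContinuousLinearMap.inr ℝ ℝ H)).aestronglyMeasurable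
  · refine Eventually.of_forall fun s hs x hx => hC (s, x) ⟨?_, Metric.ball_subset_closedBall hx⟩
    rw [uIoc_of_le zero_le_one] at hs
    exact ⟨hs.1.le, hs.2⟩
  · exact intervalIntegrable_const
  · refine Eventually.of_forall fun s _ x _ => ?_
    exact ((hg.differentiable one_ne_zero (s, x)).hasFDerivAt).comp x
      (hasFDerivAt_prodMk_right s x)

/-- The derivative of the integral is again a parametric integral, now with values in `H →L[ℝ] F`.
The induction on `m` therefore has to quantify over the target space `F`. -/
theorem contDiff_integral_of_contDiff {H : Type} [NormedAddCommGroup H] [NormedSpace ℝ H]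
    [FiniteDimensional ℝ H] (m : ℕ) : ∀ {F : Type} [NormedAddCommGroup F] [NormedSpace ℝ F]
    [CompleteSpace F] {g : ℝ × H → F}, ContDiff ℝ m g →
    ContDiff ℝ m (fun q => ∫ s in (0 : ℝ)..1, g (s, q)) := by
  induction m with
  | zero =>
    intro F _ _ _ g hg
    refine contDiff_zero.2 (intervalIntegral.continuous_parametric_intervalIntegral_of_continuous'
      (f := fun q s => g (s, q)) ?_ _ _)
    have := hg.continuous
    exact this.comp (continuous_swap)
  | succ m ih =>
    intro F _ _ _ g hg
    have h1 : ContDiff ℝ 1 g := hg.of_le (by exact_mod_cast Nat.le_add_left 1 m)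
    refine (contDiff_succ_iff_hasFDerivAt (n := (m : ℕ))).2 ⟨_, ?_,
      fun q => hasFDerivAt_integral_of_contDiff h1 q⟩
    refine ih (g := fun p : ℝ × H => (fderiv ℝ g p).comp (ContinuousLinearMap.inr ℝ ℝ H)) ?_
    have := hg.fderiv_right (m := m) (by norm_cast)
    exact this.clm_comp contDiff_const

/-! ### The divergence -/

variable {n : ℕ}

theorem divergence_eq_sum {F : Space n → Space n} {x : Space n} (hF : DifferentiableAt ℝ F x) :
    divergence F x = ∑ i, fderiv ℝ (fun y => F y i) x (EuclideanSpace.single i 1) := by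
  refine Finset.sum_congr rfl fun i _ => ?_
  have := ((EuclideanSpace.proj (𝕜 := ℝ) i).hasFDerivAt.comp x hF.hasFDerivAt).fderiv
  have h2 : (⇑(EuclideanSpace.proj (𝕜 := ℝ) i) ∘ F) = fun y => F y i := rfl
  rw [h2] at this
  rw [this]; rfl

theorem divergence_add {F G : Space n → Space n} {x : Space n} (hF : DifferentiableAt ℝ F x)
    (hG : DifferentiableAt ℝ G x) :
    divergence (fun y => F y + G y) x = divergence F x + divergence G x := by
  simp only [divergence, fderiv_fun_add hF hG, ← Finset.sum_add_distrib]
  rfl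

theorem divergence_sub {F G : Space n → Space n} {x : Space n} (hF : DifferentiableAt ℝ F x)
    (hG : DifferentiableAt ℝ G x) :
    divergence (fun y => F y - G y) x = divergence F x - divergence G x := by
  simp only [divergence, fderiv_fun_sub hF hG, ← Finset.sum_sub_distrib]
  rfl

theorem divergence_const_smul {F : Space n → Space n} {x : Space n} (hF : DifferentiableAt ℝ F x)
    (c : ℝ) : divergence (fun y => c • F y) x = c * divergence F x := by
  simp only [divergence, fderiv_fun_const_smul hF, Finset.mul_sum]
  rfl

theorem sum_coord_smul_single (v : Space n) :
    ∑ i, v i • EuclideanSpace.single i (1 : ℝ) = v := by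
  ext j
  simp [Finset.sum_apply, Pi.single_apply]

theorem divergence_smul {g : Space n → ℝ} {F : Space n → Space n} {x : Space n}
    (hg : DifferentiableAt ℝ g x) (hF : DifferentiableAt ℝ F x) :
    divergence (fun y => g y • F y) x = g x * divergence F x + fderiv ℝ g x (F x) := by
  have : fderiv ℝ g x (F x)
      = ∑ i, F x i * fderiv ℝ g x (EuclideanSpace.single i 1) := by
    conv_lhs => rw [← sum_coord_smul_single (F x)]
    simp
  rw [this]
  simp only [divergence, fderiv_fun_smul hg hF, Finset.mul_sum, ← Finset.sum_add_distrib]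
  refine Finset.sum_congr rfl fun i _ => ?_
  simp [mul_comm]

theorem integral_fderiv_apply_eq_zero {f : Space n → ℝ} (hf : ContDiff ℝ 1 f)
    (hs : HasCompactSupport f) (v : Space n) : ∫ x, fderiv ℝ f x v = 0 := by
  have hc : Continuous fun x => fderiv ℝ f x v :=
    (hf.continuous_fderiv one_ne_zero).clm_apply continuous_const
  have h := integral_mul_fderiv_eq_neg_fderiv_mul_of_integrable (μ := volume)
    (f := fun _ : Space n => (1 : ℝ)) (g := f) (v := v) (by simp)
    (by simpa using hc.integrable_of_hasCompactSupport (hs.fderiv_apply ℝ v))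
    (by simpa using hf.continuous.integrable_of_hasCompactSupport hs) (by simp)
    (fun x _ => hf.differentiable one_ne_zero x)
  simpa using h

theorem integral_divergence_eq_zero {F : Space n → Space n} (hF : ContDiff ℝ 1 F)
    (hs : HasCompactSupport F) : ∫ x, divergence F x = 0 := by
  have hc : ∀ i, ContDiff ℝ 1 fun y => F y i := fun i => contDiff_euclidean.1 hF i
  have hsi : ∀ i, HasCompactSupport fun y => F y i := fun i =>
    hs.comp_left (g := fun v : Space n => v i) rfl
  simp_rw [fun x => divergence_eq_sum (hF.differentiable one_ne_zero x)]
  rw [integral_finsetSum]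
  · exact Finset.sum_eq_zero fun i _ => integral_fderiv_apply_eq_zero (hc i) (hsi i) _
  · intro i _
    exact (((hc i).continuous_fderiv one_ne_zero).clm_apply
      continuous_const).integrable_of_hasCompactSupport ((hsi i).fderiv_apply ℝ _)

/-- Only the difference has compact support. In the first variation, `F` and `G` are the fluxes of a
perturbed and an unperturbed field, neither of which need be integrable. -/
theorem integral_divergence_sub_eq_zero {F G : Space n → Space n} (hF : ContDiff ℝ 1 F)
    (hG : ContDiff ℝ 1 G) (hs : HasCompactSupport fun x => F x - G x) :
    ∫ x, (divergence F x - divergence G x) = 0 := by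
  rw [← integral_divergence_eq_zero (hF.sub hG) hs]
  exact integral_congr_ae (Eventually.of_forall fun x =>
    (divergence_sub (hF.differentiable one_ne_zero x) (hG.differentiable one_ne_zero x)).symm)

/-- Every smooth function of `(t, x)` is the spatial divergence of a smooth vector field. -/
theorem exists_divergence_eq (hn : 0 < n) {g : ℝ × Space n → ℝ} (hg : ContDiff ℝ ∞ g) :
    ∃ Θ : ℝ × Space n → Space n, ContDiff ℝ ∞ Θ ∧
      ∀ t x, divergence (fun y => Θ (t, y)) x = g (t, x) := by
  set i₀ : Fin n := ⟨0, hn⟩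
  set e : Space n := EuclideanSpace.single i₀ 1
  -- This is the primitive of `g` in the coordinate `i₀`, starting at the hyperplane where that
  -- coordinate is zero. Rescaling to the interval `[0, 1]` makes smoothness in all variables an
  -- instance of `contDiff_integral_of_contDiff`.
  set θ : ℝ × Space n → ℝ := fun q =>
    q.2 i₀ * ∫ s in (0 : ℝ)..1, g (q.1, q.2 + (s * q.2 i₀ - q.2 i₀) • e)
  have hcoord : ContDiff ℝ ∞ fun q : ℝ × Space n => q.2 i₀ :=
    (EuclideanSpace.proj (𝕜 := ℝ) i₀).contDiff.comp contDiff_snd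
  have hθ : ContDiff ℝ ∞ θ := by
    refine hcoord.mul (contDiff_infty.2 fun m => contDiff_integral_of_contDiff m
      (g := fun p : ℝ × (ℝ × Space n) => g (p.2.1, p.2.2 + (p.1 * p.2.2 i₀ - p.2.2 i₀) • e)) ?_)
    refine ContDiff.of_le (hg.comp ?_) (mod_cast le_top)
    have := hcoord.comp (contDiff_snd (𝕜 := ℝ) (E := ℝ) (F := ℝ × Space n))
    have h2 : ContDiff ℝ ∞ fun p : ℝ × (ℝ × Space n) => p.2.2 i₀ := this
    fun_prop
  -- Along the direction `e` the rescaling is undone, so that the variable appears only in the upper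
  -- limit and the fundamental theorem of calculus applies.
  have hline : ∀ t x (τ : ℝ), θ (t, x + τ • e)
      = ∫ σ in (0 : ℝ)..(x i₀ + τ), g (t, x + (σ - x i₀) • e) := by
    intro t x τ
    have h := intervalIntegral.mul_integral_comp_mul_right (a := (0 : ℝ)) (b := 1)
      (f := fun σ => g (t, x + (σ - x i₀) • e)) (x i₀ + τ)
    rw [zero_mul, one_mul] at h
    rw [← h]
    have he : (x + τ • e) i₀ = x i₀ + τ := by simp [e]
    simp only [θ, he]
    congr 1
    refine intervalIntegral.integral_congr fun s _ => ?_
    congr 2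
    rw [add_assoc, ← add_smul]
    congr 2
    ring
  refine ⟨fun q => θ q • e, hθ.smul contDiff_const, fun t x => ?_⟩
  have hθt : ContDiff ℝ ∞ fun y => θ (t, y) := hθ.comp (contDiff_const.prodMk contDiff_id)
  have hd := hθt.differentiable (by simp) x
  rw [divergence_smul hd (differentiableAt_const _)]
  have h0 : divergence (fun _ : Space n => e) x = 0 := by simp [divergence]
  rw [h0, mul_zero, zero_add]
  have h1 : HasDerivAt (fun τ : ℝ => x + τ • e) e 0 := by
    simpa using ((hasDerivAt_id (0 : ℝ)).smul_const e).const_add x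
  have h2 : HasDerivAt (fun τ : ℝ => θ (t, x + τ • e)) (fderiv ℝ (fun y => θ (t, y)) x e) 0 := by
    have hx : x = x + (0 : ℝ) • e := by simp
    have hd' := hd.hasFDerivAt
    exact HasFDerivAt.comp_hasDerivAt (f := fun τ : ℝ => x + τ • e) 0
      (by rw [← hx]; exact hd') h1
  have h3 : HasDerivAt (fun τ : ℝ => θ (t, x + τ • e)) (g (t, x)) 0 := by
    simp only [hline]
    have hcont : Continuous fun σ : ℝ => g (t, x + (σ - x i₀) • e) := by
      have := hg.continuous
      fun_prop
    have h4 := (hcont.integral_hasStrictDerivAt 0 (x i₀)).hasDerivAt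
    have h5 : HasDerivAt (fun τ : ℝ => x i₀ + τ) 1 0 := (hasDerivAt_id (0 : ℝ)).const_add _
    have h6 := HasDerivAt.comp (h := fun τ : ℝ => x i₀ + τ) (0 : ℝ)
      (h₂ := fun b : ℝ => ∫ σ in (0 : ℝ)..b, g (t, x + (σ - x i₀) • e)) (by simpa using h4) h5
    simpa [Function.comp_def] using h6
  exact h2.unique h3

end Euler

namespace Euler

variable {n : ℕ}

/-! ### Fields and their jets -/

/-- The states with density in `I` and entropy in `J`. -/
def phase (n : ℕ) (I J : Set ℝ) : Set (State n) := {v | v.2.1 ∈ I ∧ v.2.2 ∈ J}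

theorem isOpen_phase {I J : Set ℝ} (hI : IsOpen I) (hJ : IsOpen J) : IsOpen (phase n I J) :=
  (hI.preimage (by fun_prop : Continuous fun v : State n => v.2.1)).inter
    (hJ.preimage (by fun_prop : Continuous fun v : State n => v.2.2))

theorem convex_phase {I J : Set ℝ} (hI : I.OrdConnected) (hJ : J.OrdConnected) :
    Convex ℝ (phase n I J) := fun _ hv _ hw _ _ ha hb hab =>
  ⟨hI.convex hv.1 hw.1 ha hb hab, hJ.convex hv.2 hw.2 ha hb hab⟩

theorem contDiff_jet {w : Space n → State n} (hw : ContDiff ℝ ∞ w) (k : ℕ) :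
    ContDiff ℝ ∞ (jet k w) :=
  hw.prodMk (contDiff_pi.2 fun _ => hw.iteratedFDeriv_right (mod_cast le_top))

theorem contDiff_local {I J : Set ℝ} (hI : IsOpen I) (hJ : IsOpen J) {k : ℕ}
    {X : Space n → Jet n k → Space n}
    (hX : ContDiffOn ℝ ∞ (fun q : Space n × Jet n k => X q.1 q.2) {q | q.2.1 ∈ phase n I J})
    {w : Space n → State n} (hw : IsField I J w) :
    ContDiff ℝ ∞ (fun y => X y (jet k w y)) := by
  have ho : IsOpen {q : Space n × Jet n k | q.2.1 ∈ phase n I J} :=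
    (isOpen_phase hI hJ).preimage (by fun_prop)
  rw [contDiff_iff_contDiffAt]
  intro y
  have h1 : ContDiffAt ℝ ∞ (fun q : Space n × Jet n k => X q.1 q.2) (y, jet k w y) :=
    hX.contDiffAt (ho.mem_nhds (hw.2 y))
  exact h1.comp y (contDiff_id.prodMk (contDiff_jet hw.1 k)).contDiffAt

/-- Off the closed support of `ψ` the two fields agree near the point, hence have the same jets of
every order. -/
theorem hasCompactSupport_local_sub {k : ℕ} (X : Space n → Jet n k → Space n)
    (w : Space n → State n) {ψ : Space n → State n} (hψ : HasCompactSupport ψ) :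
    HasCompactSupport fun y => X y (jet k (w + ψ) y) - X y (jet k w y) := by
  refine HasCompactSupport.of_support_subset_isCompact hψ fun y hy => ?_
  by_contra hys
  refine hy ?_
  have he : (w + ψ) =ᶠ[𝓝 y] w := by
    filter_upwards [notMem_tsupport_iff_eventuallyEq.1 hys] with z hz
    simp [hz]
  have : jet k (w + ψ) y = jet k w y :=
    Prod.ext he.eq_of_nhds (funext fun j => (Filter.EventuallyEq.iteratedFDeriv ℝ he _).eq_of_nhds)
  simp [this]

/-- `I` and `J` are open, and compactness of the support of `ψ` makes the admissible range of `s`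
uniform in `x`. -/
theorem exists_forall_isField_add_smul {I J : Set ℝ} (hI : IsOpen I) (hJ : IsOpen J)
    {w ψ : Space n → State n} (hw : IsField I J w) (hψ : ContDiff ℝ ∞ ψ)
    (hc : HasCompactSupport ψ) :
    ∃ δ : ℝ, 0 < δ ∧ ∀ s ∈ Ioo (-δ) δ, IsField I J (w + s • ψ) := by
  have h : ∀ᶠ s : ℝ in 𝓝 0, ∀ x ∈ tsupport ψ, w x + s • ψ x ∈ phase n I J := by
    refine hc.eventually_forall_of_forall_eventually fun x _ => ?_
    have hcont : Continuous fun z : ℝ × Space n => w z.2 + z.1 • ψ z.2 := by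
      have := hw.1.continuous
      have := hψ.continuous
      fun_prop
    refine hcont.continuousAt.eventually_mem ((isOpen_phase hI hJ).mem_nhds ?_)
    simp only [zero_smul, add_zero]
    exact hw.2 x
  obtain ⟨δ, hδ, hs⟩ := Metric.eventually_nhds_iff_ball.1 h
  refine ⟨δ, hδ, fun s hsm => ⟨hw.1.add (hψ.const_smul s), fun x => ?_⟩⟩
  by_cases hx : x ∈ tsupport ψ
  · refine hs s ?_ x hx
    rw [Real.ball_eq_Ioo]; simpa using hsm
  · simpa [image_eq_zero_of_notMem_tsupport hx] using hw.2 x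

/-! ### Null Lagrangians that are affine in the first derivatives -/

/-- Differentiation under the integral sign. Off `K` the integrand vanishes for all `s`, so its
`s`-derivative vanishes too; on `K` and for `|s| ≤ δ/2` the derivative is bounded by compactness. -/
theorem integral_fderiv_eq_zero_of_integral_eq_zero {g : ℝ × Space n → ℝ} {δ : ℝ} (hδ : 0 < δ)
    (hg : ContDiffOn ℝ 1 g (Ioo (-δ) δ ×ˢ univ)) {K : Set (Space n)} (hK : IsCompact K)
    (h0 : ∀ s ∈ Ioo (-δ) δ, ∀ x ∉ K, g (s, x) = 0)
    (hvanish : ∀ s ∈ Ioo (-δ) δ, ∫ x, g (s, x) = 0) :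
    ∫ x, fderiv ℝ g (0, x) (1, 0) = 0 := by
  have ho : IsOpen (Ioo (-δ) δ ×ˢ (univ : Set (Space n))) := isOpen_Ioo.prod isOpen_univ
  have hcf : ContinuousOn (fun p => fderiv ℝ g p (1, 0)) (Ioo (-δ) δ ×ˢ univ) :=
    (hg.continuousOn_fderiv_of_isOpen ho le_rfl).clm_apply continuousOn_const
  have hdiff : ∀ s ∈ Ioo (-δ) δ, ∀ x, HasDerivAt (fun s => g (s, x)) (fderiv ℝ g (s, x) (1, 0)) s := by
    intro s hs x
    have h1 : DifferentiableAt ℝ g (s, x) :=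
      (hg.contDiffAt (ho.mem_nhds ⟨hs, mem_univ _⟩)).differentiableAt one_ne_zero
    exact h1.hasFDerivAt.comp_hasDerivAt s ((hasDerivAt_id s).prodMk (hasDerivAt_const s x))
  have hzero : ∀ s ∈ Ioo (-δ) δ, ∀ x ∉ K, fderiv ℝ g (s, x) (1, 0) = 0 := by
    intro s hs x hx
    refine (hdiff s hs x).unique ((hasDerivAt_const s (0 : ℝ)).congr_of_eventuallyEq ?_)
    filter_upwards [isOpen_Ioo.mem_nhds hs] with s' hs' using h0 s' hs' x hx
  have hsub : Icc (-(δ / 2)) (δ / 2) ⊆ Ioo (-δ) δ := Icc_subset_Ioo (by linarith) (by linarith)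
  obtain ⟨C, hC⟩ := ((isCompact_Icc : IsCompact (Icc (-(δ / 2)) (δ / 2))).prod
    hK).exists_bound_of_continuousOn (hcf.mono (prod_mono hsub (subset_univ K)))
  have hm : (0 : ℝ) ∈ Ioo (-δ) δ := ⟨by linarith, hδ⟩
  have hcs : ∀ s ∈ Ioo (-δ) δ, Continuous fun x => g (s, x) := fun s hs =>
    hg.continuousOn.comp_continuous (by fun_prop) fun x => ⟨hs, mem_univ _⟩
  have key := hasDerivAt_integral_of_dominated_loc_of_deriv_le (μ := (volume : Measure (Space n)))
    (F := fun s x => g (s, x)) (F' := fun s x => fderiv ℝ g (s, x) (1, 0)) (x₀ := (0 : ℝ))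
    (s := Icc (-(δ / 2)) (δ / 2)) (bound := K.indicator fun _ => C)
    (Icc_mem_nhds (by linarith) (by linarith))
    (by filter_upwards [isOpen_Ioo.mem_nhds hm] with s hs using (hcs s hs).aestronglyMeasurable)
    ((hcs 0 hm).integrable_of_hasCompactSupport
      (HasCompactSupport.of_support_subset_isCompact hK fun x hx => by
        by_contra hxK; exact hx (h0 0 hm x hxK)))
    (hcf.comp_continuous (by fun_prop) fun x => ⟨hm, mem_univ x⟩ :
      Continuous fun x => fderiv ℝ g ((0 : ℝ), x) (1, 0)).aestronglyMeasurable
    (Eventually.of_forall fun x s hs => by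
      by_cases hx : x ∈ K
      · rw [indicator_of_mem hx]; exact hC (s, x) ⟨hs, hx⟩
      · rw [indicator_of_notMem hx, hzero s (hsub hs) x hx, norm_zero])
    ((integrable_indicator_iff hK.measurableSet).2
      (integrableOn_const hK.measure_lt_top.ne))
    (Eventually.of_forall fun x s hs => hdiff s (hsub hs) x)
  refine key.2.unique ((hasDerivAt_const (0 : ℝ) (0 : ℝ)).congr_of_eventuallyEq ?_)
  filter_upwards [isOpen_Ioo.mem_nhds hm] with s hs using hvanish s hs

variable {I J : Set ℝ} {A : Space n × State n → ℝ}
  {B : Fin n → Space n × State n → (State n →L[ℝ] ℝ)}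

/-- The Euler–Lagrange expression, in the direction `a`, of the Lagrangian
`A(x, w) + ∑ Bⁱ(x, w) ∂ᵢw`. -/
def affineEulerLagrange (A : Space n × State n → ℝ)
    (B : Fin n → Space n × State n → (State n →L[ℝ] ℝ)) (w : Space n → State n) (a : State n)
    (x : Space n) : ℝ :=
  fderiv ℝ A (x, w x) (0, a)
    + ∑ i, (fderiv ℝ (B i) (x, w x) (0, a) (fderiv ℝ w x (EuclideanSpace.single i 1))
      - fderiv ℝ (B i) (x, w x)
          (EuclideanSpace.single i 1, fderiv ℝ w x (EuclideanSpace.single i 1)) a)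

theorem continuous_affineEulerLagrange (hI : IsOpen I) (hJ : IsOpen J)
    (hA : ContDiffOn ℝ ∞ A {q | q.2 ∈ phase n I J})
    (hB : ∀ i, ContDiffOn ℝ ∞ (B i) {q | q.2 ∈ phase n I J})
    {w : Space n → State n} (hw : IsField I J w) (a : State n) :
    Continuous (affineEulerLagrange A B w a) := by
  have ho : IsOpen {q : Space n × State n | q.2 ∈ phase n I J} :=
    (isOpen_phase hI hJ).preimage continuous_snd
  have hwc := hw.1.continuous
  have hdw : Continuous (fderiv ℝ w) := hw.1.continuous_fderiv (by simp)
  have h1 : Continuous fun x => fderiv ℝ A (x, w x) :=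
    (hA.continuousOn_fderiv_of_isOpen ho (by simp)).comp_continuous (by fun_prop) hw.2
  have h2 : ∀ i, Continuous fun x => fderiv ℝ (B i) (x, w x) := fun i =>
    ((hB i).continuousOn_fderiv_of_isOpen ho (by simp)).comp_continuous (by fun_prop) hw.2
  unfold affineEulerLagrange
  fun_prop

/-- The field is varied by `s η a` with a test function `η`. The Lagrangian minus its value at `s =
0` is the divergence of a compactly supported vector field, so its integral vanishes for all small
`s`. The derivative at `s = 0` is, after integration by parts, the integral of `η` against the
Euler–Lagrange expression, which is continuous and hence zero. -/
theorem affineEulerLagrange_eq_zero (hI : IsOpen I) (hJ : IsOpen J)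
    (hA : ContDiffOn ℝ ∞ A {q | q.2 ∈ phase n I J})
    (hB : ∀ i, ContDiffOn ℝ ∞ (B i) {q | q.2 ∈ phase n I J}) {k : ℕ}
    {X : Space n → Jet n k → Space n}
    (hX : ContDiffOn ℝ ∞ (fun q : Space n × Jet n k => X q.1 q.2) {q | q.2.1 ∈ phase n I J})
    (h : ∀ w, IsField I J w → ∀ x,
      A (x, w x) + ∑ i, B i (x, w x) (fderiv ℝ w x (EuclideanSpace.single i 1))
        = divergence (fun y => X y (jet k w y)) x)
    {w : Space n → State n} (hw : IsField I J w) (a : State n) (x : Space n) :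
    affineEulerLagrange A B w a x = 0 := by
  have ho : IsOpen {q : Space n × State n | q.2 ∈ phase n I J} :=
    (isOpen_phase hI hJ).preimage continuous_snd
  have hFc := continuous_affineEulerLagrange hI hJ hA hB hw a
  suffices hae : ∀ᵐ x, affineEulerLagrange A B w a x = 0 from
    congrFun ((hFc.ae_eq_iff_eq volume continuous_const).1 hae) x
  refine ae_eq_zero_of_integral_contDiff_smul_eq_zero hFc.locallyIntegrable fun η hη hηc => ?_
  set ψ : Space n → State n := fun x => η x • a with hψdef
  have hψ : ContDiff ℝ ∞ ψ := hη.smul contDiff_const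
  have hψc : HasCompactSupport ψ := hηc.smul_right
  obtain ⟨δ, hδ, hfield⟩ := exists_forall_isField_add_smul hI hJ hw hψ hψc
  set ℓ : ℝ × Space n → ℝ := fun p =>
    A (p.2, w p.2 + p.1 • ψ p.2) + ∑ i, B i (p.2, w p.2 + p.1 • ψ p.2)
      (fderiv ℝ w p.2 (EuclideanSpace.single i 1)
        + p.1 • fderiv ℝ ψ p.2 (EuclideanSpace.single i 1)) with hℓ
  have hm : (0 : ℝ) ∈ Ioo (-δ) δ := ⟨by linarith, hδ⟩
  have hdw : ContDiff ℝ ∞ (fderiv ℝ w) := hw.1.fderiv_right (by simp)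
  have hdψ : ContDiff ℝ ∞ (fderiv ℝ ψ) := hψ.fderiv_right (by simp)
  have hpt : ContDiff ℝ ∞ fun p : ℝ × Space n => (p.2, w p.2 + p.1 • ψ p.2) := by
    have h1 := hw.1.comp (contDiff_snd (𝕜 := ℝ) (E := ℝ) (F := Space n))
    have h2 := hψ.comp (contDiff_snd (𝕜 := ℝ) (E := ℝ) (F := Space n))
    exact contDiff_snd.prodMk (h1.add (contDiff_fst.smul h2))
  have hmaps : MapsTo (fun p : ℝ × Space n => (p.2, w p.2 + p.1 • ψ p.2))
      (Ioo (-δ) δ ×ˢ univ) {q | q.2 ∈ phase n I J} := fun p hp => (hfield p.1 hp.1).2 p.2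
  have hℓs : ContDiffOn ℝ ∞ ℓ (Ioo (-δ) δ ×ˢ univ) := by
    refine (hA.comp hpt.contDiffOn hmaps).add (ContDiffOn.sum fun i _ =>
      ((hB i).comp hpt.contDiffOn hmaps).clm_apply (ContDiff.contDiffOn ?_))
    have h1 := (hdw.comp (contDiff_snd (𝕜 := ℝ) (E := ℝ) (F := Space n))).clm_apply
      (contDiff_const (c := EuclideanSpace.single i (1 : ℝ)))
    have h2 := (hdψ.comp (contDiff_snd (𝕜 := ℝ) (E := ℝ) (F := Space n))).clm_apply
      (contDiff_const (c := EuclideanSpace.single i (1 : ℝ)))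
    exact h1.add (contDiff_fst.smul h2)
  have hℓdiv : ∀ s ∈ Ioo (-δ) δ, ∀ y, ℓ (s, y)
      = divergence (fun y => X y (jet k (w + s • ψ) y)) y := by
    intro s hs y
    rw [← h _ (hfield s hs) y]
    have : fderiv ℝ (w + s • ψ) y = fderiv ℝ w y + s • fderiv ℝ ψ y := by
      rw [fderiv_add (hw.1.differentiable (by simp) y)
        ((hψ.differentiable (by simp) y).const_smul s),
        fderiv_const_smul (hψ.differentiable (by simp) y)]
    simp [hℓ, this]
  -- The integration by parts in pointwise form: the remainder is the sum of the total derivatives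
  -- of `η Bⁱ a`, each of which integrates to zero.
  have hderiv : ∀ y, fderiv ℝ (fun p : ℝ × Space n => ℓ p - ℓ (0, p.2)) (0, y) (1, 0)
      = η y * affineEulerLagrange A B w a y
        + ∑ i, fderiv ℝ (fun z => η z * B i (z, w z) a) y (EuclideanSpace.single i 1) := by
    intro y
    have hA' : DifferentiableAt ℝ A (y, w y) :=
      (hA.contDiffAt (ho.mem_nhds (hw.2 y))).differentiableAt (by simp)
    have hB' : ∀ i, DifferentiableAt ℝ (B i) (y, w y) := fun i =>
      ((hB i).contDiffAt (ho.mem_nhds (hw.2 y))).differentiableAt (by simp)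
    have hηd : DifferentiableAt ℝ η y := hη.differentiable (by simp) y
    have hwd : DifferentiableAt ℝ w y := hw.1.differentiable (by simp) y
    have hψ' : ∀ v, fderiv ℝ ψ y v = fderiv ℝ η y v • a := fun v => by
      simp [hψdef, fderiv_smul_const hηd]
    have hline : HasDerivAt (fun s : ℝ => (y, w y + s • ψ y)) (0, ψ y) 0 := by
      refine (hasDerivAt_const _ _).prodMk ?_
      simpa using ((hasDerivAt_id (0 : ℝ)).smul_const (ψ y)).const_add (w y)
    have hAs : HasDerivAt (fun s : ℝ => A (y, w y + s • ψ y)) (fderiv ℝ A (y, w y) (0, ψ y)) 0 :=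
      HasFDerivAt.comp_hasDerivAt (f := fun s : ℝ => (y, w y + s • ψ y)) 0
        (by simpa using hA'.hasFDerivAt) hline
    have hBs : ∀ i, HasDerivAt (fun s : ℝ => B i (y, w y + s • ψ y))
        (fderiv ℝ (B i) (y, w y) (0, ψ y)) 0 := fun i =>
      HasFDerivAt.comp_hasDerivAt (f := fun s : ℝ => (y, w y + s • ψ y)) 0
        (by simpa using (hB' i).hasFDerivAt) hline
    have hps : ∀ i : Fin n, HasDerivAt (fun s : ℝ => fderiv ℝ w y (EuclideanSpace.single i 1)
        + s • fderiv ℝ ψ y (EuclideanSpace.single i 1))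
        (fderiv ℝ ψ y (EuclideanSpace.single i 1)) 0 := fun i => by
      have := ((hasDerivAt_id (0 : ℝ)).smul_const
        (fderiv ℝ ψ y (EuclideanSpace.single i 1))).const_add
        (fderiv ℝ w y (EuclideanSpace.single i 1))
      rwa [one_smul] at this
    have hls : HasDerivAt (fun s : ℝ => ℓ (s, y) - ℓ (0, y)) _ 0 :=
      (hAs.add (HasDerivAt.fun_sum fun i (_ : i ∈ Finset.univ) =>
        (hBs i).clm_apply (hps i))).sub_const (ℓ (0, y))
    have hgd : DifferentiableAt ℝ (fun p : ℝ × Space n => ℓ p - ℓ (0, p.2)) (0, y) := by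
      have h1 : DifferentiableAt ℝ ℓ (0, y) :=
        (hℓs.contDiffAt ((isOpen_Ioo.prod isOpen_univ).mem_nhds
          ⟨hm, mem_univ _⟩)).differentiableAt (by simp)
      have h2 : DifferentiableAt ℝ (fun p : ℝ × Space n => ℓ (0, p.2)) (0, y) :=
        DifferentiableAt.comp (g := ℓ) (f := fun p : ℝ × Space n => ((0 : ℝ), p.2)) (0, y) h1
          (by fun_prop)
      exact h1.sub h2
    have hls' := hgd.hasFDerivAt.comp_hasDerivAt (0 : ℝ)
      ((hasDerivAt_id (0 : ℝ)).prodMk (hasDerivAt_const (0 : ℝ) y))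
    rw [hls'.unique hls]
    have hZ : ∀ i, fderiv ℝ (fun z => η z * B i (z, w z) a) y (EuclideanSpace.single i 1)
        = η y * fderiv ℝ (B i) (y, w y)
            (EuclideanSpace.single i 1, fderiv ℝ w y (EuclideanSpace.single i 1)) a
          + B i (y, w y) a * fderiv ℝ η y (EuclideanSpace.single i 1) := by
      intro i
      have h1 : HasFDerivAt (fun z => B i (z, w z)) _ y :=
        HasFDerivAt.comp (g := B i) (f := fun z => (z, w z)) y (hB' i).hasFDerivAt
          ((hasFDerivAt_id y).prodMk hwd.hasFDerivAt)
      have h2 := hηd.hasFDerivAt.fun_mul (h1.clm_apply (hasFDerivAt_const a y))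
      rw [h2.fderiv]
      simp
    simp only [hZ, affineEulerLagrange, mul_add, Finset.mul_sum]
    have e1 : ((0 : Space n), ψ y) = η y • ((0 : Space n), a) := by simp [hψdef]
    simp only [e1, map_smul, hψ', zero_smul, add_zero, smul_apply,
      smul_eq_mul, add_assoc, ← Finset.sum_add_distrib]
    congr 1
    refine Finset.sum_congr rfl fun i _ => ?_
    ring
  have hZs : ∀ i, ContDiff ℝ ∞ fun z => η z * B i (z, w z) a := fun i => by
    refine hη.mul (ContDiff.clm_apply ?_ contDiff_const)
    rw [contDiff_iff_contDiffAt]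
    exact fun z => ((hB i).contDiffAt (ho.mem_nhds (hw.2 z))).comp z
      (contDiff_id.prodMk hw.1).contDiffAt
  have hZc : ∀ i, HasCompactSupport fun z => η z * B i (z, w z) a := fun i => hηc.mul_right
  have hzero : ∫ y, fderiv ℝ (fun p : ℝ × Space n => ℓ p - ℓ (0, p.2)) (0, y) (1, 0) = 0 := by
    refine integral_fderiv_eq_zero_of_integral_eq_zero hδ ?_ (K := tsupport ψ) hψc ?_ ?_
    · refine ContDiffOn.of_le (hℓs.sub (hℓs.comp (f := fun p : ℝ × Space n => ((0 : ℝ), p.2))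
        (by fun_prop) fun p _ => ⟨hm, mem_univ _⟩)) (by simp)
    · intro s _ y hy
      have h1 : ψ y = 0 := image_eq_zero_of_notMem_tsupport hy
      have h2 : fderiv ℝ ψ y = 0 := by
        have := notMem_tsupport_iff_eventuallyEq.1 hy
        rw [this.fderiv_eq]; simp
      simp [hℓ, h1, h2]
    · intro s hs
      have hw0 : w + (0 : ℝ) • ψ = w := by simp
      simp_rw [hℓdiv s hs, hℓdiv 0 hm, hw0]
      refine integral_divergence_sub_eq_zero
        ((contDiff_local hI hJ hX (hfield s hs)).of_le (by simp))
        ((contDiff_local hI hJ hX hw).of_le (by simp)) ?_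
      exact hasCompactSupport_local_sub X w hψc.smul_left
  simp_rw [hderiv] at hzero
  rw [integral_add, integral_finsetSum] at hzero
  · simpa [fun i => integral_fderiv_apply_eq_zero ((hZs i).of_le (by simp)) (hZc i)] using hzero
  · intro i _
    exact ((((hZs i).continuous_fderiv (by simp))).clm_apply
      continuous_const).integrable_of_hasCompactSupport ((hZc i).fderiv_apply ℝ _)
  · exact (hη.continuous.mul hFc).integrable_of_hasCompactSupport hηc.mul_right
  · refine integrable_finsetSum _ fun i _ => ?_
    exact ((((hZs i).continuous_fderiv (by simp))).clm_apply
      continuous_const).integrable_of_hasCompactSupport ((hZc i).fderiv_apply ℝ _)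

/-- There is a field with a given value at `x` and, up to a positive factor, a given derivative. -/
theorem exists_isField_fderiv_eq (hI : IsOpen I) (hJ : IsOpen J) (x : Space n) {v : State n}
    (hv : v ∈ phase n I J) (M : Space n →L[ℝ] State n) :
    ∃ w : Space n → State n, IsField I J w ∧ w x = v ∧ ∃ ε > 0, fderiv ℝ w x = (ε : ℝ) • M := by
  -- A linear field with slope `M` is cut off near `x` and added to the constant `v`. It has to be
  -- scaled down to keep the values in `I` and `J`, which is why the derivative is prescribed only
  -- up to a positive factor.
  let χ : ContDiffBump x := ⟨1, 2, one_pos, one_lt_two⟩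
  set ψ : Space n → State n := fun y => χ y • M (y - x) with hψdef
  have hψ : ContDiff ℝ ∞ ψ := χ.contDiff.smul (M.contDiff.comp (contDiff_id.sub contDiff_const))
  have hc : HasCompactSupport ψ := χ.hasCompactSupport.smul_right
  have h0 : IsField I J fun _ : Space n => v := ⟨contDiff_const, fun _ => hv⟩
  obtain ⟨δ, hδ, hf⟩ := exists_forall_isField_add_smul hI hJ h0 hψ hc
  refine ⟨_, hf (δ / 2) ⟨by linarith, by linarith⟩, by simp [hψdef], δ / 2, by linarith, ?_⟩
  have h1 : ψ =ᶠ[𝓝 x] fun y => M (y - x) := by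
    filter_upwards [χ.eventuallyEq_one] with y hy
    simp [hψdef, hy]
  have h2 : fderiv ℝ ψ x = M := by
    rw [h1.fderiv_eq]
    exact (M.hasFDerivAt.comp x ((hasFDerivAt_id x).sub_const x)).fderiv
  rw [fderiv_add (differentiableAt_const _) ((hψ.differentiable (by simp) x).const_smul _),
    fderiv_const_smul (hψ.differentiable (by simp) x), h2]
  simp

/-- A Lagrangian `A(x, w) + ∑ Bⁱ(x, w) ∂ᵢw` that is a divergence satisfies `dA = ∑ ∂Bⁱ/∂xⁱ`, and
each `Bⁱ(x, ·)` is a closed form. -/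
theorem affine_null_lagrangian (hI : IsOpen I) (hJ : IsOpen J)
    (hA : ContDiffOn ℝ ∞ A {q | q.2 ∈ phase n I J})
    (hB : ∀ i, ContDiffOn ℝ ∞ (B i) {q | q.2 ∈ phase n I J}) {k : ℕ}
    {X : Space n → Jet n k → Space n}
    (hX : ContDiffOn ℝ ∞ (fun q : Space n × Jet n k => X q.1 q.2) {q | q.2.1 ∈ phase n I J})
    (h : ∀ w, IsField I J w → ∀ x,
      A (x, w x) + ∑ i, B i (x, w x) (fderiv ℝ w x (EuclideanSpace.single i 1))
        = divergence (fun y => X y (jet k w y)) x)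
    (x : Space n) {v : State n} (hv : v ∈ phase n I J) (a : State n) :
    fderiv ℝ A (x, v) (0, a) = ∑ i, fderiv ℝ (B i) (x, v) (EuclideanSpace.single i 1, 0) a ∧
      ∀ i b, fderiv ℝ (B i) (x, v) (0, a) b = fderiv ℝ (B i) (x, v) (0, b) a := by
  have h0 : fderiv ℝ A (x, v) (0, a)
      = ∑ i, fderiv ℝ (B i) (x, v) (EuclideanSpace.single i 1, 0) a := by
    -- On a constant field only the explicit `x`-derivatives of `Bⁱ` survive.
    have := affineEulerLagrange_eq_zero hI hJ hA hB hX h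
      (w := fun _ => v) ⟨contDiff_const, fun _ => hv⟩ a x
    simp only [affineEulerLagrange, fderiv_fun_const, Pi.zero_apply,
      zero_apply, map_zero, zero_sub, Finset.sum_neg_distrib] at this
    linarith
  refine ⟨h0, fun i b => ?_⟩
  -- The field varies to first order only along the `i`-th axis, in the state direction `b`. Given
  -- `h0`, the Euler–Lagrange expression then reduces to `ε` times the `(a, b)` component of the
  -- exterior derivative of `Bⁱ`.
  obtain ⟨w, hw, hwx, ε, hε, hdw⟩ := exists_isField_fderiv_eq hI hJ x hv
    ((EuclideanSpace.proj (𝕜 := ℝ) i).smulRight b)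
  have := affineEulerLagrange_eq_zero hI hJ hA hB hX h hw a x
  have hd : ∀ j : Fin n, fderiv ℝ w x (EuclideanSpace.single j 1)
      = if j = i then ε • b else 0 := by
    intro j
    rw [hdw]
    by_cases hji : j = i
    · subst hji; simp
    · simp [hji, Ne.symm hji]
  have hsplit : ∀ (j : Fin n) (c : State n),
      fderiv ℝ (B j) (x, v) (0, a) c - fderiv ℝ (B j) (x, v) (EuclideanSpace.single j 1, c) a
        = (fderiv ℝ (B j) (x, v) (0, a) c - fderiv ℝ (B j) (x, v) (0, c) a)
          - fderiv ℝ (B j) (x, v) (EuclideanSpace.single j 1, 0) a := by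
    intro j c
    rw [sub_sub, ← add_apply, ← map_add]
    simp
  simp only [affineEulerLagrange, hwx, hsplit, h0, hd, Finset.sum_sub_distrib] at this
  rw [add_comm, sub_add_cancel, ← Finset.sum_sub_distrib, Finset.sum_eq_single i] at this
  · simp only [if_true, map_smul, smul_eq_mul] at this
    have e1 : ((0 : Space n), ε • b) = ε • ((0 : Space n), b) := by simp
    rw [e1, map_smul, smul_apply, smul_eq_mul] at this
    have : ε * (fderiv ℝ (B i) (x, v) (0, a) b - fderiv ℝ (B i) (x, v) (0, b) a) = 0 := by
      linarith
    rcases mul_eq_zero.1 this with h1 | h1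
    · exact absurd h1 hε.ne'
    · linarith
  · intro j _ hj
    have e0 : ((0 : Space n), (0 : State n)) = 0 := rfl
    simp [hj, e0]
  · simp

/-- A function of `(x, w)` that is a divergence does not depend on `w`. -/
theorem eq_of_eq_divergence (hI : IsOpen I) (hJ : IsOpen J) (hI' : I.OrdConnected)
    (hJ' : J.OrdConnected) (hA : ContDiffOn ℝ ∞ A {q | q.2 ∈ phase n I J}) {k : ℕ}
    {X : Space n → Jet n k → Space n}
    (hX : ContDiffOn ℝ ∞ (fun q : Space n × Jet n k => X q.1 q.2) {q | q.2.1 ∈ phase n I J})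
    (h : ∀ w, IsField I J w → ∀ x, A (x, w x) = divergence (fun y => X y (jet k w y)) x)
    (x : Space n) {v w : State n} (hv : v ∈ phase n I J) (hw : w ∈ phase n I J) :
    A (x, v) = A (x, w) := by
  have ho : IsOpen {q : Space n × State n | q.2 ∈ phase n I J} :=
    (isOpen_phase hI hJ).preimage continuous_snd
  refine eq_of_fderiv_apply_sub_eq_zero (s := {q : Space n × State n | q.2 ∈ phase n I J})
    (f := A) ho
    ((convex_phase hI' hJ').linear_preimage (LinearMap.snd ℝ (Space n) (State n)))
    (hA.differentiableOn (by simp)) hw hv fun z hz => ?_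
  have := (affine_null_lagrangian (B := fun _ _ => 0) hI hJ hA (fun _ => contDiffOn_const) hX
    (by simpa using h) z.1 (v := z.2) hz (v - w)).1
  simpa using this

end Euler

namespace Euler

variable {n : ℕ} {I J : Set ℝ} {P : ℝ → ℝ → ℝ}

/-! ### Kinematic functions -/

theorem isOpen_kinematic_domain (hI : IsOpen I) (hJ : IsOpen J) :
    IsOpen {q : ℝ × Space n × State n | q.2.2 ∈ phase n I J} :=
  (isOpen_phase hI hJ).preimage (by fun_prop)

theorem IsSmoothKinematic.contDiffAt {T : Kinematic n ℝ} (hT : IsSmoothKinematic I J T)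
    (hI : IsOpen I) (hJ : IsOpen J) (t : ℝ) (x : Space n) {v : State n} (hv : v ∈ phase n I J) :
    ContDiffAt ℝ ∞ (uncurried T) (t, x, v) :=
  ContDiffOn.contDiffAt hT ((isOpen_kinematic_domain hI hJ).mem_nhds hv)

theorem IsSmoothKinematic.differentiableAt {T : Kinematic n ℝ} (hT : IsSmoothKinematic I J T)
    (hI : IsOpen I) (hJ : IsOpen J) (t : ℝ) (x : Space n) {v : State n} (hv : v ∈ phase n I J) :
    DifferentiableAt ℝ (uncurried T) (t, x, v) :=
  (hT.contDiffAt hI hJ t x hv).differentiableAt (by simp)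

/-- The total time derivative of `T` in a frame that moves with the fluid. -/
theorem timeDeriv_add_divergence_smul {T : Kinematic n ℝ} {t : ℝ} {w : Space n → State n}
    {x : Space n} (hT : DifferentiableAt ℝ (uncurried T) (t, x, w x))
    (hw : DifferentiableAt ℝ w x) :
    timeDeriv P T t w x + divergence (fun y => onField T t w y • (w y).1) x
      = fderiv ℝ (uncurried T) (t, x, w x) (1, (w x).1,
          (-(((w x).2.1)⁻¹ • gradient (fun y => P (w y).2.1 (w y).2.2) x),
            -((w x).2.1 * divergence (fun y => (w y).1) x), 0))
        + onField T t w x * divergence (fun y => (w y).1) x := by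
  have hw1 : HasFDerivAt (fun y => (w y).1)
      ((ContinuousLinearMap.fst ℝ (Space n) (ℝ × ℝ)).comp (fderiv ℝ w x)) x :=
    (ContinuousLinearMap.fst ℝ (Space n) (ℝ × ℝ)).hasFDerivAt.comp x hw.hasFDerivAt
  have hw2 : HasFDerivAt (fun y => (w y).2.1)
      (((ContinuousLinearMap.fst ℝ ℝ ℝ).comp (ContinuousLinearMap.snd ℝ (Space n) (ℝ × ℝ))).comp
        (fderiv ℝ w x)) x :=
    ((ContinuousLinearMap.fst ℝ ℝ ℝ).comp
      (ContinuousLinearMap.snd ℝ (Space n) (ℝ × ℝ))).hasFDerivAt.comp x hw.hasFDerivAt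
  have hw3 : HasFDerivAt (fun y => (w y).2.2)
      (((ContinuousLinearMap.snd ℝ ℝ ℝ).comp (ContinuousLinearMap.snd ℝ (Space n) (ℝ × ℝ))).comp
        (fderiv ℝ w x)) x :=
    ((ContinuousLinearMap.snd ℝ ℝ ℝ).comp
      (ContinuousLinearMap.snd ℝ (Space n) (ℝ × ℝ))).hasFDerivAt.comp x hw.hasFDerivAt
  have hTw : HasFDerivAt (fun y => onField T t w y)
      ((fderiv ℝ (uncurried T) (t, x, w x)).comp
        ((0 : Space n →L[ℝ] ℝ).prod ((ContinuousLinearMap.id ℝ (Space n)).prod (fderiv ℝ w x)))) x :=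
    HasFDerivAt.comp (g := uncurried T) (f := fun y => (t, y, w y)) x hT.hasFDerivAt
      ((hasFDerivAt_const t x).prodMk ((hasFDerivAt_id x).prodMk hw.hasFDerivAt))
  rw [divergence_smul hTw.differentiableAt hw1.differentiableAt, hTw.fderiv]
  unfold timeDeriv eulerRHS
  rw [divergence_smul hw2.differentiableAt hw1.differentiableAt, hw1.fderiv, hw2.fderiv,
    hw3.fderiv]
  set L := fderiv ℝ (uncurried T) (t, x, w x)
  set g := gradient (fun y => P (w y).2.1 (w y).2.2) x
  set d := divergence (fun y => (w y).1) x
  set p := fderiv ℝ w x (w x).1 with hp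
  -- The material derivative: the Eulerian rate of change plus transport along `u` removes every
  -- advection term. The component along `S` becomes zero because entropy is carried by the flow.
  have : ((1 : ℝ), (w x).1, (-(((w x).2.1)⁻¹ • g), -((w x).2.1 * d), (0 : ℝ)))
      = (1, 0, (-p.1 - ((w x).2.1)⁻¹ • g, -((w x).2.1 * d + p.2.1), -p.2.2))
        + (0, (w x).1, p) := by
    simp only [Prod.mk_add_mk, add_zero, zero_add]
    refine Prod.ext rfl (Prod.ext rfl (Prod.ext ?_ (Prod.ext ?_ ?_)))
    · simp only [Prod.fst_add]; abel
    · simp only [Prod.snd_add, Prod.fst_add]; ring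
    · simp
  rw [this, map_add]
  simp only [ContinuousLinearMap.comp_apply, ContinuousLinearMap.prod_apply, zero_apply,
    ContinuousLinearMap.id_apply, ContinuousLinearMap.coe_fst', ContinuousLinearMap.coe_snd', ← hp]
  ring

/-- The densities `ρ(β(½|u|² + e) + α·u + h)` with `β, α` functions of `(t, x)` and `h` a function
of `(t, x, S)`. -/
def affineDensity (e : ℝ → ℝ → ℝ) (β : ℝ × Space n → ℝ) (α : ℝ × Space n → Space n)
    (h : ℝ × Space n × ℝ → ℝ) : Kinematic n ℝ := fun t x u ρ S =>
  ρ * (β (t, x) * (‖u‖ ^ 2 / 2 + e ρ S) + inner ℝ (α (t, x)) u + h (t, x, S))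

variable {e : ℝ → ℝ → ℝ} {β : ℝ × Space n → ℝ} {α : ℝ × Space n → Space n}
  {h : ℝ × Space n × ℝ → ℝ}

theorem isSmoothKinematic_affineDensity
    (he : ContDiffOn ℝ ∞ (fun q : ℝ × ℝ => e q.1 q.2) (I ×ˢ J)) (hβ : ContDiff ℝ ∞ β)
    (hα : ContDiff ℝ ∞ α) (hh : ContDiffOn ℝ ∞ h {q | q.2.2 ∈ J}) :
    IsSmoothKinematic I J (affineDensity e β α h) := by
  unfold IsSmoothKinematic uncurried affineDensity
  have h1 : ContDiff ℝ ∞ fun q : ℝ × Space n × State n => (q.1, q.2.1) := by fun_prop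
  have h2 : ContDiffOn ℝ ∞ (fun q : ℝ × Space n × State n => e q.2.2.2.1 q.2.2.2.2)
      {q | q.2.2.2.1 ∈ I ∧ q.2.2.2.2 ∈ J} :=
    he.comp (f := fun q : ℝ × Space n × State n => (q.2.2.2.1, q.2.2.2.2)) (by fun_prop)
      fun q hq => hq
  have h3 : ContDiffOn ℝ ∞ (fun q : ℝ × Space n × State n => h (q.1, q.2.1, q.2.2.2.2))
      {q | q.2.2.2.1 ∈ I ∧ q.2.2.2.2 ∈ J} :=
    hh.comp (f := fun q : ℝ × Space n × State n => (q.1, q.2.1, q.2.2.2.2)) (by fun_prop)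
      fun q hq => hq.2
  have hρ : ContDiff ℝ ∞ fun q : ℝ × Space n × State n => q.2.2.2.1 := by fun_prop
  have hu : ContDiff ℝ ∞ fun q : ℝ × Space n × State n => q.2.2.1 := by fun_prop
  have hu2 : ContDiff ℝ ∞ fun q : ℝ × Space n × State n => ‖q.2.2.1‖ ^ 2 / 2 :=
    (hu.norm_sq ℝ).div_const 2
  exact hρ.contDiffOn.mul ((((hβ.comp h1).contDiffOn.mul (hu2.contDiffOn.add h2)).add
    (((hα.comp h1).inner ℝ hu).contDiffOn)).add h3)

/-- The local balance of the density `ρ(β(½|u|² + e) + α·u + h)`, where `e` is an internal energy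
for the pressure `P - p₀`. -/
theorem timeDeriv_affineDensity_add_divergence (hI : IsOpen I) (hJ : IsOpen J)
    (hIpos : I ⊆ Ioi 0) (hP : ContDiffOn ℝ ∞ (fun q : ℝ × ℝ => P q.1 q.2) (I ×ˢ J)) {p₀ : ℝ}
    (he : IsInternalEnergy I J (fun ρ S => P ρ S - p₀) e) (hβ : ContDiff ℝ ∞ β)
    (hα : ContDiff ℝ ∞ α) (hh : ContDiffOn ℝ ∞ h {q | q.2.2 ∈ J}) (t : ℝ)
    {w : Space n → State n} (hw : IsField I J w) (x : Space n) :
    timeDeriv P (affineDensity e β α h) t w x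
      + divergence (fun y => onField (affineDensity e β α h) t w y • (w y).1
          + (P (w y).2.1 (w y).2.2 - p₀) • (β (t, y) • (w y).1 + α (t, y))) x
      = (w x).2.1 * (fderiv ℝ β (t, x) (1, (w x).1) * (‖(w x).1‖ ^ 2 / 2 + e (w x).2.1 (w x).2.2)
          + inner ℝ (fderiv ℝ α (t, x) (1, (w x).1)) (w x).1
          + fderiv ℝ h (t, x, (w x).2.2) (1, (w x).1, 0))
        + (P (w x).2.1 (w x).2.2 - p₀) * (fderiv ℝ β (t, x) (0, (w x).1)
          + ∑ i, fderiv ℝ α (t, x) (0, EuclideanSpace.single i 1) i) := by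
  have hT := isSmoothKinematic_affineDensity he.1 hβ hα hh
  have hTd := hT.differentiableAt hI hJ t x (hw.2 x)
  have hwd : DifferentiableAt ℝ w x := hw.1.differentiable (by simp) x
  have hβd : DifferentiableAt ℝ β (t, x) := hβ.differentiable (by simp) _
  have hαd : DifferentiableAt ℝ α (t, x) := hα.differentiable (by simp) _
  have hhd : DifferentiableAt ℝ h (t, x, (w x).2.2) :=
    (hh.contDiffAt ((hJ.preimage (by fun_prop : Continuous fun q : ℝ × Space n × ℝ =>
      q.2.2)).mem_nhds (hw.2 x).2)).differentiableAt (by simp)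
  have hPd : DifferentiableAt ℝ (fun q : ℝ × ℝ => P q.1 q.2) ((w x).2.1, (w x).2.2) :=
    (hP.contDiffAt ((hI.prod hJ).mem_nhds (hw.2 x))).differentiableAt (by simp)
  have hρ : (w x).2.1 ≠ 0 := (hIpos (hw.2 x).1).ne'
  set u := (w x).1 with hu
  set ρ := (w x).2.1 with hρdef
  set S := (w x).2.2 with hS
  have hpd : DifferentiableAt ℝ (fun y => P (w y).2.1 (w y).2.2) x :=
    DifferentiableAt.comp (g := fun q : ℝ × ℝ => P q.1 q.2)
      (f := fun y => ((w y).2.1, (w y).2.2)) x hPd (by fun_prop)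
  have hud : DifferentiableAt ℝ (fun y => (w y).1) x := by fun_prop
  have hβx : HasFDerivAt (fun y => β (t, y))
      ((fderiv ℝ β (t, x)).comp (ContinuousLinearMap.inr ℝ ℝ (Space n))) x :=
    hβd.hasFDerivAt.comp x (hasFDerivAt_prodMk_right t x)
  have hαx : HasFDerivAt (fun y => α (t, y))
      ((fderiv ℝ α (t, x)).comp (ContinuousLinearMap.inr ℝ ℝ (Space n))) x :=
    hαd.hasFDerivAt.comp x (hasFDerivAt_prodMk_right t x)
  have hTu : DifferentiableAt ℝ (fun y => onField (affineDensity e β α h) t w y • (w y).1) x :=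
    (DifferentiableAt.comp (g := uncurried (affineDensity e β α h)) (f := fun y => (t, y, w y)) x
      hTd (by fun_prop)).smul hud
  have hvd : DifferentiableAt ℝ (fun y => β (t, y) • (w y).1 + α (t, y)) x :=
    (hβx.differentiableAt.fun_smul hud).add hαx.differentiableAt
  set d := divergence (fun y => (w y).1) x with hd
  set g := gradient (fun y => P (w y).2.1 (w y).2.2) x with hg
  have hgrad : ∀ v, fderiv ℝ (fun y => P (w y).2.1 (w y).2.2) x v = inner ℝ g v := fun v => by
    rw [hg, gradient, InnerProductSpace.toDual_symm_apply]
  have hdivα : divergence (fun y => α (t, y)) x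
      = ∑ i, fderiv ℝ α (t, x) (0, EuclideanSpace.single i 1) i := by
    simp [divergence, hαx.fderiv]
  have hflux : divergence (fun y => (P (w y).2.1 (w y).2.2 - p₀)
        • (β (t, y) • (w y).1 + α (t, y))) x
      = (P ρ S - p₀) * (β (t, x) * d + fderiv ℝ β (t, x) (0, u)
          + ∑ i, fderiv ℝ α (t, x) (0, EuclideanSpace.single i 1) i)
        + inner ℝ g (β (t, x) • u + α (t, x)) := by
    rw [divergence_smul (hpd.sub_const p₀) hvd,
      divergence_add (hβx.differentiableAt.fun_smul hud) hαx.differentiableAt,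
      divergence_smul hβx.differentiableAt hud, fderiv_sub_const, hgrad, hdivα, hβx.fderiv]
    simp [← hd, ← hu, ← hρdef, ← hS]
  rw [divergence_add hTu ((hpd.sub_const p₀).fun_smul hvd), ← add_assoc,
    timeDeriv_add_divergence_smul hTd hwd, hflux]
  set a : Space n := -(ρ⁻¹ • g) with ha
  set r : ℝ := -(ρ * d) with hr
  -- The derivative is read off along the curve `(t + s, x + su, u + sa, ρ + sr, S)`. The entropy is
  -- frozen, so the only derivative of `e` needed is `e_ρ`, which is the one that `he` provides.
  have hlin : fderiv ℝ (uncurried (affineDensity e β α h)) (t, x, w x) (1, u, (a, r, 0))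
      = r * (β (t, x) * (‖u‖ ^ 2 / 2 + e ρ S) + inner ℝ (α (t, x)) u + h (t, x, S))
        + ρ * ((fderiv ℝ β (t, x) (1, u) * (‖u‖ ^ 2 / 2 + e ρ S)
            + β (t, x) * (inner ℝ u a + (ρ ^ 2)⁻¹ * (P ρ S - p₀) * r))
          + (inner ℝ (α (t, x)) a + inner ℝ (fderiv ℝ α (t, x) (1, u)) u)
          + fderiv ℝ h (t, x, S) (1, u, 0)) := by
    have hs1 : HasDerivAt (fun s : ℝ => t + s) 1 0 := (hasDerivAt_id (0 : ℝ)).const_add t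
    have hs2 : HasDerivAt (fun s : ℝ => x + s • u) u 0 := by
      simpa using ((hasDerivAt_id (0 : ℝ)).smul_const u).const_add x
    have hs3 : HasDerivAt (fun s : ℝ => u + s • a) a 0 := by
      have := ((hasDerivAt_id (0 : ℝ)).smul_const a).const_add u
      rwa [one_smul] at this
    have hs4 : HasDerivAt (fun s : ℝ => ρ + s * r) r 0 := by
      simpa using ((hasDerivAt_id (0 : ℝ)).mul_const r).const_add ρ
    have hl : HasDerivAt (fun s : ℝ => uncurried (affineDensity e β α h)
        (t + s, x + s • u, u + s • a, ρ + s * r, S))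
        (fderiv ℝ (uncurried (affineDensity e β α h)) (t, x, w x) (1, u, (a, r, 0))) 0 := by
      have hbase : (t, x, w x) = (t + (0 : ℝ), x + (0 : ℝ) • u, u + (0 : ℝ) • a,
          ρ + (0 : ℝ) * r, S) := by simp [hu, hρdef, hS]
      refine HasFDerivAt.comp_hasDerivAt (l := uncurried (affineDensity e β α h))
        (f := fun s : ℝ => (t + s, x + s • u, u + s • a, ρ + s * r, S)) 0 ?_
        (hs1.prodMk (hs2.prodMk (hs3.prodMk (hs4.prodMk (hasDerivAt_const _ _)))))
      rw [← hbase]; exact hTd.hasFDerivAt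
    have hβs : HasDerivAt (fun s : ℝ => β (t + s, x + s • u)) (fderiv ℝ β (t, x) (1, u)) 0 :=
      HasFDerivAt.comp_hasDerivAt (l := β) (f := fun s : ℝ => (t + s, x + s • u)) 0
        (by simpa using hβd.hasFDerivAt) (hs1.prodMk hs2)
    have hαs : HasDerivAt (fun s : ℝ => α (t + s, x + s • u)) (fderiv ℝ α (t, x) (1, u)) 0 :=
      HasFDerivAt.comp_hasDerivAt (l := α) (f := fun s : ℝ => (t + s, x + s • u)) 0
        (by simpa using hαd.hasFDerivAt) (hs1.prodMk hs2)
    have hhs : HasDerivAt (fun s : ℝ => h (t + s, x + s • u, S))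
        (fderiv ℝ h (t, x, S) (1, u, 0)) 0 :=
      HasFDerivAt.comp_hasDerivAt (l := h) (f := fun s : ℝ => (t + s, x + s • u, S)) 0
        (by simpa using hhd.hasFDerivAt) (hs1.prodMk (hs2.prodMk (hasDerivAt_const _ _)))
    have hes : HasDerivAt (fun s : ℝ => e (ρ + s * r) S) ((ρ ^ 2)⁻¹ * (P ρ S - p₀) * r) 0 :=
      HasDerivAt.comp (h₂ := fun r => e r S) (h := fun s : ℝ => ρ + s * r) 0
        (by simpa using he.2 ρ (hw.2 x).1 S (hw.2 x).2) hs4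
    have hus : HasDerivAt (fun s : ℝ => ‖u + s • a‖ ^ 2 / 2) (inner ℝ u a) 0 := by
      have := (hs3.norm_sq).div_const 2
      simpa using this
    have hfin := hs4.fun_mul (((hβs.fun_mul (hus.fun_add hes)).fun_add (hαs.inner ℝ hs3)).fun_add hhs)
    have huniq := hl.unique hfin
    rw [huniq]
    simp
  rw [hlin]
  have hon : onField (affineDensity e β α h) t w x
      = ρ * (β (t, x) * (‖u‖ ^ 2 / 2 + e ρ S) + inner ℝ (α (t, x)) u + h (t, x, S)) := rfl
  -- Three cancellations remain: the change of `ρ` against `T div u`, the acceleration `-ρ⁻¹∇p`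
  -- against the pressure gradient in the flux, and `ρβe_ρρ_t` against `(P - p₀)β div u`.
  rw [hon, hr, ha]
  simp only [inner_neg_right, inner_smul_right, inner_add_right]
  rw [real_inner_comm g u, real_inner_comm g (α (t, x))]
  field_simp
  ring

end Euler

namespace Euler

variable {n : ℕ} {I J : Set ℝ} {P : ℝ → ℝ → ℝ} {T T₁ T₂ : Kinematic n ℝ}

/-! ### The space of conserved densities -/

/-- Truncation of jets. -/
def Jet.truncate {k m : ℕ} (hkm : k ≤ m) (z : Jet n m) : Jet n k :=
  (z.1, fun j => z.2 (Fin.castLE hkm j))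

theorem Jet.contDiff_truncate {k m : ℕ} (hkm : k ≤ m) :
    ContDiff ℝ ∞ (Jet.truncate (n := n) hkm) :=
  contDiff_fst.prodMk (contDiff_pi.2 fun j =>
    (ContinuousLinearMap.proj (R := ℝ) (φ := fun j : Fin m =>
      ContinuousMultilinearMap ℝ (fun _ : Fin (j.val + 1) => Space n) (State n))
        (Fin.castLE hkm j)).contDiff.comp contDiff_snd)

theorem Jet.truncate_jet {k m : ℕ} (hkm : k ≤ m) (w : Space n → State n) (x : Space n) :
    Jet.truncate hkm (jet m w x) = jet k w x := rfl

/-- Fluxes of different orders can be added after both are regarded as functions of the longer jet.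
-/
theorem IsSmoothLocal.truncate {k m : ℕ} (hkm : k ≤ m) {X : ℝ → Space n → Jet n k → Space n}
    (hX : IsSmoothLocal I J X) :
    IsSmoothLocal I J fun t x (z : Jet n m) => X t x (z.truncate hkm) := by
  have h1 : ContDiff ℝ ∞ fun q : ℝ × Space n × Jet n m => (q.1, q.2.1, q.2.2.truncate hkm) :=
    contDiff_fst.prodMk ((contDiff_fst.comp contDiff_snd).prodMk
      ((Jet.contDiff_truncate hkm).comp (contDiff_snd.comp contDiff_snd)))
  exact ContDiffOn.comp (g := fun q : ℝ × Space n × Jet n k => X q.1 q.2.1 q.2.2) hX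
    h1.contDiffOn fun q hq => hq

theorem IsSmoothLocal.slice {k : ℕ} {X : ℝ → Space n → Jet n k → Space n}
    (hX : IsSmoothLocal I J X) (t : ℝ) :
    ContDiffOn ℝ ∞ (fun q : Space n × Jet n k => X t q.1 q.2) {q | q.2.1 ∈ phase n I J} :=
  ContDiffOn.comp (g := fun q : ℝ × Space n × Jet n k => X q.1 q.2.1 q.2.2)
    (f := fun q : Space n × Jet n k => (t, q.1, q.2)) hX
    (contDiff_const.prodMk contDiff_id).contDiffOn fun _ hq => hq

theorem IsSmoothLocal.differentiableAt {k : ℕ} {X : ℝ → Space n → Jet n k → Space n}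
    (hX : IsSmoothLocal I J X) (hI : IsOpen I) (hJ : IsOpen J) (t : ℝ) {w : Space n → State n}
    (hw : IsField I J w) (x : Space n) : DifferentiableAt ℝ (fun y => X t y (jet k w y)) x :=
  (contDiff_local hI hJ (hX.slice t) hw).differentiable (by simp) x

/-- The domain is open, so the derivative is insensitive to the values that a kinematic function
takes outside `I` and `J`. -/
theorem timeDeriv_congr (hI : IsOpen I) (hJ : IsOpen J)
    (h : ∀ t x, ∀ u : Space n, ∀ ρ ∈ I, ∀ S ∈ J, T₁ t x u ρ S = T₂ t x u ρ S) (t : ℝ)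
    {w : Space n → State n} (hw : IsField I J w) (x : Space n) :
    timeDeriv P T₁ t w x = timeDeriv P T₂ t w x := by
  unfold timeDeriv
  rw [Filter.EventuallyEq.fderiv_eq (f₁ := uncurried T₁) (f := uncurried T₂)]
  filter_upwards [(isOpen_kinematic_domain hI hJ).mem_nhds (x := (t, x, w x)) (hw.2 x)] with q hq
  exact h _ _ _ _ hq.1 _ hq.2

theorem IsConserved.congr (hI : IsOpen I) (hJ : IsOpen J) (h₁ : IsConserved I J P T₁)
    (h : ∀ t x, ∀ u : Space n, ∀ ρ ∈ I, ∀ S ∈ J, T₁ t x u ρ S = T₂ t x u ρ S) :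
    IsConserved I J P T₂ := by
  obtain ⟨k, X, hX, hdiv⟩ := h₁
  refine ⟨k, X, hX, fun t w hw x => ?_⟩
  rw [← timeDeriv_congr hI hJ h t hw x, hdiv t w hw x]

/-- Smooth conserved densities. -/
def IsSmoothConserved (I J : Set ℝ) (P : ℝ → ℝ → ℝ) (T : Kinematic n ℝ) : Prop :=
  IsSmoothKinematic I J T ∧ IsConserved I J P T

theorem IsSmoothConserved.add (hI : IsOpen I) (hJ : IsOpen J) (h₁ : IsSmoothConserved I J P T₁)
    (h₂ : IsSmoothConserved I J P T₂) : IsSmoothConserved I J P (T₁ + T₂) := by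
  refine ⟨ContDiffOn.add h₁.1 h₂.1, ?_⟩
  obtain ⟨k₁, X₁, hX₁, hdiv₁⟩ := h₁.2
  obtain ⟨k₂, X₂, hX₂, hdiv₂⟩ := h₂.2
  have hX₁' := hX₁.truncate (le_max_left k₁ k₂)
  have hX₂' := hX₂.truncate (le_max_right k₁ k₂)
  refine ⟨max k₁ k₂, fun t x z => X₁ t x (z.truncate (le_max_left k₁ k₂))
    + X₂ t x (z.truncate (le_max_right k₁ k₂)), ContDiffOn.add hX₁' hX₂', fun t w hw x => ?_⟩
  have e1 : timeDeriv P (T₁ + T₂) t w x = timeDeriv P T₁ t w x + timeDeriv P T₂ t w x := by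
    unfold timeDeriv
    have : uncurried (T₁ + T₂) = uncurried T₁ + uncurried T₂ := rfl
    rw [this, fderiv_add (h₁.1.differentiableAt hI hJ t x (hw.2 x))
      (h₂.1.differentiableAt hI hJ t x (hw.2 x))]
    rfl
  have h1 := hdiv₁ t w hw x
  have h2 := hdiv₂ t w hw x
  have e2 := divergence_add (hX₁'.differentiableAt hI hJ t hw x)
    (hX₂'.differentiableAt hI hJ t hw x)
  simp only [Jet.truncate_jet] at e2
  rw [e1]
  refine Eq.trans (congrArg (_ + ·) e2) ?_
  linarith

theorem IsSmoothConserved.smul (hI : IsOpen I) (hJ : IsOpen J) (h : IsSmoothConserved I J P T)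
    (c : ℝ) : IsSmoothConserved I J P (c • T) := by
  refine ⟨ContDiffOn.const_smul c h.1, ?_⟩
  obtain ⟨k, X, hX, hdiv⟩ := h.2
  refine ⟨k, fun t x z => c • X t x z, ContDiffOn.const_smul c hX, fun t w hw x => ?_⟩
  have e1 : timeDeriv P (c • T) t w x = c * timeDeriv P T t w x := by
    unfold timeDeriv
    have : uncurried (c • T) = c • uncurried T := rfl
    rw [this, fderiv_const_smul (h.1.differentiableAt hI hJ t x (hw.2 x))]
    rfl
  rw [e1]
  refine Eq.trans (congrArg (_ + ·)
    (divergence_const_smul (hX.differentiableAt hI hJ t hw x) c)) ?_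
  rw [← mul_add, hdiv t w hw x, mul_zero]

theorem IsSmoothConserved.sub (hI : IsOpen I) (hJ : IsOpen J) (h₁ : IsSmoothConserved I J P T₁)
    (h₂ : IsSmoothConserved I J P T₂) : IsSmoothConserved I J P (T₁ - T₂) := by
  have := h₁.add hI hJ (h₂.smul hI hJ (-1))
  rwa [neg_one_smul, ← sub_eq_add_neg] at this

/-- The density of a function of `(t, x)` alone. -/
def background (g : ℝ × Space n → ℝ) : Kinematic n ℝ := fun t x _ _ _ => g (t, x)

theorem isSmoothLocal_background {Θ : ℝ × Space n → Space n} (hΘ : ContDiff ℝ ∞ Θ) :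
    IsSmoothLocal I J fun t x (_ : Jet n 0) => Θ (t, x) :=
  (hΘ.comp (contDiff_fst.prodMk (contDiff_fst.comp contDiff_snd))).contDiffOn

theorem isTrivial_background (hn : 0 < n) {g : ℝ × Space n → ℝ} (hg : ContDiff ℝ ∞ g) :
    IsTrivial I J (background g) := by
  obtain ⟨Θ, hΘ, hdiv⟩ := exists_divergence_eq hn hg
  exact ⟨0, _, isSmoothLocal_background hΘ, fun t w _ x => (hdiv t x).symm⟩

/-- The time derivative is `g_t`, again a function of `(t, x)`; a flux is obtained by solving `div Θ
= -g_t`. -/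
theorem isSmoothConserved_background (hn : 0 < n) {g : ℝ × Space n → ℝ} (hg : ContDiff ℝ ∞ g) :
    IsSmoothConserved I J P (background g) := by
  refine ⟨(hg.comp (contDiff_fst.prodMk (contDiff_fst.comp contDiff_snd))).contDiffOn, ?_⟩
  have hg' : ContDiff ℝ ∞ fun q => -fderiv ℝ g q (1, 0) :=
    ((hg.fderiv_right (by simp)).clm_apply contDiff_const).neg
  obtain ⟨Θ, hΘ, hdiv⟩ := exists_divergence_eq hn hg'
  refine ⟨0, _, isSmoothLocal_background hΘ, fun t w _ x => ?_⟩
  have : timeDeriv P (background g) t w x = fderiv ℝ g (t, x) (1, 0) := by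
    unfold timeDeriv
    have h1 : HasFDerivAt (uncurried (background g)) _ (t, x, w x) :=
      HasFDerivAt.comp (g := g) (f := fun q : ℝ × Space n × State n => (q.1, q.2.1)) (t, x, w x)
        (hg.differentiable (by simp) (t, x)).hasFDerivAt
        (hasFDerivAt_fst.prodMk (hasFDerivAt_fst.comp _ hasFDerivAt_snd))
    rw [h1.fderiv]
    simp
  rw [this, hdiv t x]
  simp

theorem IsSmoothKinematic.slice (hT : IsSmoothKinematic I J T) (t : ℝ) :
    ContDiffOn ℝ ∞ (fun q : Space n × State n => uncurried T (t, q))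
      {q | q.2 ∈ phase n I J} :=
  ContDiffOn.comp (g := uncurried T) (f := fun q : Space n × State n => (t, q)) hT
    (contDiff_const.prodMk contDiff_id).contDiffOn fun _ hq => hq

/-- A trivial density of kinematic form depends on `(t, x)` only. -/
theorem IsTrivial.eq (hI : IsOpen I) (hJ : IsOpen J) (hI' : I.OrdConnected) (hJ' : J.OrdConnected)
    (hT : IsSmoothKinematic I J T) (h : IsTrivial I J T) (t : ℝ) (x : Space n) {v w : State n}
    (hv : v ∈ phase n I J) (hw : w ∈ phase n I J) :
    uncurried T (t, x, v) = uncurried T (t, x, w) := by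
  obtain ⟨k, Θ, hΘ, hdiv⟩ := h
  exact eq_of_eq_divergence hI hJ hI' hJ' (hT.slice t) (hΘ.slice t) (fun w hw x => hdiv t w hw x)
    x hv hw

/-- A smooth trivial density is conserved. -/
theorem IsTrivial.isSmoothConserved (hn : 0 < n) (hI : IsOpen I) (hJ : IsOpen J)
    (hI' : I.OrdConnected) (hJ' : J.OrdConnected) {v₀ : State n} (hv₀ : v₀ ∈ phase n I J)
    (hT : IsSmoothKinematic I J T) (h : IsTrivial I J T) : IsSmoothConserved I J P T := by
  refine ⟨hT, ?_⟩
  -- By `IsTrivial.eq` the density equals its value at the reference state `v₀`, so the background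
  -- case applies.
  have hg : ContDiff ℝ ∞ fun q : ℝ × Space n => uncurried T (q.1, q.2, v₀) := by
    rw [contDiff_iff_contDiffAt]
    intro q
    exact ContDiffAt.comp (f := fun q : ℝ × Space n => (q.1, q.2, v₀)) q
      (hT.contDiffAt hI hJ q.1 q.2 hv₀) (by fun_prop)
  refine (isSmoothConserved_background hn hg).2.congr hI hJ fun t x u ρ hρ S hS => ?_
  exact h.eq hI hJ hI' hJ' hT t x hv₀ (w := (u, ρ, S)) ⟨hρ, hS⟩

/-! ### The conservation laws -/

variable {e : ℝ → ℝ → ℝ} {β : ℝ × Space n → ℝ} {α : ℝ × Space n → Space n}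
  {h : ℝ × Space n × ℝ → ℝ}

theorem isSmoothLocal_flux (hP : ContDiffOn ℝ ∞ (fun q : ℝ × ℝ => P q.1 q.2) (I ×ˢ J))
    (hT : IsSmoothKinematic I J T) (p₀ : ℝ) (hβ : ContDiff ℝ ∞ β) (hα : ContDiff ℝ ∞ α) :
    IsSmoothLocal I J fun t x (z : Jet n 0) => uncurried T (t, x, z.1) • z.1.1
      + (P z.1.2.1 z.1.2.2 - p₀) • (β (t, x) • z.1.1 + α (t, x)) := by
  have h1 : ContDiff ℝ ∞ fun q : ℝ × Space n × Jet n 0 => (q.1, q.2.1) := by fun_prop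
  have hu : ContDiff ℝ ∞ fun q : ℝ × Space n × Jet n 0 => q.2.2.1.1 := by fun_prop
  have h2 : ContDiffOn ℝ ∞ (fun q : ℝ × Space n × Jet n 0 => P q.2.2.1.2.1 q.2.2.1.2.2)
      {q | q.2.2.1.2.1 ∈ I ∧ q.2.2.1.2.2 ∈ J} :=
    hP.comp (f := fun q : ℝ × Space n × Jet n 0 => (q.2.2.1.2.1, q.2.2.1.2.2)) (by fun_prop)
      fun q hq => hq
  have h3 : ContDiffOn ℝ ∞ (fun q : ℝ × Space n × Jet n 0 => uncurried T (q.1, q.2.1, q.2.2.1))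
      {q | q.2.2.1.2.1 ∈ I ∧ q.2.2.1.2.2 ∈ J} :=
    ContDiffOn.comp (g := uncurried T)
      (f := fun q : ℝ × Space n × Jet n 0 => (q.1, q.2.1, q.2.2.1)) hT (by fun_prop)
      fun q hq => hq
  exact (h3.smul hu.contDiffOn).add ((h2.sub contDiffOn_const).smul
    (((hβ.comp h1).smul hu).add (hα.comp h1)).contDiffOn)

/-- The common source of all the conservation laws: each of them is a choice of `β`, `α`, `h` for
which the source `hN` of the moving balance vanishes. Derivatives are passed explicitly so that `hN`
becomes an algebraic identity. -/
theorem affineDensity_law (hI : IsOpen I) (hJ : IsOpen J)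
    (hIpos : I ⊆ Ioi 0) (hP : ContDiffOn ℝ ∞ (fun q : ℝ × ℝ => P q.1 q.2) (I ×ˢ J)) {p₀ : ℝ}
    (he : IsInternalEnergy I J (fun ρ S => P ρ S - p₀) e) (hβ : ContDiff ℝ ∞ β)
    (hα : ContDiff ℝ ∞ α) (hh : ContDiffOn ℝ ∞ h {q | q.2.2 ∈ J})
    {β' : ℝ → Space n → (ℝ × Space n →L[ℝ] ℝ)} {α' : ℝ → Space n → (ℝ × Space n →L[ℝ] Space n)}
    {h' : ℝ → Space n → ℝ → (ℝ × Space n × ℝ →L[ℝ] ℝ)}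
    (hβ' : ∀ t x, HasFDerivAt β (β' t x) (t, x)) (hα' : ∀ t x, HasFDerivAt α (α' t x) (t, x))
    (hh' : ∀ t x, ∀ S ∈ J, HasFDerivAt h (h' t x S) (t, x, S))
    (hN : ∀ t x u, ∀ ρ ∈ I, ∀ S ∈ J, ρ * (β' t x (1, u) * (‖u‖ ^ 2 / 2 + e ρ S)
        + inner ℝ (α' t x (1, u)) u + h' t x S (1, u, 0))
      + (P ρ S - p₀) * (β' t x (0, u) + ∑ i, α' t x (0, EuclideanSpace.single i 1) i) = 0)
    {ξ : Kinematic n (Space n)} (hT : T = affineDensity e β α h)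
    (hξ : ∀ t x u ρ S, ξ t x u ρ S = (P ρ S - p₀) • (β (t, x) • u + α (t, x))) :
    HasMovingFlux I J P T ξ ∧ IsSmoothConserved I J P T := by
  subst hT
  have hflux : HasMovingFlux I J P (affineDensity e β α h) ξ := by
    intro t w hw x
    unfold onField
    simp only [hξ]
    have := timeDeriv_affineDensity_add_divergence hI hJ hIpos hP he hβ hα hh t hw x
    unfold onField at this
    rw [this, (hβ' t x).fderiv, (hα' t x).fderiv, (hh' t x _ (hw.2 x).2).fderiv]
    exact hN t x (w x).1 _ (hw.2 x).1 _ (hw.2 x).2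
  have hs := isSmoothKinematic_affineDensity he.1 hβ hα hh
  refine ⟨hflux, hs, 0, _, isSmoothLocal_flux hP hs p₀ hβ hα, fun t w hw x => ?_⟩
  have := hflux t w hw x
  unfold onField at this
  simp only [hξ] at this
  exact this

theorem IsInternalEnergy.sub_zero (he : IsInternalEnergy I J P e) :
    IsInternalEnergy I J (fun ρ S => P ρ S - 0) e := by simpa using he

theorem mass_law (hI : IsOpen I) (hJ : IsOpen J) (hIpos : I ⊆ Ioi 0)
    (hP : ContDiffOn ℝ ∞ (fun q : ℝ × ℝ => P q.1 q.2) (I ×ˢ J))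
    (he : IsInternalEnergy I J P e) : HasMovingFlux (n := n) I J P mass (fun _ _ _ _ _ => 0)
    ∧ IsSmoothConserved (n := n) I J P mass := by
  refine affineDensity_law (β := fun _ => 0) (α := fun _ => 0) (h := fun _ => 1) hI hJ hIpos hP
    he.sub_zero contDiff_const contDiff_const contDiffOn_const
    (fun t x => hasFDerivAt_const _ _) (fun t x => hasFDerivAt_const _ _)
    (fun t x S _ => hasFDerivAt_const _ _) ?_ ?_ ?_
  · simp
  · funext t x u ρ S; simp [mass, affineDensity]
  · simp

theorem momentum_law (hI : IsOpen I) (hJ : IsOpen J) (hIpos : I ⊆ Ioi 0)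
    (hP : ContDiffOn ℝ ∞ (fun q : ℝ × ℝ => P q.1 q.2) (I ×ˢ J))
    (he : IsInternalEnergy I J P e)
    (k : Fin n) : HasMovingFlux I J P (momentum k)
      (fun _ _ _ ρ S => P ρ S • EuclideanSpace.single k 1)
    ∧ IsSmoothConserved (n := n) I J P (momentum k) := by
  refine affineDensity_law (β := fun _ => 0) (α := fun _ => EuclideanSpace.single k 1)
    (h := fun _ => 0) hI hJ hIpos hP
    he.sub_zero contDiff_const contDiff_const contDiffOn_const
    (fun t x => hasFDerivAt_const _ _) (fun t x => hasFDerivAt_const _ _)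
    (fun t x S _ => hasFDerivAt_const _ _) ?_ ?_ ?_
  · simp
  · funext t x u ρ S; simp [momentum, affineDensity, EuclideanSpace.inner_single_left]
  · simp

/-- The field `α = xᵏeⱼ - xʲeₖ` is linear in `x` with skew matrix, so both `⟨∇α u, u⟩` and `div α`
vanish. -/
theorem angularMomentum_law (hI : IsOpen I) (hJ : IsOpen J) (hIpos : I ⊆ Ioi 0)
    (hP : ContDiffOn ℝ ∞ (fun q : ℝ × ℝ => P q.1 q.2) (I ×ˢ J))
    (he : IsInternalEnergy I J P e)
    (j k : Fin n) : HasMovingFlux I J P (angularMomentum j k)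
      (fun _ x _ ρ S => P ρ S •
        (x k • EuclideanSpace.single j 1 - x j • EuclideanSpace.single k 1))
    ∧ IsSmoothConserved (n := n) I J P (angularMomentum j k) := by
  set A : ℝ × Space n →L[ℝ] Space n :=
    (((EuclideanSpace.proj (𝕜 := ℝ) k).smulRight (EuclideanSpace.single j (1 : ℝ)))
      - (EuclideanSpace.proj (𝕜 := ℝ) j).smulRight (EuclideanSpace.single k (1 : ℝ))).comp
        (ContinuousLinearMap.snd ℝ ℝ (Space n)) with hA
  refine affineDensity_law (β := fun _ => 0) (α := A)
    (h := fun _ => 0) hI hJ hIpos hP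
    he.sub_zero contDiff_const A.contDiff contDiffOn_const
    (fun t x => hasFDerivAt_const _ _) (fun t x => A.hasFDerivAt)
    (fun t x S _ => hasFDerivAt_const _ _) ?_ ?_ ?_
  · intro t x u ρ _ S _
    have h1 : inner ℝ (A (1, u)) u = 0 := by
      simp [hA, inner_sub_left, inner_smul_left, EuclideanSpace.inner_single_left, mul_comm]
    have h2 : ∑ i, A (0, EuclideanSpace.single i 1) i = 0 := by
      simp only [hA]
      by_cases hjk : j = k
      · subst hjk; simp
      · refine Finset.sum_eq_zero fun i _ => ?_
        by_cases hij : i = j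
        · subst hij
          simp [hjk, Ne.symm hjk]
        · by_cases hik : i = k
          · subst hik; simp [hjk, Ne.symm hjk]
          · simp [hij, hik]
    simp [h1, h2]
  · funext t x u ρ S
    simp [angularMomentum, affineDensity, hA, inner_sub_left, inner_smul_left,
      EuclideanSpace.inner_single_left, mul_comm]
  · simp [hA]

/-- Here `α = t eₖ` and `h = -xᵏ`; the source is `ρ(α_t·u + u·∇h) = 0`. -/
theorem galileanMomentum_law (hI : IsOpen I) (hJ : IsOpen J) (hIpos : I ⊆ Ioi 0)
    (hP : ContDiffOn ℝ ∞ (fun q : ℝ × ℝ => P q.1 q.2) (I ×ˢ J))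
    (he : IsInternalEnergy I J P e)
    (k : Fin n) : HasMovingFlux I J P (galileanMomentum k)
      (fun t _ _ ρ S => (t * P ρ S) • EuclideanSpace.single k 1)
    ∧ IsSmoothConserved (n := n) I J P (galileanMomentum k) := by
  set A : ℝ × Space n →L[ℝ] Space n :=
    (ContinuousLinearMap.fst ℝ ℝ (Space n)).smulRight (EuclideanSpace.single k (1 : ℝ)) with hA
  set H : ℝ × Space n × ℝ →L[ℝ] ℝ := -((EuclideanSpace.proj (𝕜 := ℝ) k).comp
    ((ContinuousLinearMap.fst ℝ (Space n) ℝ).comp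
      (ContinuousLinearMap.snd ℝ ℝ (Space n × ℝ)))) with hH
  refine affineDensity_law (β := fun _ => 0) (α := A)
    (h := H) hI hJ hIpos hP
    he.sub_zero contDiff_const A.contDiff H.contDiff.contDiffOn
    (fun t x => hasFDerivAt_const _ _) (fun t x => A.hasFDerivAt)
    (fun t x S _ => H.hasFDerivAt) ?_ ?_ ?_
  · simp [hA, hH, EuclideanSpace.inner_single_left]
  · funext t x u ρ S
    simp [galileanMomentum, affineDensity, hA, hH, inner_smul_left,
      EuclideanSpace.inner_single_left, sub_eq_add_neg]
  · intro t x u ρ S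
    simp [hA, smul_smul, mul_comm]

theorem energy_law (hI : IsOpen I) (hJ : IsOpen J) (hIpos : I ⊆ Ioi 0)
    (hP : ContDiffOn ℝ ∞ (fun q : ℝ × ℝ => P q.1 q.2) (I ×ˢ J))
    (he : IsInternalEnergy I J P e) : HasMovingFlux (n := n) I J P (energy e) (fun _ _ u ρ S => P ρ S • u)
    ∧ IsSmoothConserved (n := n) I J P (energy e) := by
  refine affineDensity_law (β := fun _ => 1) (α := fun _ => 0)
    (h := fun _ => 0) hI hJ hIpos hP
    he.sub_zero contDiff_const contDiff_const contDiffOn_const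
    (fun t x => hasFDerivAt_const _ _) (fun t x => hasFDerivAt_const _ _)
    (fun t x S _ => hasFDerivAt_const _ _) ?_ ?_ ?_
  · simp
  · funext t x u ρ S; simp [energy, affineDensity]
  · simp

theorem entropy_law (hI : IsOpen I) (hJ : IsOpen J) (hIpos : I ⊆ Ioi 0)
    (hP : ContDiffOn ℝ ∞ (fun q : ℝ × ℝ => P q.1 q.2) (I ×ˢ J))
    (he : IsInternalEnergy I J P e)
    {f : ℝ → ℝ} (hf : ContDiffOn ℝ ∞ f J) :
    HasMovingFlux (n := n) I J P (entropy f) (fun _ _ _ _ _ => 0)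
    ∧ IsSmoothConserved (n := n) I J P (entropy f) := by
  refine affineDensity_law (β := fun _ => 0) (α := fun _ => 0)
    (h := fun q => f q.2.2) hI hJ hIpos hP
    he.sub_zero contDiff_const contDiff_const
    (hf.comp (f := fun q : ℝ × Space n × ℝ => q.2.2) (by fun_prop) fun _ hq => hq)
    (fun t x => hasFDerivAt_const _ _) (fun t x => hasFDerivAt_const _ _)
    (h' := fun t x S => (fderiv ℝ f S).comp ((ContinuousLinearMap.snd ℝ (Space n) ℝ).comp
      (ContinuousLinearMap.snd ℝ ℝ (Space n × ℝ))))
    (fun t x S hS => ?_) ?_ ?_ ?_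
  · exact HasFDerivAt.comp (g := f) (f := fun q : ℝ × Space n × ℝ => q.2.2) (t, x, S)
      ((hf.contDiffAt (hJ.mem_nhds hS)).differentiableAt (by simp)).hasFDerivAt
      (hasFDerivAt_snd.comp _ hasFDerivAt_snd)
  · simp
  · funext t x u ρ S; simp [entropy, affineDensity]
  · simp

/-! ### The two additional laws for a polytropic equation of state. -/

section Polytropic

variable {κ : ℝ → ℝ} {p₀ : ℝ}

/-- With this relation the term `ρβ'e` of the source cancels against `(P - p₀) div α` whenever `div
α = -(n/2)β'`. -/
theorem IsShiftedPolytropic.mul_polytropicEnergy (hIpos : I ⊆ Ioi 0)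
    (hκ : IsShiftedPolytropic n I J P κ p₀) {ρ S : ℝ} (hρ : ρ ∈ I) (hS : S ∈ J) :
    ρ * polytropicEnergy n κ ρ S = (n : ℝ) / 2 * (P ρ S - p₀) := by
  have hpos : 0 < ρ := hIpos hρ
  rw [hκ ρ hρ S hS, polytropicEnergy, Real.rpow_add hpos, Real.rpow_one]
  ring

theorem IsShiftedPolytropic.isInternalEnergy (hn : 0 < n) (hIpos : I ⊆ Ioi 0)
    (hP : ContDiffOn ℝ ∞ (fun q : ℝ × ℝ => P q.1 q.2) (I ×ˢ J))
    (hκ : IsShiftedPolytropic n I J P κ p₀) :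
    IsInternalEnergy I J (fun ρ S => P ρ S - p₀) (polytropicEnergy n κ) := by
  constructor
  -- No regularity of `κ` is assumed. Smoothness of the energy comes from that of `P`, through the
  -- quotient `(n/2)(P - p₀)/ρ`.
  · have h1 : ContDiffOn ℝ ∞ (fun q : ℝ × ℝ => (n : ℝ) / 2 * (P q.1 q.2 - p₀) / q.1) (I ×ˢ J) :=
      (contDiffOn_const.mul (hP.sub contDiffOn_const)).div contDiffOn_fst
        fun q hq => (hIpos hq.1).ne'
    refine h1.congr fun q hq => ?_
    rw [← hκ.mul_polytropicEnergy hIpos hq.1 hq.2, mul_div_cancel_left₀]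
    exact (hIpos hq.1).ne'
  · intro ρ hρ S hS
    have hpos : 0 < ρ := hIpos hρ
    have hn' : (n : ℝ) ≠ 0 := by exact_mod_cast hn.ne'
    have h1 := (Real.hasDerivAt_rpow_const (x := ρ) (p := 2 / (n : ℝ))
      (Or.inl hpos.ne')).const_mul ((n : ℝ) / 2 * κ S)
    refine h1.congr_deriv ?_
    have e1 : ρ ^ (1 + 2 / (n : ℝ)) = ρ ^ (2 : ℕ) * ρ ^ (2 / (n : ℝ) - 1) := by
      rw [← Real.rpow_natCast, ← Real.rpow_add hpos]
      congr 1
      push_cast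
      ring
    simp only [hκ ρ hρ S hS, e1]
    field_simp
    ring

theorem energy_polytropic (hIpos : I ⊆ Ioi 0) (hκ : IsShiftedPolytropic n I J P κ p₀)
    (t : ℝ) (x u : Space n) {ρ S : ℝ} (hρ : ρ ∈ I) (hS : S ∈ J) :
    energy (polytropicEnergy n κ) t x u ρ S
      = ρ * ‖u‖ ^ 2 / 2 + (n : ℝ) / 2 * (P ρ S - p₀) := by
  rw [← hκ.mul_polytropicEnergy hIpos hρ hS, energy]
  ring

/-- The choice is `β = t`, `α = -x/2`, `h = 0`. The kinetic terms `½|u|²` cancel and the rest is `ρe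
- (n/2)(P - p₀)`, which is zero. -/
theorem similarityEnergy_law (hn : 0 < n) (hI : IsOpen I) (hJ : IsOpen J) (hIpos : I ⊆ Ioi 0)
    (hP : ContDiffOn ℝ ∞ (fun q : ℝ × ℝ => P q.1 q.2) (I ×ˢ J))
    (hκ : IsShiftedPolytropic n I J P κ p₀) :
    HasMovingFlux (n := n) I J P (similarityEnergy (polytropicEnergy n κ))
      (fun t x u ρ S => (P ρ S - p₀) • (t • u - (1 / 2 : ℝ) • x))
    ∧ IsSmoothConserved (n := n) I J P (similarityEnergy (polytropicEnergy n κ)) := by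
  set b : ℝ × Space n →L[ℝ] ℝ := ContinuousLinearMap.fst ℝ ℝ (Space n) with hb
  set A : ℝ × Space n →L[ℝ] Space n :=
    (-(1 / 2 : ℝ)) • ContinuousLinearMap.snd ℝ ℝ (Space n) with hA
  refine affineDensity_law (β := b) (α := A) (h := fun _ => 0) hI hJ hIpos hP
    (hκ.isInternalEnergy hn hIpos hP) b.contDiff A.contDiff contDiffOn_const
    (fun t x => b.hasFDerivAt) (fun t x => A.hasFDerivAt)
    (fun t x S _ => hasFDerivAt_const _ _) ?_ ?_ ?_
  · intro t x u ρ hρ S hS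
    have := hκ.mul_polytropicEnergy hIpos hρ hS
    simp [hA, hb, inner_neg_left, inner_smul_left]
    linarith
  · funext t x u ρ S
    simp [similarityEnergy, energy, affineDensity, hA, hb, inner_neg_left, inner_smul_left,
      real_inner_comm u x]
    ring
  · intro t x u ρ S
    simp [hA, hb, sub_eq_add_neg]

/-- The choice is `β = t²`, `α = -tx`, `h = ½|x|²`. Here `α_t·u` cancels `u·∇h`, the terms `t|u|²`
cancel, and the rest is `2t(ρe - (n/2)(P - p₀)) = 0`. -/
theorem dilationalEnergy_law (hn : 0 < n) (hI : IsOpen I) (hJ : IsOpen J) (hIpos : I ⊆ Ioi 0)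
    (hP : ContDiffOn ℝ ∞ (fun q : ℝ × ℝ => P q.1 q.2) (I ×ˢ J))
    (hκ : IsShiftedPolytropic n I J P κ p₀) :
    HasMovingFlux (n := n) I J P (dilationalEnergy (polytropicEnergy n κ))
      (fun t x u ρ S => ((P ρ S - p₀) * t) • (t • u - x))
    ∧ IsSmoothConserved (n := n) I J P (dilationalEnergy (polytropicEnergy n κ)) := by
  set b : ℝ × Space n →L[ℝ] ℝ := ContinuousLinearMap.fst ℝ ℝ (Space n) with hb
  set A : ℝ × Space n →L[ℝ] Space n := ContinuousLinearMap.snd ℝ ℝ (Space n) with hA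
  set X : ℝ × Space n × ℝ →L[ℝ] Space n := (ContinuousLinearMap.fst ℝ (Space n) ℝ).comp
      (ContinuousLinearMap.snd ℝ ℝ (Space n × ℝ)) with hX
  refine affineDensity_law (β := fun q => b q * b q) (α := fun q => -(b q • A q))
    (h := fun q => 1 / 2 * inner ℝ (X q) (X q)) hI hJ hIpos hP
    (hκ.isInternalEnergy hn hIpos hP) (b.contDiff.mul b.contDiff)
    ((b.contDiff.smul A.contDiff).neg)
    ((contDiff_const.mul (X.contDiff.inner ℝ X.contDiff)).contDiffOn)
    (fun t x => b.hasFDerivAt.fun_mul b.hasFDerivAt)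
    (fun t x => (b.hasFDerivAt.fun_smul A.hasFDerivAt).fun_neg)
    (fun t x S _ => (X.hasFDerivAt.inner ℝ X.hasFDerivAt).const_mul _) ?_ ?_ ?_
  · intro t x u ρ hρ S hS
    have := hκ.mul_polytropicEnergy hIpos hρ hS
    simp [hA, hb, hX, fderivInnerCLM_apply, inner_neg_left, inner_smul_left, inner_add_left,
      real_inner_comm u x]
    linear_combination 2 * t * this
  · funext t x u ρ S
    simp [dilationalEnergy, energy, affineDensity, hA, hb, hX, inner_neg_left, inner_smul_left,
      real_inner_comm u x]
    ring
  · intro t x u ρ S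
    simp [hA, hb, smul_smul, sub_eq_add_neg, mul_assoc]

end Polytropic

end Euler

namespace Euler

variable {n : ℕ} {I J : Set ℝ} {P e : ℝ → ℝ → ℝ}

/-! ### The dependence of a conserved density on the state -/

/-- The unit vector of the `k`-th velocity component in the space of states. -/
def velDir (k : Fin n) : State n := (EuclideanSpace.single k 1, 0, 0)

/-- The unit vector of the density in the space of states. -/
def densDir : State n := (0, 1, 0)

/-- The unit vector of the entropy in the space of states. -/
def entDir : State n := (0, 0, 1)

theorem state_eq_sum (b : State n) :
    b = (∑ j, b.1 j • velDir j) + b.2.1 • densDir + b.2.2 • entDir := by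
  have h1 : (∑ j, b.1 j • velDir j : State n) = (b.1, 0, 0) := by
    have := congrArg (ContinuousLinearMap.inl ℝ (Space n) (ℝ × ℝ)) (sum_coord_smul_single b.1)
    rw [map_sum] at this
    refine Eq.trans (Finset.sum_congr rfl fun j _ => ?_) this
    simp [velDir]
  rw [h1]
  simp [densDir, entDir]

/-- A directional derivative depends only on the restriction to a line. This carries partial
derivatives from one base point to another when the function is known not to depend on the
coordinates that differ. -/
theorem fderiv_eq_of_line {F : Type*} [NormedAddCommGroup F] [NormedSpace ℝ F] {g₁ g₂ : F → ℝ}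
    {v₁ v₂ b : F} (h₁ : DifferentiableAt ℝ g₁ v₁) (h₂ : DifferentiableAt ℝ g₂ v₂)
    (h : ∀ᶠ s : ℝ in 𝓝 0, g₁ (v₁ + s • b) = g₂ (v₂ + s • b)) :
    fderiv ℝ g₁ v₁ b = fderiv ℝ g₂ v₂ b :=
  HasDerivAt.unique (h₁.hasFDerivAt.hasLineDerivAt b)
    (HasDerivAt.congr_of_eventuallyEq (h₂.hasFDerivAt.hasLineDerivAt b) h)

theorem eventually_add_smul_mem {F : Type*} [NormedAddCommGroup F] [NormedSpace ℝ F] {s : Set F}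
    (hs : IsOpen s) {v : F} (hv : v ∈ s) (b : F) : ∀ᶠ r : ℝ in 𝓝 0, v + r • b ∈ s := by
  have hc : Continuous fun r : ℝ => v + r • b := by fun_prop
  exact hc.continuousAt.eventually_mem (hs.mem_nhds (by simpa using hv))

/-- The coefficient `f - ρ f_ρ` of `∇·u` in the balance of `f` in the moving frame. -/
def dilationCoeff (f : State n → ℝ) (v : State n) : ℝ := f v - v.2.1 * fderiv ℝ f v densDir

/-- The coefficient `ρ⁻¹ f_{u^k}`. -/
def velCoeff (f : State n → ℝ) (k : Fin n) (v : State n) : ℝ :=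
  (v.2.1)⁻¹ * fderiv ℝ f v (velDir k)

section

variable {f : State n → ℝ}

theorem contDiffOn_fderiv_state (hI : IsOpen I) (hJ : IsOpen J)
    (hf : ContDiffOn ℝ ∞ f (phase n I J)) : ContDiffOn ℝ ∞ (fderiv ℝ f) (phase n I J) :=
  hf.fderiv_of_isOpen (isOpen_phase hI hJ) (by simp)

theorem contDiffOn_dilationCoeff (hI : IsOpen I) (hJ : IsOpen J)
    (hf : ContDiffOn ℝ ∞ f (phase n I J)) : ContDiffOn ℝ ∞ (dilationCoeff f) (phase n I J) :=
  hf.sub ((by fun_prop : ContDiff ℝ ∞ fun v : State n => v.2.1).contDiffOn.mul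
    ((contDiffOn_fderiv_state hI hJ hf).clm_apply contDiffOn_const))

theorem contDiffOn_velCoeff (hI : IsOpen I) (hJ : IsOpen J) (hIpos : I ⊆ Ioi 0)
    (hf : ContDiffOn ℝ ∞ f (phase n I J))
    (k : Fin n) : ContDiffOn ℝ ∞ (velCoeff f k) (phase n I J) :=
  ((by fun_prop : ContDiff ℝ ∞ fun v : State n => v.2.1).contDiffOn.inv
    fun _ hv => (hIpos hv.1).ne').mul
    ((contDiffOn_fderiv_state hI hJ hf).clm_apply contDiffOn_const)

/-- By symmetry of second derivatives both sides equal `f_{uᵏ} - ρ f_{ρuᵏ}`. This is the link that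
turns velocity-independence of `W` into density-independence of `ν`. -/
theorem fderiv_dilationCoeff_velDir (hI : IsOpen I) (hJ : IsOpen J) (hIpos : I ⊆ Ioi 0)
    (hf : ContDiffOn ℝ ∞ f (phase n I J))
    {v : State n} (hv : v ∈ phase n I J) (k : Fin n) :
    fderiv ℝ (dilationCoeff f) v (velDir k)
      = -(v.2.1 ^ 2 * fderiv ℝ (velCoeff f k) v densDir) := by
  have hnhds := (isOpen_phase hI hJ).mem_nhds hv
  have hfd : DifferentiableAt ℝ f v := (hf.contDiffAt hnhds).differentiableAt (by simp)
  have hf2 : DifferentiableAt ℝ (fderiv ℝ f) v :=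
    ((contDiffOn_fderiv_state hI hJ hf).contDiffAt hnhds).differentiableAt (by simp)
  have hsymm : IsSymmSndFDerivAt ℝ f v :=
    (hf.contDiffAt hnhds).isSymmSndFDerivAt (by simp only [minSmoothness_of_isRCLikeNormedField]; exact ENat.LEInfty.out)
  have hρ : HasFDerivAt (fun v : State n => v.2.1) ((ContinuousLinearMap.fst ℝ ℝ ℝ).comp
      (ContinuousLinearMap.snd ℝ (Space n) (ℝ × ℝ))) v :=
    ((ContinuousLinearMap.fst ℝ ℝ ℝ).comp
      (ContinuousLinearMap.snd ℝ (Space n) (ℝ × ℝ))).hasFDerivAt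
  have hρ0 : v.2.1 ≠ 0 := (hIpos hv.1).ne'
  have h1 : HasFDerivAt (dilationCoeff f) _ v :=
    hfd.hasFDerivAt.fun_sub (hρ.fun_mul (hf2.hasFDerivAt.clm_apply (hasFDerivAt_const densDir v)))
  have h2 : HasFDerivAt (velCoeff f k) _ v :=
    ((hasDerivAt_inv hρ0).comp_hasFDerivAt v hρ).fun_mul
      (hf2.hasFDerivAt.clm_apply (hasFDerivAt_const (velDir k) v))
  rw [h1.fderiv, h2.fderiv]
  have e1 : (velDir k : State n).2.1 = 0 := rfl
  have e2 : (densDir : State n).2.1 = 1 := rfl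
  simp only [sub_apply, add_apply, smul_apply, ContinuousLinearMap.comp_apply,
    ContinuousLinearMap.coe_fst', ContinuousLinearMap.coe_snd', ContinuousLinearMap.flip_apply,
    zero_apply, map_zero, smul_eq_mul, e1, e2, Function.comp_apply]
  rw [hsymm.eq (velDir k) densDir]
  field_simp
  ring

end

/-- If the forms `W duⁱ - νᵢ dP` on the space of states are closed, where `W = f - ρ f_ρ` and
`νᵢ = ρ⁻¹ f_{uⁱ}`, then `f = w₀ + ρ(β(½|u|² + e) + α·u + h(S))`. -/
theorem eq_of_closed (hn : 1 < n) (hI : IsOpen I) (hJ : IsOpen J) (hI' : I.OrdConnected)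
    (hJ' : J.OrdConnected) (hIpos : I ⊆ Ioi 0)
    (hP : ContDiffOn ℝ ∞ (fun q : ℝ × ℝ => P q.1 q.2) (I ×ˢ J))
    (hPρ : ∀ U ⊆ J, IsOpen U → U.Nonempty → ∃ S ∈ U, ∃ ρ ∈ I, deriv (fun r => P r S) ρ ≠ 0)
    (he : IsInternalEnergy I J P e) {ρ₀ S₀ : ℝ} (hρ₀ : ρ₀ ∈ I) (hS₀ : S₀ ∈ J)
    (hP₀ : deriv (fun r => P r S₀) ρ₀ ≠ 0) {f : State n → ℝ}
    (hf : ContDiffOn ℝ ∞ f (phase n I J))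
    (hcurl : ∀ v ∈ phase n I J, ∀ i a b,
      fderiv ℝ (dilationCoeff f) v a * b.1 i
          - fderiv ℝ (velCoeff f i) v a * fderiv ℝ (fun v : State n => P v.2.1 v.2.2) v b
        = fderiv ℝ (dilationCoeff f) v b * a.1 i
          - fderiv ℝ (velCoeff f i) v b * fderiv ℝ (fun v : State n => P v.2.1 v.2.2) v a)
    {β w₀ : ℝ} {α : Space n}
    (hβ : β = -fderiv ℝ (dilationCoeff f) (0, ρ₀, S₀) densDir / deriv (fun r => P r S₀) ρ₀)
    (hα : ∀ i, α i = velCoeff f i (0, ρ₀, S₀))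
    (hw₀ : w₀ = dilationCoeff f (0, ρ₀, S₀) + β * P ρ₀ S₀)
    (u : Space n) {ρ S : ℝ} (hρ : ρ ∈ I) (hS : S ∈ J) :
    f (u, ρ, S) = w₀ + ρ * (β * (‖u‖ ^ 2 / 2 + e ρ S) + inner ℝ α u
      + ((f (0, ρ₀, S) - w₀) / ρ₀ - β * e ρ₀ S)) := by
  have ho := isOpen_phase (n := n) hI hJ
  have hcv := convex_phase (n := n) hI' hJ'
  set W := dilationCoeff f with hW
  set ν := velCoeff f with hν
  set p : State n → ℝ := fun v => P v.2.1 v.2.2 with hp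
  have hWs : ContDiffOn ℝ ∞ W (phase n I J) := contDiffOn_dilationCoeff hI hJ hf
  have hνs : ∀ k, ContDiffOn ℝ ∞ (ν k) (phase n I J) := contDiffOn_velCoeff hI hJ hIpos hf
  have hps : ContDiffOn ℝ ∞ p (phase n I J) :=
    hP.comp (f := fun v : State n => (v.2.1, v.2.2)) (by fun_prop) fun _ hv => hv
  have hWd : ∀ v ∈ phase n I J, DifferentiableAt ℝ W v := fun v hv =>
    (hWs.contDiffAt (ho.mem_nhds hv)).differentiableAt (by simp)
  have hνd : ∀ k, ∀ v ∈ phase n I J, DifferentiableAt ℝ (ν k) v := fun k v hv =>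
    ((hνs k).contDiffAt (ho.mem_nhds hv)).differentiableAt (by simp)
  have hpd : ∀ v ∈ phase n I J, DifferentiableAt ℝ p v := fun v hv =>
    (hps.contDiffAt (ho.mem_nhds hv)).differentiableAt (by simp)
  have hfd : ∀ v ∈ phase n I J, DifferentiableAt ℝ f v := fun v hv =>
    (hf.contDiffAt (ho.mem_nhds hv)).differentiableAt (by simp)
  have hpvel : ∀ v ∈ phase n I J, ∀ k, fderiv ℝ p v (velDir k) = 0 := fun v hv k => by
    rw [fderiv_eq_of_line (g₂ := fun _ => p v) (v₂ := v) (hpd v hv) (differentiableAt_const _)]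
    · simp
    · exact Eventually.of_forall fun s => by simp [hp, velDir]
  have hpdens : ∀ v ∈ phase n I J, fderiv ℝ p v densDir = deriv (fun r => P r v.2.2) v.2.1 := by
    intro v hv
    have h1 := (hpd v hv).hasFDerivAt.hasLineDerivAt (densDir : State n)
    have h2 : HasDerivAt (fun r => P r v.2.2) (fderiv ℝ p v densDir) v.2.1 := by
      have h3 : HasDerivAt (fun r : ℝ => r - v.2.1) 1 v.2.1 := (hasDerivAt_id _).sub_const _
      have := HasDerivAt.comp (h₂ := fun s : ℝ => p (v + s • densDir)) (h := fun r => r - v.2.1)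
        v.2.1 (by rw [sub_self]; exact h1) h3
      simpa [Function.comp_def, hp, densDir] using this
    exact h2.deriv.symm
  -- the coefficient of the dilation does not depend on the velocity
  have hWvel : ∀ v ∈ phase n I J, ∀ k, fderiv ℝ W v (velDir k) = 0 := by
    intro v hv k
    -- A second index `i ≠ k` is needed here, and it exists because `n > 1`. Since `dP` has no
    -- velocity component, the `duᵏ ∧ duⁱ` component of the `i`-th form is just `W_{uᵏ}`.
    have : Nontrivial (Fin n) := Fin.nontrivial_iff_two_le.2 hn
    obtain ⟨i, hi⟩ := exists_ne k
    have := hcurl v hv i (velDir k) (velDir i)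
    rw [hpvel v hv, hpvel v hv] at this
    simpa [velDir, hi, hi.symm] using this
  have hνdens : ∀ v ∈ phase n I J, ∀ k, fderiv ℝ (ν k) v densDir = 0 := by
    intro v hv k
    have h1 := fderiv_dilationCoeff_velDir hI hJ hIpos hf hv k
    rw [← hW, hWvel v hv k] at h1
    have hρ0 : v.2.1 ≠ 0 := (hIpos hv.1).ne'
    have h2 : v.2.1 ^ 2 * fderiv ℝ (ν k) v densDir = 0 := by linarith
    exact (mul_eq_zero.1 h2).resolve_left (pow_ne_zero 2 hρ0)
  have hνρ : ∀ k u, ∀ ρ₁ ∈ I, ∀ ρ₂ ∈ I, ∀ S ∈ J, ν k (u, ρ₁, S) = ν k (u, ρ₂, S) := by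
    intro k u ρ₁ h₁ ρ₂ h₂ S hS
    refine eq_of_fderiv_apply_sub_eq_zero ho hcv ((hνs k).differentiableOn (by simp))
      (x := (u, ρ₂, S)) (y := (u, ρ₁, S)) ⟨h₂, hS⟩ ⟨h₁, hS⟩ fun z hz => ?_
    have : ((u, ρ₁, S) - (u, ρ₂, S) : State n) = (ρ₁ - ρ₂) • densDir := by simp [densDir]
    rw [this, map_smul, hνdens z hz, smul_zero]
  -- If `ν_S` were nonzero at one point, it would be nonzero on an open set of entropies, and by
  -- `hνρ` for every density. That set contains an entropy at which `P_ρ ≠ 0` for some density,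
  -- contradicting the `dρ ∧ dS` component `ν_S P_ρ = 0`.
  have hνent : ∀ v ∈ phase n I J, ∀ k, fderiv ℝ (ν k) v entDir = 0 := by
    rintro ⟨u, ρ₁, S₁⟩ hv k
    by_contra hne
    have hc : ContinuousOn (fun S => fderiv ℝ (ν k) (u, ρ₁, S) entDir) J := by
      refine (((hνs k).continuousOn_fderiv_of_isOpen ho (by simp)).comp
        (f := fun S => ((u, ρ₁, S) : State n)) (by fun_prop) fun S hS => ⟨hv.1, hS⟩).clm_apply
        continuousOn_const
    obtain ⟨S, hSU, ρ', hρ', hPne⟩ := hPρ _ inter_subset_left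
      (hc.isOpen_inter_preimage hJ (isOpen_compl_singleton (x := (0 : ℝ)))) ⟨S₁, hv.2, hne⟩
    have hm : ((u, ρ', S) : State n) ∈ phase n I J := ⟨hρ', hSU.1⟩
    have hm1 : ((u, ρ₁, S) : State n) ∈ phase n I J := ⟨hv.1, hSU.1⟩
    have heq : fderiv ℝ (ν k) (u, ρ', S) entDir = fderiv ℝ (ν k) (u, ρ₁, S) entDir := by
      refine fderiv_eq_of_line (hνd k _ hm) (hνd k _ hm1) ?_
      filter_upwards [eventually_add_smul_mem hJ hSU.1 (1 : ℝ)] with s hs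
      simp only [entDir, Prod.smul_mk, Prod.mk_add_mk, smul_zero, add_zero]
      exact hνρ k u ρ' hρ' ρ₁ hv.1 _ hs
    have h1 := hcurl _ hm k entDir densDir
    rw [hνdens _ hm, hpdens _ hm, heq] at h1
    simp only [entDir, densDir, PiLp.zero_apply, mul_zero, zero_mul, sub_zero, zero_sub,
      neg_eq_zero, mul_eq_zero] at h1
    rcases h1 with h1 | h1
    · exact hSU.2 h1
    · exact hPne h1
  have hνconst : ∀ k u, ∀ ρ ∈ I, ∀ S ∈ J, ν k (u, ρ, S) = ν k (u, ρ₀, S₀) := by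
    intro k u ρ hρ S hS
    refine eq_of_fderiv_apply_sub_eq_zero ho hcv ((hνs k).differentiableOn (by simp))
      (x := (u, ρ₀, S₀)) (y := (u, ρ, S)) ⟨hρ₀, hS₀⟩ ⟨hρ, hS⟩ fun z hz => ?_
    have : ((u, ρ, S) - (u, ρ₀, S₀) : State n) = (ρ - ρ₀) • densDir + (S - S₀) • entDir := by
      simp [densDir, entDir]
    rw [this, map_add, map_smul, map_smul, hνdens z hz, hνent z hz]
    simp
  have hWu : ∀ u, ∀ ρ ∈ I, ∀ S ∈ J, W (u, ρ, S) = W (0, ρ, S) := by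
    intro u ρ hρ S hS
    refine eq_of_fderiv_apply_sub_eq_zero ho hcv (hWs.differentiableOn (by simp))
      (x := (0, ρ, S)) (y := (u, ρ, S)) ⟨hρ, hS⟩ ⟨hρ, hS⟩ fun z hz => ?_
    have : ((u, ρ, S) - (0, ρ, S) : State n) = (u, 0, 0) := by simp; rfl
    rw [this, state_eq_sum (u, 0, 0)]
    simp [map_sum, hWvel z hz]
  have hWdens : ∀ u, fderiv ℝ W (u, ρ₀, S₀) densDir = fderiv ℝ W (0, ρ₀, S₀) densDir := by
    intro u
    refine fderiv_eq_of_line (hWd _ ⟨hρ₀, hS₀⟩) (hWd _ ⟨hρ₀, hS₀⟩) ?_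
    filter_upwards [eventually_add_smul_mem hI hρ₀ (1 : ℝ)] with s hs
    simp only [densDir, Prod.smul_mk, Prod.mk_add_mk, smul_zero, add_zero]
    exact hWu u _ hs _ hS₀
  -- The components between velocity and density: `-ν_{i,uʲ} P_ρ = W_ρ δᵢⱼ`. At the base point `P_ρ
  -- ≠ 0`, and neither `P_ρ` nor `W_ρ` depends on `u`, so the velocity derivative of `ν` there is
  -- the fixed multiple `β` of the identity.
  have hmix : ∀ v ∈ phase n I J, ∀ i j, -(fderiv ℝ (ν i) v (velDir j) * fderiv ℝ p v densDir)
      = fderiv ℝ W v densDir * (velDir j : State n).1 i := by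
    intro v hv i j
    have := hcurl v hv i (velDir j) densDir
    rw [hνdens v hv, hWvel v hv] at this
    simpa using this
  have hmix' : ∀ v ∈ phase n I J, ∀ i j, -(fderiv ℝ (ν i) v (velDir j) * fderiv ℝ p v entDir)
      = fderiv ℝ W v entDir * (velDir j : State n).1 i := by
    intro v hv i j
    have := hcurl v hv i (velDir j) entDir
    rw [hνent v hv, hWvel v hv] at this
    simpa using this
  have hνvel₀ : ∀ u i j, fderiv ℝ (ν i) (u, ρ₀, S₀) (velDir j) = β * (velDir j : State n).1 i := by
    intro u i j
    have h1 := hmix (u, ρ₀, S₀) ⟨hρ₀, hS₀⟩ i j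
    rw [hpdens _ ⟨hρ₀, hS₀⟩, hWdens u] at h1
    simp only at h1
    rw [hβ]
    field_simp
    linarith
  have hνaff₀ : ∀ i u, ν i (u, ρ₀, S₀) = β * u i + α i := by
    intro i u
    have hg : ∀ u, HasFDerivAt (fun u : Space n => ν i (u, ρ₀, S₀) - β * u i)
        ((fderiv ℝ (ν i) (u, ρ₀, S₀)).comp (ContinuousLinearMap.inl ℝ (Space n) (ℝ × ℝ))
          - β • EuclideanSpace.proj (𝕜 := ℝ) i) u := fun u =>
      ((hνd i _ ⟨hρ₀, hS₀⟩).hasFDerivAt.comp u (hasFDerivAt_prodMk_left u (ρ₀, S₀))).fun_sub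
        ((EuclideanSpace.proj (𝕜 := ℝ) i).hasFDerivAt.const_mul β)
    have := eq_of_fderiv_apply_sub_eq_zero (s := univ) isOpen_univ convex_univ
      (f := fun u : Space n => ν i (u, ρ₀, S₀) - β * u i)
      (fun u _ => (hg u).differentiableAt.differentiableWithinAt) (x := 0) (y := u)
      (mem_univ _) (mem_univ _) fun z _ => by
        rw [(hg z).fderiv, sub_zero]
        have e1 : (ContinuousLinearMap.inl ℝ (Space n) (ℝ × ℝ)) u = ∑ j, u j • velDir j := by
          have := state_eq_sum ((u, 0, 0) : State n)
          rwa [zero_smul, zero_smul, add_zero, add_zero] at this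
        simp only [sub_apply, ContinuousLinearMap.comp_apply, e1, map_sum, map_smul,
          hνvel₀, smul_apply, smul_eq_mul]
        simp [velDir, mul_comm]
    simp only [PiLp.zero_apply, mul_zero, sub_zero] at this
    rw [hα i]
    linarith
  have hνaff : ∀ i, ∀ v ∈ phase n I J, ν i v = β * v.1 i + α i := by
    rintro i ⟨u, ρ, S⟩ hv
    rw [hνconst i u ρ hv.1 S hv.2, hνaff₀]
  have hνvel : ∀ v ∈ phase n I J, ∀ i, fderiv ℝ (ν i) v (velDir i) = β := by
    rintro ⟨u, ρ, S⟩ hv i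
    have : fderiv ℝ (ν i) (u, ρ, S) (velDir i) = fderiv ℝ (ν i) (u, ρ₀, S₀) (velDir i) := by
      refine fderiv_eq_of_line (hνd i _ hv) (hνd i _ ⟨hρ₀, hS₀⟩) (Eventually.of_forall fun s => ?_)
      simp only [velDir, Prod.smul_mk, Prod.mk_add_mk, smul_zero, add_zero]
      exact hνconst i _ ρ hv.1 S hv.2
    rw [this, hνvel₀]
    simp [velDir]
  -- the dilation coefficient is an affine function of the pressure
  have hWp : ∀ v ∈ phase n I J, W v = w₀ - β * p v := by
    intro v hv
    have i₀ : Fin n := ⟨0, by omega⟩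
    have := eq_of_fderiv_apply_sub_eq_zero ho hcv (f := fun v => W v + β * p v)
      ((hWs.add (contDiffOn_const.mul hps)).differentiableOn (by simp))
      (x := (0, ρ₀, S₀)) (y := v) ⟨hρ₀, hS₀⟩ hv fun z hz => by
        have h1 : fderiv ℝ (fun v => W v + β * p v) z = fderiv ℝ W z + β • fderiv ℝ p z :=
          ((hWd z hz).hasFDerivAt.fun_add ((hpd z hz).hasFDerivAt.const_mul β)).fderiv
        -- The diagonal components give `dW = -β dP` in the directions of density and entropy; in
        -- the velocity directions both sides vanish.
        have h2 := hmix z hz i₀ i₀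
        have h3 := hmix' z hz i₀ i₀
        rw [hνvel z hz] at h2 h3
        have e1 : (velDir i₀ : State n).1 i₀ = 1 := by simp [velDir]
        rw [e1, mul_one] at h2 h3
        rw [h1, state_eq_sum (v - (0, ρ₀, S₀))]
        simp only [add_apply, smul_apply, map_add, map_sum, map_smul, hWvel z hz, hpvel z hz,
          ← h2, ← h3, smul_eq_mul]
        simp
    rw [hw₀]
    have e2 : p (0, ρ₀, S₀) = P ρ₀ S₀ := rfl
    rw [e2] at this
    linarith
  -- What remains of `(f - w₀)/ρ` after removal of the energy and momentum terms. Once it is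
  -- independent of `u` and `ρ`, it can be evaluated at `(0, ρ₀, S)`, which is the `h(S)` of the
  -- statement.
  set H : State n → ℝ := fun v =>
    v.2.1⁻¹ * (f v - w₀) - β * (‖v.1‖ ^ 2 / 2 + e v.2.1 v.2.2) - inner ℝ α v.1 with hH
  have hHs : ContDiffOn ℝ ∞ H (phase n I J) := by
    have h1 : ContDiff ℝ ∞ fun v : State n => v.2.1 := by fun_prop
    have h2 : ContDiffOn ℝ ∞ (fun v : State n => e v.2.1 v.2.2) (phase n I J) :=
      he.1.comp (f := fun v : State n => (v.2.1, v.2.2)) (by fun_prop) fun _ hv => hv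
    have h3 : ContDiff ℝ ∞ fun v : State n => ‖v.1‖ ^ 2 / 2 :=
      ((contDiff_fst).norm_sq ℝ).div_const 2
    have h4 : ContDiff ℝ ∞ fun v : State n => inner ℝ α v.1 :=
      contDiff_const.inner ℝ contDiff_fst
    exact (((h1.contDiffOn.inv fun _ hv => (hIpos hv.1).ne').mul (hf.sub contDiffOn_const)).sub
      (contDiffOn_const.mul (h3.contDiffOn.add h2))).sub h4.contDiffOn
  have hHeq : H (u, ρ, S) = H (0, ρ₀, S) := by
    refine eq_of_fderiv_apply_sub_eq_zero ho hcv (hHs.differentiableOn (by simp))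
      (x := (0, ρ₀, S)) (y := (u, ρ, S)) ⟨hρ₀, hS⟩ ⟨hρ, hS⟩ fun z hz => ?_
    obtain ⟨a, r, hb⟩ : ∃ a r, ((u, ρ, S) - (0, ρ₀, S) : State n) = (a, r, 0) :=
      ⟨u, ρ - ρ₀, by simp⟩
    rw [hb]
    have hz0 : z.2.1 ≠ 0 := (hIpos hz.1).ne'
    have hHd : DifferentiableAt ℝ H z :=
      (hHs.contDiffAt (ho.mem_nhds hz)).differentiableAt (by simp)
    have hs1 : HasDerivAt (fun s : ℝ => z.1 + s • a) a 0 := by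
      simpa using ((hasDerivAt_id (0 : ℝ)).smul_const a).const_add z.1
    have hs2 : HasDerivAt (fun s : ℝ => z.2.1 + s * r) r 0 := by
      simpa using ((hasDerivAt_id (0 : ℝ)).mul_const r).const_add z.2.1
    have hs3 : HasDerivAt (fun s : ℝ => e (z.2.1 + s * r) z.2.2)
        ((z.2.1 ^ 2)⁻¹ * P z.2.1 z.2.2 * r) 0 :=
      HasDerivAt.comp (h₂ := fun r => e r z.2.2) (h := fun s : ℝ => z.2.1 + s * r) 0
        (by simpa using he.2 _ hz.1 _ hz.2) hs2
    have hs4 : HasDerivAt (fun s : ℝ => ‖z.1 + s • a‖ ^ 2 / 2) (inner ℝ z.1 a) 0 := by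
      simpa using (hs1.norm_sq).div_const 2
    have hs5 : HasDerivAt (fun s : ℝ => f (z + s • ((a, r, 0) : State n)))
        (fderiv ℝ f z (a, r, 0)) 0 := (hfd z hz).hasFDerivAt.hasLineDerivAt ((a, r, 0) : State n)
    have hs6 := ((hs2.fun_inv (by simpa using hz0)).fun_mul (hs5.sub_const w₀)).fun_sub
      ((hs4.fun_add hs3).const_mul β) |>.fun_sub ((hasDerivAt_const (0 : ℝ) α).inner ℝ hs1)
    have hs7 := (hHd.hasFDerivAt.hasLineDerivAt ((a, r, 0) : State n))
    have hs8 := hs6.congr_of_eventuallyEq (f₁ := fun s : ℝ => H (z + s • ((a, r, 0) : State n)))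
      (Eventually.of_forall fun s => by simp [hH])
    rw [HasDerivAt.unique hs7 hs8]
    have hfa : fderiv ℝ f z (a, r, 0)
        = z.2.1 * (β * inner ℝ z.1 a + inner ℝ α a) + r * fderiv ℝ f z densDir := by
      have hk : ∀ k, fderiv ℝ f z (velDir k) = z.2.1 * (β * z.1 k + α k) := by
        intro k
        rw [← hνaff k z hz, hν, velCoeff, mul_inv_cancel_left₀ hz0]
      conv_lhs => rw [state_eq_sum ((a, r, 0) : State n)]
      simp only [map_add, map_sum, map_smul, hk, smul_eq_mul, zero_mul, add_zero]
      congr 1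
      simp only [PiLp.inner_apply, Finset.mul_sum, ← Finset.sum_add_distrib]
      refine Finset.sum_congr rfl fun k _ => ?_
      simp
      ring
    -- Since `W = w₀ - βP`, the `ρ`-derivative of `(f - w₀)/ρ` is `βρ⁻²P = βe_ρ`, which cancels
    -- against the energy term in `H`.
    have hfz : f z = w₀ - β * P z.2.1 z.2.2 + z.2.1 * fderiv ℝ f z densDir := by
      have := hWp z hz
      rw [hW, dilationCoeff] at this
      simp only [hp] at this
      linarith
    rw [hfa]
    simp only [zero_smul, zero_mul, add_zero, inner_zero_left, hfz]
    field_simp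
    ring
  simp only [hH, norm_zero, inner_zero_right] at hHeq
  have hρ0 : ρ ≠ 0 := (hIpos hρ).ne'
  have hρ₀0 : ρ₀ ≠ 0 := (hIpos hρ₀).ne'
  have h1 : ρ⁻¹ * (f (u, ρ, S) - w₀) = β * (‖u‖ ^ 2 / 2 + e ρ S) + inner ℝ α u
      + ((f (0, ρ₀, S) - w₀) / ρ₀ - β * e ρ₀ S) := by
    rw [div_eq_inv_mul]
    linear_combination hHeq
  rw [← h1, mul_inv_cancel_left₀ hρ0]
  ring

end Euler

namespace Euler

variable {n : ℕ} {I J : Set ℝ} {P e : ℝ → ℝ → ℝ} {T : Kinematic n ℝ}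

/-! ### The form of a conserved density -/

/-- The coefficient `T - ρ T_ρ` as a function of all variables. -/
def kinematicDilationCoeff (T : Kinematic n ℝ) (q : ℝ × Space n × State n) : ℝ :=
  uncurried T q - q.2.2.2.1 * fderiv ℝ (uncurried T) q (0, 0, densDir)

/-- The coefficient `ρ⁻¹ T_{u^k}` as a function of all variables. -/
def kinematicVelCoeff (T : Kinematic n ℝ) (k : Fin n) (q : ℝ × Space n × State n) : ℝ :=
  (q.2.2.2.1)⁻¹ * fderiv ℝ (uncurried T) q (0, 0, velDir k)

theorem contDiffOn_fderiv_uncurried (hI : IsOpen I) (hJ : IsOpen J)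
    (hT : IsSmoothKinematic I J T) :
    ContDiffOn ℝ ∞ (fderiv ℝ (uncurried T)) {q | q.2.2 ∈ phase n I J} :=
  ContDiffOn.fderiv_of_isOpen hT (isOpen_kinematic_domain hI hJ) (by simp)

theorem contDiffOn_kinematicDilationCoeff (hI : IsOpen I) (hJ : IsOpen J)
    (hT : IsSmoothKinematic I J T) :
    ContDiffOn ℝ ∞ (kinematicDilationCoeff T) {q | q.2.2 ∈ phase n I J} :=
  ContDiffOn.sub hT ((by fun_prop : ContDiff ℝ ∞ fun q : ℝ × Space n × State n =>
    q.2.2.2.1).contDiffOn.mul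
    ((contDiffOn_fderiv_uncurried hI hJ hT).clm_apply contDiffOn_const))

theorem contDiffOn_kinematicVelCoeff (hI : IsOpen I) (hJ : IsOpen J) (hIpos : I ⊆ Ioi 0)
    (hT : IsSmoothKinematic I J T) (k : Fin n) :
    ContDiffOn ℝ ∞ (kinematicVelCoeff T k) {q | q.2.2 ∈ phase n I J} :=
  ((by fun_prop : ContDiff ℝ ∞ fun q : ℝ × Space n × State n =>
    q.2.2.2.1).contDiffOn.inv fun _ hq => (hIpos hq.1).ne').mul
    ((contDiffOn_fderiv_uncurried hI hJ hT).clm_apply contDiffOn_const)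

theorem hasFDerivAt_slice {F : Type*} [NormedAddCommGroup F] [NormedSpace ℝ F]
    {G : ℝ × Space n × State n → F} {t : ℝ} {x : Space n}
    {v : State n} (hG : DifferentiableAt ℝ G (t, x, v)) :
    HasFDerivAt (fun v => G (t, x, v)) ((fderiv ℝ G (t, x, v)).comp
      ((ContinuousLinearMap.inr ℝ ℝ (Space n × State n)).comp
        (ContinuousLinearMap.inr ℝ (Space n) (State n)))) v :=
  HasFDerivAt.comp (g := G) (f := fun v => (t, x, v)) v hG.hasFDerivAt
    ((hasFDerivAt_prodMk_right t (x, v)).comp v (hasFDerivAt_prodMk_right x v))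

theorem fderiv_slice {G : ℝ × Space n × State n → ℝ} {t : ℝ} {x : Space n}
    {v : State n} (hG : DifferentiableAt ℝ G (t, x, v)) (a : State n) :
    fderiv ℝ (fun v => G (t, x, v)) v a = fderiv ℝ G (t, x, v) (0, 0, a) := by
  rw [(hasFDerivAt_slice hG).fderiv]
  simp

/-- The analysis of closed forms freezes `(t, x)`, whereas smoothness of the resulting coefficients
in `(t, x)` needs the joint functions. The slice lemmas identify the two. -/
theorem dilationCoeff_slice (hI : IsOpen I) (hJ : IsOpen J) (hT : IsSmoothKinematic I J T)
    (t : ℝ) (x : Space n) {v : State n} (hv : v ∈ phase n I J) :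
    dilationCoeff (fun v => uncurried T (t, x, v)) v = kinematicDilationCoeff T (t, x, v) := by
  rw [dilationCoeff, fderiv_slice (hT.differentiableAt hI hJ t x hv), kinematicDilationCoeff]

theorem velCoeff_slice (hI : IsOpen I) (hJ : IsOpen J) (hT : IsSmoothKinematic I J T)
    (t : ℝ) (x : Space n) {v : State n} (hv : v ∈ phase n I J) (k : Fin n) :
    velCoeff (fun v => uncurried T (t, x, v)) k v = kinematicVelCoeff T k (t, x, v) := by
  rw [velCoeff, fderiv_slice (hT.differentiableAt hI hJ t x hv), kinematicVelCoeff]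

theorem fderiv_dilationCoeff_slice (hI : IsOpen I) (hJ : IsOpen J)
    (hT : IsSmoothKinematic I J T)
    (t : ℝ) (x : Space n) {v : State n} (hv : v ∈ phase n I J) (a : State n) :
    fderiv ℝ (dilationCoeff (fun v => uncurried T (t, x, v))) v a
      = fderiv ℝ (kinematicDilationCoeff T) (t, x, v) (0, 0, a) := by
  rw [← fderiv_slice (((contDiffOn_kinematicDilationCoeff hI hJ hT).contDiffAt
    ((isOpen_kinematic_domain hI hJ).mem_nhds hv)).differentiableAt (by simp)),
    Filter.EventuallyEq.fderiv_eq]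
  filter_upwards [(isOpen_phase hI hJ).mem_nhds hv] with v hv
  exact dilationCoeff_slice hI hJ hT t x hv

theorem fderiv_velCoeff_slice (hI : IsOpen I) (hJ : IsOpen J) (hIpos : I ⊆ Ioi 0)
    (hT : IsSmoothKinematic I J T) (t : ℝ) (x : Space n) {v : State n} (hv : v ∈ phase n I J)
    (k : Fin n) (a : State n) :
    fderiv ℝ (velCoeff (fun v => uncurried T (t, x, v)) k) v a
      = fderiv ℝ (kinematicVelCoeff T k) (t, x, v) (0, 0, a) := by
  rw [← fderiv_slice (((contDiffOn_kinematicVelCoeff hI hJ hIpos hT k).contDiffAt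
    ((isOpen_kinematic_domain hI hJ).mem_nhds hv)).differentiableAt (by simp)),
    Filter.EventuallyEq.fderiv_eq]
  filter_upwards [(isOpen_phase hI hJ).mem_nhds hv] with v hv
  exact velCoeff_slice hI hJ hT t x hv k

/-- The coefficient of `∂ᵢ(u, ρ, S)` in the balance of `T` in the moving frame. -/
def balanceForm (P : ℝ → ℝ → ℝ) (T : Kinematic n ℝ) (t : ℝ) (i : Fin n)
    (q : Space n × State n) : State n →L[ℝ] ℝ :=
  kinematicDilationCoeff T (t, q) •
      (EuclideanSpace.proj (𝕜 := ℝ) i).comp (ContinuousLinearMap.fst ℝ (Space n) (ℝ × ℝ))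
    - kinematicVelCoeff T i (t, q) • fderiv ℝ (fun v : State n => P v.2.1 v.2.2) q.2

theorem contDiffOn_pressure (hP : ContDiffOn ℝ ∞ (fun q : ℝ × ℝ => P q.1 q.2) (I ×ˢ J)) :
    ContDiffOn ℝ ∞ (fun v : State n => P v.2.1 v.2.2) (phase n I J) :=
  hP.comp (f := fun v : State n => (v.2.1, v.2.2)) (by fun_prop) fun _ hv => hv

theorem contDiffOn_balanceForm (hI : IsOpen I) (hJ : IsOpen J) (hIpos : I ⊆ Ioi 0)
    (hP : ContDiffOn ℝ ∞ (fun q : ℝ × ℝ => P q.1 q.2) (I ×ˢ J))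
    (hT : IsSmoothKinematic I J T) (t : ℝ) (i : Fin n) :
    ContDiffOn ℝ ∞ (balanceForm P T t i) {q | q.2 ∈ phase n I J} := by
  have hslice : ContDiffOn ℝ ∞ (fun q : Space n × State n => (t, q)) {q | q.2 ∈ phase n I J} :=
    (contDiff_const.prodMk contDiff_id).contDiffOn
  have hp := ((contDiffOn_pressure (n := n) hP).fderiv_of_isOpen (isOpen_phase hI hJ)
    (m := ∞) (by simp)).comp (f := fun q : Space n × State n => q.2) (s := {q : Space n × State n | q.2 ∈ phase n I J})
    contDiff_snd.contDiffOn fun _ hq => hq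
  exact (((contDiffOn_kinematicDilationCoeff hI hJ hT).comp hslice fun _ hq => hq).smul
    contDiffOn_const).sub
    (((contDiffOn_kinematicVelCoeff hI hJ hIpos hT i).comp hslice fun _ hq => hq).smul hp)

/-- The moving balance brought to the shape `A(x, w) + ∑ Bⁱ(x, w) ∂ᵢw` required by
`affine_null_lagrangian`. -/
theorem timeDeriv_add_divergence_smul_eq_sum (hI : IsOpen I) (hJ : IsOpen J)
    (hP : ContDiffOn ℝ ∞ (fun q : ℝ × ℝ => P q.1 q.2) (I ×ˢ J))
    (hT : IsSmoothKinematic I J T) (t : ℝ) {w : Space n → State n} (hw : IsField I J w)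
    (x : Space n) :
    timeDeriv P T t w x + divergence (fun y => onField T t w y • (w y).1) x
      = fderiv ℝ (uncurried T) (t, x, w x) (1, (w x).1, 0)
        + ∑ i, balanceForm P T t i (x, w x) (fderiv ℝ w x (EuclideanSpace.single i 1)) := by
  have hTd := hT.differentiableAt hI hJ t x (hw.2 x)
  have hwd : DifferentiableAt ℝ w x := hw.1.differentiable (by simp) x
  have hpd : DifferentiableAt ℝ (fun v : State n => P v.2.1 v.2.2) (w x) :=
    ((contDiffOn_pressure (n := n) hP).contDiffAt
      ((isOpen_phase hI hJ).mem_nhds (hw.2 x))).differentiableAt (by simp)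
  have hpw : HasFDerivAt (fun y => P (w y).2.1 (w y).2.2) _ x :=
    HasFDerivAt.comp (g := fun v : State n => P v.2.1 v.2.2) x hpd.hasFDerivAt hwd.hasFDerivAt
  rw [timeDeriv_add_divergence_smul hTd hwd]
  set g := gradient (fun y => P (w y).2.1 (w y).2.2) x with hg
  set d := divergence (fun y => (w y).1) x with hd
  set L := fderiv ℝ (uncurried T) (t, x, w x) with hL
  have hgi : ∀ i, g i = fderiv ℝ (fun v : State n => P v.2.1 v.2.2) (w x)
      (fderiv ℝ w x (EuclideanSpace.single i 1)) := by
    intro i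
    have h1 : inner ℝ g (EuclideanSpace.single i (1 : ℝ))
        = fderiv ℝ (fun y => P (w y).2.1 (w y).2.2) x (EuclideanSpace.single i 1) := by
      rw [hg, gradient, InnerProductSpace.toDual_symm_apply]
    rw [hpw.fderiv, EuclideanSpace.inner_single_right] at h1
    simpa using h1
  have hd' : d = ∑ i, (fderiv ℝ w x (EuclideanSpace.single i 1)).1 i := by
    have hw1 : HasFDerivAt (fun y => (w y).1)
        ((ContinuousLinearMap.fst ℝ (Space n) (ℝ × ℝ)).comp (fderiv ℝ w x)) x :=
      (ContinuousLinearMap.fst ℝ (Space n) (ℝ × ℝ)).hasFDerivAt.comp x hwd.hasFDerivAt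
    rw [hd, divergence, hw1.fderiv]
    rfl
  have hsplit : ((1 : ℝ), (w x).1, (-(((w x).2.1)⁻¹ • g), -((w x).2.1 * d), (0 : ℝ)))
      = (1, (w x).1, 0) - ((w x).2.1)⁻¹ • ∑ i, g i • ((0, 0, velDir i) : ℝ × Space n × State n)
        - ((w x).2.1 * d) • (0, 0, densDir) := by
    have h1 : ∑ i, g i • ((0, 0, velDir i) : ℝ × Space n × State n) = (0, 0, (g, 0, 0)) := by
      have h2 := state_eq_sum ((g, 0, 0) : State n)
      rw [zero_smul, zero_smul, add_zero, add_zero] at h2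
      have h3 := congrArg ((ContinuousLinearMap.inr ℝ ℝ (Space n × State n)).comp
        (ContinuousLinearMap.inr ℝ (Space n) (State n))) h2
      rw [map_sum] at h3
      refine Eq.trans (Finset.sum_congr rfl fun i _ => ?_) h3.symm
      simp
    rw [h1]
    refine Prod.ext ?_ (Prod.ext ?_ (Prod.ext ?_ (Prod.ext ?_ ?_))) <;> simp [densDir]
  rw [hsplit, map_sub, map_sub, map_smul, map_smul, map_sum]
  have hsum : ∑ i, balanceForm P T t i (x, w x) (fderiv ℝ w x (EuclideanSpace.single i 1))
      = kinematicDilationCoeff T (t, x, w x) * d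
        - ∑ i, g i * kinematicVelCoeff T i (t, x, w x) := by
    rw [hd', Finset.mul_sum, ← Finset.sum_sub_distrib]
    refine Finset.sum_congr rfl fun i _ => ?_
    rw [hgi i]
    simp [balanceForm, mul_comm]
  rw [hsum]
  simp only [map_smul, smul_eq_mul, kinematicDilationCoeff, kinematicVelCoeff, ← hL]
  have hon : onField T t w x = uncurried T (t, x, w x) := rfl
  rw [hon, Finset.mul_sum]
  have : ∀ i, ((w x).2.1)⁻¹ * (g i * L (0, 0, velDir i))
      = g i * (((w x).2.1)⁻¹ * L (0, 0, velDir i)) := fun i => by ring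
  simp only [this]
  ring

/-- For a conserved density the forms `(T - ρ T_ρ) duⁱ - ρ⁻¹ T_{uⁱ} dP` are closed. -/
theorem IsConserved.closed (hI : IsOpen I) (hJ : IsOpen J) (hIpos : I ⊆ Ioi 0)
    (hP : ContDiffOn ℝ ∞ (fun q : ℝ × ℝ => P q.1 q.2) (I ×ˢ J))
    (hT : IsSmoothKinematic I J T) (hc : IsConserved I J P T) (t : ℝ) (x : Space n)
    {v : State n} (hv : v ∈ phase n I J) (i : Fin n) (a b : State n) :
    fderiv ℝ (dilationCoeff fun v => uncurried T (t, x, v)) v a * b.1 i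
        - fderiv ℝ (velCoeff (fun v => uncurried T (t, x, v)) i) v a
          * fderiv ℝ (fun v : State n => P v.2.1 v.2.2) v b
      = fderiv ℝ (dilationCoeff fun v => uncurried T (t, x, v)) v b * a.1 i
        - fderiv ℝ (velCoeff (fun v => uncurried T (t, x, v)) i) v b
          * fderiv ℝ (fun v : State n => P v.2.1 v.2.2) v a := by
  obtain ⟨k, X, hX, hdiv⟩ := hc
  have hslice : ContDiffOn ℝ ∞ (fun q : Space n × State n => (t, q)) {q | q.2 ∈ phase n I J} :=
    (contDiff_const.prodMk contDiff_id).contDiffOn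
  have hA : ContDiffOn ℝ ∞ (fun q : Space n × State n =>
      fderiv ℝ (uncurried T) (t, q) (1, q.2.1, 0)) {q | q.2 ∈ phase n I J} :=
    ((contDiffOn_fderiv_uncurried hI hJ hT).comp hslice fun _ hq => hq).clm_apply (by fun_prop)
  have hTu : ContDiffOn ℝ ∞ (fun q : Space n × Jet n k => uncurried T (t, q.1, q.2.1) • q.2.1.1)
      {q | q.2.1 ∈ phase n I J} :=
    (ContDiffOn.comp (g := uncurried T) (f := fun q : Space n × Jet n k => (t, q.1, q.2.1)) hT
      (by fun_prop) fun _ hq => hq).smul (by fun_prop)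
  -- Conservation says that the moving balance is the divergence of `Tu - X`.
  have key := (affine_null_lagrangian hI hJ hA (contDiffOn_balanceForm hI hJ hIpos hP hT t)
    (X := fun y z => uncurried T (t, y, z.1) • z.1.1 - X t y z) (hTu.sub (hX.slice t))
    (fun w hw x => by
      have h1 := timeDeriv_add_divergence_smul_eq_sum hI hJ hP hT t hw x
      have h2 := hdiv t w hw x
      have hd1 : DifferentiableAt ℝ (fun y => uncurried T (t, y, (jet k w y).1) • (jet k w y).1.1) x :=
        (contDiff_local hI hJ (X := fun y z => uncurried T (t, y, z.1) • z.1.1) hTu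
          hw).differentiable (by simp) x
      rw [divergence_sub hd1 (hX.differentiableAt hI hJ t hw x), ← h1]
      have e1 : divergence (fun y => uncurried T (t, y, (jet k w y).1) • (jet k w y).1.1) x
        = divergence (fun y => onField T t w y • (w y).1) x := rfl
      rw [e1]
      linarith) x hv a).2 i b
  have hmem := (isOpen_kinematic_domain (n := n) hI hJ).mem_nhds (x := (t, x, v)) hv
  have hWd : DifferentiableAt ℝ (kinematicDilationCoeff T) (t, x, v) :=
    ((contDiffOn_kinematicDilationCoeff hI hJ hT).contDiffAt hmem).differentiableAt (by simp)
  have hνd : DifferentiableAt ℝ (kinematicVelCoeff T i) (t, x, v) :=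
    ((contDiffOn_kinematicVelCoeff hI hJ hIpos hT i).contDiffAt hmem).differentiableAt (by simp)
  have hps := (contDiffOn_pressure (n := n) hP).contDiffAt ((isOpen_phase hI hJ).mem_nhds hv)
  have hpd : DifferentiableAt ℝ (fderiv ℝ (fun v : State n => P v.2.1 v.2.2)) v :=
    (hps.fderiv_right (m := ∞) (by simp)).differentiableAt (by simp)
  -- The terms `νᵢ d²P(a, b)` and `νᵢ d²P(b, a)` have to cancel, leaving only `dW ∧ duⁱ - dνᵢ ∧ dP`.
  have hsymm : IsSymmSndFDerivAt ℝ (fun v : State n => P v.2.1 v.2.2) v :=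
    hps.isSymmSndFDerivAt
      (by simp only [minSmoothness_of_isRCLikeNormedField]; exact ENat.LEInfty.out)
  have hW1 : HasFDerivAt (fun q : Space n × State n => kinematicDilationCoeff T (t, q)) _ (x, v) :=
    hWd.hasFDerivAt.comp (x, v) (hasFDerivAt_prodMk_right t (x, v))
  have hν1 : HasFDerivAt (fun q : Space n × State n => kinematicVelCoeff T i (t, q)) _ (x, v) :=
    hνd.hasFDerivAt.comp (x, v) (hasFDerivAt_prodMk_right t (x, v))
  have hp1 : HasFDerivAt (fun q : Space n × State n =>
      fderiv ℝ (fun v : State n => P v.2.1 v.2.2) q.2) _ (x, v) :=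
    HasFDerivAt.comp (g := fderiv ℝ (fun v : State n => P v.2.1 v.2.2)) (x, v) hpd.hasFDerivAt
      (hasFDerivAt_snd (p := (x, v)))
  have hB : HasFDerivAt (balanceForm P T t i) _ (x, v) :=
    (hW1.smul_const ((EuclideanSpace.proj (𝕜 := ℝ) i).comp
      (ContinuousLinearMap.fst ℝ (Space n) (ℝ × ℝ)))).fun_sub (hν1.fun_smul hp1)
  rw [hB.fderiv] at key
  rw [fderiv_dilationCoeff_slice hI hJ hT t x hv, fderiv_dilationCoeff_slice hI hJ hT t x hv,
    fderiv_velCoeff_slice hI hJ hIpos hT t x hv, fderiv_velCoeff_slice hI hJ hIpos hT t x hv]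
  simp only [sub_apply, add_apply, smul_apply, ContinuousLinearMap.smulRight_apply,
    ContinuousLinearMap.comp_apply, ContinuousLinearMap.inr_apply, ContinuousLinearMap.coe_fst',
    ContinuousLinearMap.coe_snd', smul_eq_mul] at key
  rw [hsymm.eq a b] at key
  have hproj : ∀ c : Space n, EuclideanSpace.proj (𝕜 := ℝ) i c = c i := fun _ => rfl
  rw [hproj, hproj] at key
  linarith

/-- A conserved density has the form `w₀(t, x) + ρ(β(½|u|² + e) + α·u + h)`. -/
theorem IsConserved.exists_affineDensity (hn : 1 < n) (hI : IsOpen I) (hJ : IsOpen J)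
    (hI' : I.OrdConnected) (hJ' : J.OrdConnected) (hIpos : I ⊆ Ioi 0)
    (hP : ContDiffOn ℝ ∞ (fun q : ℝ × ℝ => P q.1 q.2) (I ×ˢ J)) (hJne : J.Nonempty)
    (hPρ : ∀ U ⊆ J, IsOpen U → U.Nonempty → ∃ S ∈ U, ∃ ρ ∈ I, deriv (fun r => P r S) ρ ≠ 0)
    (he : IsInternalEnergy I J P e) (hT : IsSmoothKinematic I J T) (hc : IsConserved I J P T) :
    ∃ (w₀ β : ℝ × Space n → ℝ) (α : ℝ × Space n → Space n) (h : ℝ × Space n × ℝ → ℝ),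
      ContDiff ℝ ∞ w₀ ∧ ContDiff ℝ ∞ β ∧ ContDiff ℝ ∞ α ∧ ContDiffOn ℝ ∞ h {q | q.2.2 ∈ J} ∧
      ∀ t x, ∀ u : Space n, ∀ ρ ∈ I, ∀ S ∈ J,
        T t x u ρ S = (background w₀ + affineDensity e β α h) t x u ρ S := by
  -- One base state with `P_ρ ≠ 0` serves for all `(t, x)`. The coefficients become explicit
  -- expressions in `T` and its derivatives at that state, hence smooth.
  obtain ⟨S₀, hS₀, ρ₀, hρ₀, hP₀⟩ := hPρ J subset_rfl hJ hJne
  have hv₀ : ((0, ρ₀, S₀) : State n) ∈ phase n I J := ⟨hρ₀, hS₀⟩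
  have ho := isOpen_kinematic_domain (n := n) hI hJ
  have hpt : ContDiff ℝ ∞ fun q : ℝ × Space n => (q.1, q.2, ((0, ρ₀, S₀) : State n)) := by fun_prop
  have hcomp : ∀ {F : Type} [NormedAddCommGroup F] [NormedSpace ℝ F]
      {G : ℝ × Space n × State n → F}, ContDiffOn ℝ ∞ G {q | q.2.2 ∈ phase n I J} →
      ContDiff ℝ ∞ fun q : ℝ × Space n => G (q.1, q.2, (0, ρ₀, S₀)) := by
    intro F _ _ G hG
    rw [contDiff_iff_contDiffAt]
    exact fun q => ContDiffAt.comp (g := G)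
      (f := fun q : ℝ × Space n => (q.1, q.2, ((0, ρ₀, S₀) : State n))) q
      (hG.contDiffAt (ho.mem_nhds hv₀)) hpt.contDiffAt
  have hWs := contDiffOn_kinematicDilationCoeff hI hJ hT
  have hβ : ContDiff ℝ ∞ fun q : ℝ × Space n =>
      -fderiv ℝ (kinematicDilationCoeff T) (q.1, q.2, (0, ρ₀, S₀)) (0, 0, densDir)
        / deriv (fun r => P r S₀) ρ₀ :=
    ((hcomp ((hWs.fderiv_of_isOpen ho (m := ∞) (by simp)))).clm_apply
      contDiff_const).neg.div_const _
  set β : ℝ × Space n → ℝ := fun q : ℝ × Space n =>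
      -fderiv ℝ (kinematicDilationCoeff T) (q.1, q.2, (0, ρ₀, S₀)) (0, 0, densDir)
        / deriv (fun r => P r S₀) ρ₀ with hβdef
  have hw₀ : ContDiff ℝ ∞ fun q : ℝ × Space n =>
      kinematicDilationCoeff T (q.1, q.2, (0, ρ₀, S₀)) + β q * P ρ₀ S₀ :=
    (hcomp hWs).add (hβ.mul contDiff_const)
  set w₀ : ℝ × Space n → ℝ := fun q : ℝ × Space n =>
      kinematicDilationCoeff T (q.1, q.2, (0, ρ₀, S₀)) + β q * P ρ₀ S₀ with hw₀def
  have hα : ContDiff ℝ ∞ fun q : ℝ × Space n =>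
      WithLp.toLp 2 fun i => kinematicVelCoeff T i (q.1, q.2, (0, ρ₀, S₀)) :=
    contDiff_euclidean.2 fun i => hcomp (contDiffOn_kinematicVelCoeff hI hJ hIpos hT i)
  have hh : ContDiffOn ℝ ∞ (fun q : ℝ × Space n × ℝ =>
      (uncurried T (q.1, q.2.1, (0, ρ₀, q.2.2)) - w₀ (q.1, q.2.1)) / ρ₀
        - β (q.1, q.2.1) * e ρ₀ q.2.2) {q | q.2.2 ∈ J} := by
    have h1 : ContDiff ℝ ∞ fun q : ℝ × Space n × ℝ => (q.1, q.2.1) := by fun_prop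
    have h2 : ContDiffOn ℝ ∞ (fun q : ℝ × Space n × ℝ =>
        uncurried T (q.1, q.2.1, (0, ρ₀, q.2.2))) {q | q.2.2 ∈ J} :=
      ContDiffOn.comp (g := uncurried T)
        (f := fun q : ℝ × Space n × ℝ => (q.1, q.2.1, ((0, ρ₀, q.2.2) : State n))) hT
        (by fun_prop) fun _ hq => ⟨hρ₀, hq⟩
    have h3 : ContDiffOn ℝ ∞ (fun q : ℝ × Space n × ℝ => e ρ₀ q.2.2) {q | q.2.2 ∈ J} :=
      he.1.comp (f := fun q : ℝ × Space n × ℝ => (ρ₀, q.2.2)) (by fun_prop)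
        fun _ hq => ⟨hρ₀, hq⟩
    exact ((h2.sub (hw₀.comp h1).contDiffOn).div_const _).sub ((hβ.comp h1).contDiffOn.mul h3)
  refine ⟨w₀, β, _, _, hw₀, hβ, hα, hh, fun t x u ρ hρ S hS => ?_⟩
  have hslice : ContDiffOn ℝ ∞ (fun v => uncurried T (t, x, v)) (phase n I J) :=
    ContDiffOn.comp (g := uncurried T) (f := fun v : State n => (t, x, v)) hT (by fun_prop)
      fun _ hv => hv
  exact eq_of_closed hn hI hJ hI' hJ' hIpos hP hPρ he hρ₀ hS₀ hP₀ hslice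
    (fun v hv i a b => hc.closed hI hJ hIpos hP hT t x hv i a b)
    (β := β (t, x)) (w₀ := w₀ (t, x))
    (α := WithLp.toLp 2 fun i => kinematicVelCoeff T i (t, x, (0, ρ₀, S₀)))
    (by rw [fderiv_dilationCoeff_slice hI hJ hT t x hv₀])
    (fun i => by rw [velCoeff_slice hI hJ hT t x hv₀])
    (by rw [dilationCoeff_slice hI hJ hT t x hv₀]) u hρ hS

end Euler

namespace Euler

variable {n : ℕ} {I J : Set ℝ} {P e : ℝ → ℝ → ℝ} {T T₁ T₂ : Kinematic n ℝ}
  {β : ℝ × Space n → ℝ} {α : ℝ × Space n → Space n} {h : ℝ × Space n × ℝ → ℝ}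

/-! ### The determining equations -/

/-- The source in the balance of the density `ρ(β(½|u|² + e) + α·u + h)`. -/
def balanceSource (P e : ℝ → ℝ → ℝ) (β : ℝ × Space n → ℝ) (α : ℝ × Space n → Space n)
    (h : ℝ × Space n × ℝ → ℝ) (t : ℝ) (q : Space n × State n) : ℝ :=
  q.2.2.1 * (fderiv ℝ β (t, q.1) (1, q.2.1) * (‖q.2.1‖ ^ 2 / 2 + e q.2.2.1 q.2.2.2)
      + inner ℝ (fderiv ℝ α (t, q.1) (1, q.2.1)) q.2.1
      + fderiv ℝ h (t, q.1, q.2.2.2) (1, q.2.1, 0))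
    + P q.2.2.1 q.2.2.2 * (fderiv ℝ β (t, q.1) (0, q.2.1)
      + ∑ i, fderiv ℝ α (t, q.1) (0, EuclideanSpace.single i 1) i)

theorem contDiffOn_balanceSource (hJ : IsOpen J)
    (hP : ContDiffOn ℝ ∞ (fun q : ℝ × ℝ => P q.1 q.2) (I ×ˢ J))
    (he : ContDiffOn ℝ ∞ (fun q : ℝ × ℝ => e q.1 q.2) (I ×ˢ J)) (hβ : ContDiff ℝ ∞ β)
    (hα : ContDiff ℝ ∞ α) (hh : ContDiffOn ℝ ∞ h {q | q.2.2 ∈ J}) (t : ℝ) :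
    ContDiffOn ℝ ∞ (balanceSource P e β α h t) {q | q.2 ∈ phase n I J} := by
  have ho : IsOpen {q : ℝ × Space n × ℝ | q.2.2 ∈ J} := hJ.preimage (by fun_prop)
  have hpt : ContDiff ℝ ∞ fun q : Space n × State n => (t, q.1) := by fun_prop
  have hu : ContDiff ℝ ∞ fun q : Space n × State n => q.2.1 := by fun_prop
  have hρ : ContDiff ℝ ∞ fun q : Space n × State n => q.2.2.1 := by fun_prop
  have hdβ := (hβ.fderiv_right (m := ∞) (by simp)).comp hpt
  have hdα := (hα.fderiv_right (m := ∞) (by simp)).comp hpt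
  have hdh : ContDiffOn ℝ ∞ (fun q : Space n × State n => fderiv ℝ h (t, q.1, q.2.2.2))
      {q | q.2 ∈ phase n I J} :=
    (hh.fderiv_of_isOpen ho (m := ∞) (by simp)).comp
      (f := fun q : Space n × State n => (t, q.1, q.2.2.2)) (by fun_prop) fun _ hq => hq.2
  have hp : ContDiffOn ℝ ∞ (fun q : Space n × State n => P q.2.2.1 q.2.2.2)
      {q | q.2 ∈ phase n I J} :=
    hP.comp (f := fun q : Space n × State n => (q.2.2.1, q.2.2.2)) (by fun_prop) fun _ hq => hq
  have hee : ContDiffOn ℝ ∞ (fun q : Space n × State n => e q.2.2.1 q.2.2.2)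
      {q | q.2 ∈ phase n I J} :=
    he.comp (f := fun q : Space n × State n => (q.2.2.1, q.2.2.2)) (by fun_prop) fun _ hq => hq
  have h1 : ContDiff ℝ ∞ fun q : Space n × State n => ((1 : ℝ), q.2.1) := by fun_prop
  have h0 : ContDiff ℝ ∞ fun q : Space n × State n => ((0 : ℝ), q.2.1) := by fun_prop
  have h2 : ContDiff ℝ ∞ fun q : Space n × State n => ((1 : ℝ), q.2.1, (0 : ℝ)) := by fun_prop
  have hn2 : ContDiff ℝ ∞ fun q : Space n × State n => ‖q.2.1‖ ^ 2 / 2 :=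
    (hu.norm_sq ℝ).div_const 2
  have hdiv : ContDiff ℝ ∞ fun q : Space n × State n =>
      ∑ i, fderiv ℝ α (t, q.1) (0, EuclideanSpace.single i 1) i :=
    ContDiff.sum fun i _ => (EuclideanSpace.proj (𝕜 := ℝ) i).contDiff.comp
      (hdα.clm_apply contDiff_const)
  exact (hρ.contDiffOn.mul ((((hdβ.clm_apply h1).contDiffOn.mul (hn2.contDiffOn.add hee)).add
    ((hdα.clm_apply h1).inner ℝ hu).contDiffOn).add (hdh.clm_apply h2.contDiffOn))).add
    (hp.mul ((hdβ.clm_apply h0).add hdiv).contDiffOn)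

/-- With the flux `Tu + P(βu + α)` the balance contains no derivatives of the fields. For a
conserved density the source is thus a divergence that depends only on the value of the field, and
`eq_of_eq_divergence` applies. -/
theorem balanceSource_eq (hI : IsOpen I) (hJ : IsOpen J)
    (hI' : I.OrdConnected) (hJ' : J.OrdConnected) (hIpos : I ⊆ Ioi 0)
    (hP : ContDiffOn ℝ ∞ (fun q : ℝ × ℝ => P q.1 q.2) (I ×ˢ J))
    (he : IsInternalEnergy I J P e) (hβ : ContDiff ℝ ∞ β)
    (hα : ContDiff ℝ ∞ α) (hh : ContDiffOn ℝ ∞ h {q | q.2.2 ∈ J})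
    (hc : IsConserved I J P (affineDensity e β α h)) (t : ℝ) (x : Space n) {v v' : State n}
    (hv : v ∈ phase n I J) (hv' : v' ∈ phase n I J) :
    balanceSource P e β α h t (x, v) = balanceSource P e β α h t (x, v') := by
  obtain ⟨k, X, hX, hdiv⟩ := hc
  have hT := isSmoothKinematic_affineDensity he.1 hβ hα hh
  have hF := (isSmoothLocal_flux hP hT 0 hβ hα).truncate (Nat.zero_le k)
  refine eq_of_eq_divergence hI hJ hI' hJ' (contDiffOn_balanceSource hJ hP he.1 hβ hα hh t)
    (X := fun x (z : Jet n k) => uncurried (affineDensity e β α h)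
          (t, x, (z.truncate (Nat.zero_le k)).1) • (z.truncate (Nat.zero_le k)).1.1
        + (P (z.truncate (Nat.zero_le k)).1.2.1 (z.truncate (Nat.zero_le k)).1.2.2 - 0)
          • (β (t, x) • (z.truncate (Nat.zero_le k)).1.1 + α (t, x)) - X t x z)
    ((hF.slice t).sub (hX.slice t)) (fun w hw x => ?_) x hv hv'
  have h1 := timeDeriv_affineDensity_add_divergence hI hJ hIpos hP he.sub_zero hβ hα hh t hw x
  have h2 := hdiv t w hw x
  rw [divergence_sub (hF.differentiableAt hI hJ t hw x) (hX.differentiableAt hI hJ t hw x)]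
  have e1 : balanceSource P e β α h t (x, w x)
      = timeDeriv P (affineDensity e β α h) t w x
        + divergence (fun y => onField (affineDensity e β α h) t w y • (w y).1
          + (P (w y).2.1 (w y).2.2 - 0) • (β (t, y) • (w y).1 + α (t, y))) x := by
    rw [h1, balanceSource]
    simp only [sub_zero]
  have e2 : divergence (fun y => (fun t x (z : Jet n k) => uncurried (affineDensity e β α h)
          (t, x, (z.truncate (Nat.zero_le k)).1) • (z.truncate (Nat.zero_le k)).1.1
        + (P (z.truncate (Nat.zero_le k)).1.2.1 (z.truncate (Nat.zero_le k)).1.2.2 - 0)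
          • (β (t, x) • (z.truncate (Nat.zero_le k)).1.1 + α (t, x))) t y (jet k w y)) x
      = divergence (fun y => onField (affineDensity e β α h) t w y • (w y).1
          + (P (w y).2.1 (w y).2.2 - 0) • (β (t, y) • (w y).1 + α (t, y))) x := rfl
  rw [e1]
  refine Eq.trans ?_ (congrArg (· - _) e2.symm)
  linarith

/-- The equations satisfied by the coefficients of a conserved density
`ρ(β(½|u|² + e) + α·u + h)`. -/
structure DeterminingEquations (I J : Set ℝ) (P e : ℝ → ℝ → ℝ) (β : ℝ × Space n → ℝ)
    (α : ℝ × Space n → Space n) (h : ℝ × Space n × ℝ → ℝ) : Prop where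
  contDiff_β : ContDiff ℝ ∞ β
  contDiff_α : ContDiff ℝ ∞ α
  contDiffOn_h : ContDiffOn ℝ ∞ h {q | q.2.2 ∈ J}
  β_space : ∀ t x u, fderiv ℝ β (t, x) (0, u) = 0
  α_space : ∀ t x u, fderiv ℝ β (t, x) (1, 0) * ‖u‖ ^ 2 / 2
    + inner ℝ (fderiv ℝ α (t, x) (0, u)) u = 0
  α_time : ∀ t x u, ∀ S ∈ J,
    inner ℝ (fderiv ℝ α (t, x) (1, 0)) u + fderiv ℝ h (t, x, S) (0, u, 0) = 0
  pressure : ∀ t x, ∀ ρ ∈ I, ∀ S ∈ J, ∀ ρ' ∈ I, ∀ S' ∈ J,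
    ρ * (fderiv ℝ β (t, x) (1, 0) * e ρ S + fderiv ℝ h (t, x, S) (1, 0, 0))
        - n / 2 * fderiv ℝ β (t, x) (1, 0) * P ρ S
      = ρ' * (fderiv ℝ β (t, x) (1, 0) * e ρ' S' + fderiv ℝ h (t, x, S') (1, 0, 0))
        - n / 2 * fderiv ℝ β (t, x) (1, 0) * P ρ' S'

theorem determiningEquations (hI : IsOpen I) (hJ : IsOpen J)
    (hI' : I.OrdConnected) (hJ' : J.OrdConnected) (hIpos : I ⊆ Ioi 0)
    (hP : ContDiffOn ℝ ∞ (fun q : ℝ × ℝ => P q.1 q.2) (I ×ˢ J))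
    (hIne : I.Nonempty) (he : IsInternalEnergy I J P e) (hβ : ContDiff ℝ ∞ β)
    (hJne : J.Nonempty) (hα : ContDiff ℝ ∞ α) (hh : ContDiffOn ℝ ∞ h {q | q.2.2 ∈ J})
    (hc : IsConserved I J P (affineDensity e β α h)) : DeterminingEquations I J P e β α h := by
  have hN : ∀ t x u u', ∀ ρ ∈ I, ∀ S ∈ J, ∀ ρ' ∈ I, ∀ S' ∈ J,
      balanceSource P e β α h t (x, u, ρ, S) = balanceSource P e β α h t (x, u', ρ', S') :=
    fun t x u u' ρ hρ S hS ρ' hρ' S' hS' =>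
      balanceSource_eq hI hJ hI' hJ' hIpos hP he hβ hα hh hc t x ⟨hρ, hS⟩ ⟨hρ', hS'⟩
  have hsource : ∀ t x u ρ S, balanceSource P e β α h t (x, u, ρ, S)
      = ρ * ((fderiv ℝ β (t, x) (1, 0) + fderiv ℝ β (t, x) (0, u)) * (‖u‖ ^ 2 / 2 + e ρ S)
          + (inner ℝ (fderiv ℝ α (t, x) (1, 0)) u + inner ℝ (fderiv ℝ α (t, x) (0, u)) u)
          + (fderiv ℝ h (t, x, S) (1, 0, 0) + fderiv ℝ h (t, x, S) (0, u, 0)))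
        + P ρ S * (fderiv ℝ β (t, x) (0, u)
          + ∑ i, fderiv ℝ α (t, x) (0, EuclideanSpace.single i 1) i) := by
    intro t x u ρ S
    rw [balanceSource, ← inner_add_left, ← map_add, ← map_add, ← map_add]
    simp
  have hcoef : ∀ t x u, ∀ ρ ∈ I, ∀ S ∈ J,
      ρ * (fderiv ℝ β (t, x) (0, u) * ‖u‖ ^ 2 / 2) = 0 ∧
      ρ * (fderiv ℝ β (t, x) (1, 0) * ‖u‖ ^ 2 / 2 + inner ℝ (fderiv ℝ α (t, x) (0, u)) u) = 0 ∧
      ρ * (fderiv ℝ β (t, x) (0, u) * e ρ S + inner ℝ (fderiv ℝ α (t, x) (1, 0)) u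
        + fderiv ℝ h (t, x, S) (0, u, 0)) + P ρ S * fderiv ℝ β (t, x) (0, u) = 0 := by
    intro t x u ρ hρ S hS
    -- The source at velocity `su` minus the source at rest is a cubic polynomial in `s` without
    -- constant term. Its vanishing at `1`, `-1` and `2` suffices to annihilate the three
    -- coefficients.
    have hs : ∀ s : ℝ, s ^ 3 * (ρ * (fderiv ℝ β (t, x) (0, u) * ‖u‖ ^ 2 / 2))
        + s ^ 2 * (ρ * (fderiv ℝ β (t, x) (1, 0) * ‖u‖ ^ 2 / 2
          + inner ℝ (fderiv ℝ α (t, x) (0, u)) u))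
        + s * (ρ * (fderiv ℝ β (t, x) (0, u) * e ρ S + inner ℝ (fderiv ℝ α (t, x) (1, 0)) u
        + fderiv ℝ h (t, x, S) (0, u, 0)) + P ρ S * fderiv ℝ β (t, x) (0, u)) = 0 := by
      intro s
      have h1 := hN t x (s • u) 0 ρ hρ S hS ρ hρ S hS
      rw [hsource, hsource] at h1
      have e1 : ((0 : ℝ), s • u) = s • ((0 : ℝ), u) := by simp
      have e2 : ((0 : ℝ), s • u, (0 : ℝ)) = s • ((0 : ℝ), u, (0 : ℝ)) := by simp
      have e3 : ((0 : ℝ), (0 : Space n)) = 0 := rfl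
      have e4 : ((0 : ℝ), (0 : Space n), (0 : ℝ)) = 0 := rfl
      rw [e1, e2, e3, e4] at h1
      simp only [map_smul, map_zero, norm_smul, inner_smul_left, inner_smul_right, smul_eq_mul,
        inner_zero_right, norm_zero, mul_pow, Real.norm_eq_abs, sq_abs, conj_trivial] at h1
      linear_combination h1
    have h1 := hs 1
    have h2 := hs (-1)
    have h3 := hs 2
    refine ⟨?_, ?_, ?_⟩ <;> linarith
  obtain ⟨ρ₀, hρ₀⟩ := hIne
  obtain ⟨S₀, hS₀⟩ := hJne
  have hρ₀0 : ρ₀ ≠ 0 := (hIpos hρ₀).ne'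
  have hβs : ∀ t x u, fderiv ℝ β (t, x) (0, u) = 0 := by
    intro t x u
    by_cases hu : u = 0
    · subst hu
      exact map_zero (fderiv ℝ β (t, x))
    · have h1 := ((mul_eq_zero.1 (hcoef t x u ρ₀ hρ₀ S₀ hS₀).1).resolve_left hρ₀0)
      have hu2 : ‖u‖ ^ 2 ≠ 0 := pow_ne_zero 2 (norm_ne_zero_iff.2 hu)
      have h2 : fderiv ℝ β (t, x) (0, u) * ‖u‖ ^ 2 = 0 := by linarith
      exact (mul_eq_zero.1 h2).resolve_right hu2
  have hαs : ∀ t x u, fderiv ℝ β (t, x) (1, 0) * ‖u‖ ^ 2 / 2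
      + inner ℝ (fderiv ℝ α (t, x) (0, u)) u = 0 := fun t x u =>
    (mul_eq_zero.1 (hcoef t x u ρ₀ hρ₀ S₀ hS₀).2.1).resolve_left hρ₀0
  -- The trace of the quadratic equation, obtained by inserting the basis vectors.
  have hdiv : ∀ t x, ∑ i, fderiv ℝ α (t, x) (0, EuclideanSpace.single i 1) i
      = -(n / 2 * fderiv ℝ β (t, x) (1, 0)) := by
    intro t x
    have h1 : ∀ i : Fin n, fderiv ℝ α (t, x) (0, EuclideanSpace.single i 1) i
        = -(fderiv ℝ β (t, x) (1, 0) / 2) := by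
      intro i
      have := hαs t x (EuclideanSpace.single i 1)
      rw [EuclideanSpace.inner_single_right] at this
      simp at this
      linarith
    simp only [h1, Finset.sum_const, Finset.card_univ, Fintype.card_fin, nsmul_eq_mul]
    ring
  refine ⟨hβ, hα, hh, hβs, hαs, ?_, ?_⟩
  · intro t x u S hS
    have h1 := (hcoef t x u ρ₀ hρ₀ S hS).2.2
    rw [hβs] at h1
    have h2 : ρ₀ * (inner ℝ (fderiv ℝ α (t, x) (1, 0)) u + fderiv ℝ h (t, x, S) (0, u, 0)) = 0 := by
      linarith
    exact (mul_eq_zero.1 h2).resolve_left hρ₀0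
  · intro t x ρ hρ S hS ρ' hρ' S' hS'
    have h1 := hN t x 0 0 ρ hρ S hS ρ' hρ' S' hS'
    have e4 : ((0 : ℝ), (0 : Space n), (0 : ℝ)) = 0 := rfl
    rw [hsource, hsource, hdiv, hβs, e4] at h1
    simp only [map_zero, inner_zero_right, norm_zero] at h1
    linear_combination h1

/-- A conserved density is, up to a function of `(t, x)`, a density `ρ(β(½|u|² + e) + α·u + h)`
whose coefficients satisfy the determining equations. -/
theorem IsSmoothConserved.exists_determiningEquations (hn : 1 < n) (hI : IsOpen I) (hJ : IsOpen J)
    (hI' : I.OrdConnected) (hJ' : J.OrdConnected) (hIpos : I ⊆ Ioi 0)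
    (hP : ContDiffOn ℝ ∞ (fun q : ℝ × ℝ => P q.1 q.2) (I ×ˢ J)) (hIne : I.Nonempty)
    (hJne : J.Nonempty)
    (hPρ : ∀ U ⊆ J, IsOpen U → U.Nonempty → ∃ S ∈ U, ∃ ρ ∈ I, deriv (fun r => P r S) ρ ≠ 0)
    (he : IsInternalEnergy I J P e) (hT : IsSmoothConserved I J P T) :
    ∃ (w₀ β : ℝ × Space n → ℝ) (α : ℝ × Space n → Space n) (h : ℝ × Space n × ℝ → ℝ),
      ContDiff ℝ ∞ w₀ ∧ DeterminingEquations I J P e β α h ∧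
      ∀ t x, ∀ u : Space n, ∀ ρ ∈ I, ∀ S ∈ J,
        T t x u ρ S = (background w₀ + affineDensity e β α h) t x u ρ S := by
  obtain ⟨w₀, β, α, h, hw₀, hβ, hα, hh, heq⟩ :=
    hT.2.exists_affineDensity hn hI hJ hI' hJ' hIpos hP hJne hPρ he hT.1
  refine ⟨w₀, β, α, h, hw₀, ?_, heq⟩
  refine determiningEquations hI hJ hI' hJ' hIpos hP hIne he hβ hJne hα hh ?_
  -- A function of `(t, x)` is itself conserved, so removing `w₀` leaves a conserved density.
  refine (hT.sub hI hJ (isSmoothConserved_background (by omega) hw₀)).2.congr hI hJ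
    fun t x u ρ hρ S hS => ?_
  have := heq t x u ρ hρ S hS
  simp only [Pi.sub_apply, Pi.add_apply] at this ⊢
  linarith

/-! ### Integration of the determining equations -/

theorem eq_add_mul_of_hasDerivAt {f : ℝ → ℝ} {c : ℝ} (hf : ∀ t, HasDerivAt f c t) (t : ℝ) :
    f t = f 0 + t * c := by
  have h1 : ∀ s, HasDerivAt (fun s => f s - s * c) 0 s := fun s => by
    simpa using (hf s).fun_sub ((hasDerivAt_id s).mul_const c)
  have := is_const_of_deriv_eq_zero (fun s => (h1 s).differentiableAt) (fun s => (h1 s).deriv) t 0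
  linarith

theorem hasDerivAt_time {F : Type*} [NormedAddCommGroup F] [NormedSpace ℝ F]
    {g : ℝ × Space n → F} (hg : ContDiff ℝ ∞ g) (t : ℝ) (x : Space n) :
    HasDerivAt (fun t => g (t, x)) (fderiv ℝ g (t, x) (1, 0)) t :=
  (hg.differentiable (by simp) (t, x)).hasFDerivAt.comp_hasDerivAt t
    ((hasDerivAt_id t).prodMk (hasDerivAt_const t x))

theorem hasDerivAt_line {F : Type*} [NormedAddCommGroup F] [NormedSpace ℝ F]
    {g : ℝ × Space n → F} (hg : ContDiff ℝ ∞ g) (t : ℝ) (x u : Space n) (s : ℝ) :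
    HasDerivAt (fun s : ℝ => g (t, x + s • u)) (fderiv ℝ g (t, x + s • u) (0, u)) s := by
  refine (hg.differentiable (by simp) (t, x + s • u)).hasFDerivAt.comp_hasDerivAt s
    ((hasDerivAt_const s t).prodMk ?_)
  simpa using ((hasDerivAt_id s).smul_const u).const_add x

namespace DeterminingEquations

theorem β_eq (D : DeterminingEquations I J P e β α h)
    (t : ℝ) (x : Space n) : β (t, x) = β (t, 0) := by
  have := eq_add_mul_of_hasDerivAt (f := fun s : ℝ => β (t, 0 + s • x)) (c := 0)
    (fun s => by rw [← D.β_space t (0 + s • x) x]; exact hasDerivAt_line D.contDiff_β t 0 x s) 1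
  simpa using this

theorem fderiv_β_eq (D : DeterminingEquations I J P e β α h)
    (t : ℝ) (x : Space n) :
    fderiv ℝ β (t, x) (1, 0) = fderiv ℝ β (t, 0) (1, 0) := by
  refine (hasDerivAt_time D.contDiff_β t x).unique ?_
  simp_rw [fun t => D.β_eq t x]
  exact hasDerivAt_time D.contDiff_β t 0

/-- Along the segment from `x` to `x + u` the function `⟨α, u⟩` has constant derivative, because
`β'` does not depend on `x`. -/
theorem inner_α_sub (D : DeterminingEquations I J P e β α h)
    (t : ℝ) (x u : Space n) :
    inner ℝ (α (t, x + u) - α (t, x)) u = -(fderiv ℝ β (t, 0) (1, 0) * ‖u‖ ^ 2 / 2) := by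
  have := eq_add_mul_of_hasDerivAt (f := fun s : ℝ => inner ℝ (α (t, x + s • u)) u)
    (c := -(fderiv ℝ β (t, 0) (1, 0) * ‖u‖ ^ 2 / 2)) (fun s => by
      have h1 := (hasDerivAt_line D.contDiff_α t x u s).inner ℝ (hasDerivAt_const s u)
      refine h1.congr_deriv ?_
      have h2 := D.α_space t (x + s • u) u
      rw [D.fderiv_β_eq] at h2
      simp only [inner_zero_right, zero_add]
      linarith) 1
  simp only [one_smul, zero_smul, add_zero, one_mul] at this
  rw [inner_sub_left]
  linarith

theorem differentiableAt_h (D : DeterminingEquations I J P e β α h)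
    (hJ : IsOpen J) (t : ℝ) (x : Space n) {S : ℝ} (hS : S ∈ J) :
    DifferentiableAt ℝ h (t, x, S) :=
  (D.contDiffOn_h.contDiffAt ((hJ.preimage (by fun_prop : Continuous fun q : ℝ × Space n × ℝ =>
    q.2.2)).mem_nhds hS)).differentiableAt (by simp)

theorem hasDerivAt_h_time (D : DeterminingEquations I J P e β α h)
    (hJ : IsOpen J) (t : ℝ) (x : Space n) {S : ℝ} (hS : S ∈ J) :
    HasDerivAt (fun t => h (t, x, S)) (fderiv ℝ h (t, x, S) (1, 0, 0)) t :=
  (D.differentiableAt_h hJ t x hS).hasFDerivAt.comp_hasDerivAt t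
    ((hasDerivAt_id t).prodMk ((hasDerivAt_const t x).prodMk (hasDerivAt_const t S)))

theorem hasDerivAt_h_line (D : DeterminingEquations I J P e β α h)
    (hJ : IsOpen J) (t : ℝ) (x u : Space n) {S : ℝ} (hS : S ∈ J) (s : ℝ) :
    HasDerivAt (fun s : ℝ => h (t, x + s • u, S)) (fderiv ℝ h (t, x + s • u, S) (0, u, 0)) s := by
  refine (D.differentiableAt_h hJ t (x + s • u) hS).hasFDerivAt.comp_hasDerivAt s
    ((hasDerivAt_const s t).prodMk (HasDerivAt.prodMk ?_ (hasDerivAt_const s S)))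
  simpa using ((hasDerivAt_id s).smul_const u).const_add x

section

variable {S : ℝ} {k : ℝ}
-- `hk` says that `h + kβ` is constant in time at a single entropy `S`. It is used with `k = 0` when
-- `β' = 0`, and in the polytropic case with `k` the integration constant that relates `e` to the
-- polytropic energy.
theorem h_eq (D : DeterminingEquations I J P e β α h) (hJ : IsOpen J) (hS : S ∈ J)
    (hk : ∀ t x, fderiv ℝ h (t, x, S) (1, 0, 0) + fderiv ℝ β (t, x) (1, 0) * k = 0)
    (t : ℝ) (x : Space n) :
    h (t, x, S) = h (0, x, S) + (β (0, 0) - β (t, 0)) * k := by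
  have := eq_add_mul_of_hasDerivAt (f := fun t : ℝ => h (t, x, S) + β (t, x) * k) (c := 0)
    (fun t => by
      rw [← hk t x]
      exact (D.hasDerivAt_h_time hJ t x hS).fun_add
        ((hasDerivAt_time D.contDiff_β t x).mul_const k)) t
  simp only [D.β_eq _ x] at this
  linarith

/-- By `h_eq` the time-dependent part of `h` is constant in space, so `∇h`, and with it `α_t = -∇h`,
does not change in time. Consequently `α` is affine in `t`. -/
theorem inner_fderiv_α_time (D : DeterminingEquations I J P e β α h) (hJ : IsOpen J) (hS : S ∈ J)
    (hk : ∀ t x, fderiv ℝ h (t, x, S) (1, 0, 0) + fderiv ℝ β (t, x) (1, 0) * k = 0)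
    (t : ℝ) (x u : Space n) :
    inner ℝ (fderiv ℝ α (t, x) (1, 0)) u = inner ℝ (fderiv ℝ α (0, x) (1, 0)) u := by
  have h1 := D.α_time t x u S hS
  have h2 := D.α_time 0 x u S hS
  have h3 : fderiv ℝ h (t, x, S) (0, u, 0) = fderiv ℝ h (0, x, S) (0, u, 0) := by
    have h4 := D.hasDerivAt_h_line hJ t x u hS 0
    have h5 := D.hasDerivAt_h_line hJ 0 x u hS 0
    simp only [zero_smul, add_zero] at h4 h5
    refine h4.unique ?_
    simp_rw [fun s : ℝ => D.h_eq hJ hS hk t (x + s • u)]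
    exact h5.add_const _
  linarith

theorem inner_α_time (D : DeterminingEquations I J P e β α h) (hJ : IsOpen J) (hS : S ∈ J)
    (hk : ∀ t x, fderiv ℝ h (t, x, S) (1, 0, 0) + fderiv ℝ β (t, x) (1, 0) * k = 0)
    (t : ℝ) (x u : Space n) :
    inner ℝ (α (t, x)) u
      = inner ℝ (α (0, x)) u + t * inner ℝ (fderiv ℝ α (0, x) (1, 0)) u := by
  refine eq_add_mul_of_hasDerivAt (f := fun t => inner ℝ (α (t, x)) u) (fun s => ?_) t
  rw [← D.inner_fderiv_α_time hJ hS hk s x u]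
  have := (hasDerivAt_time D.contDiff_α s x).inner ℝ (hasDerivAt_const s u)
  simpa using this

/-- The coefficient `β` is a quadratic polynomial in time. -/
theorem exists_β_eq_quadratic (D : DeterminingEquations I J P e β α h) (hJ : IsOpen J) (hS : S ∈ J)
    (hk : ∀ t x, fderiv ℝ h (t, x, S) (1, 0, 0) + fderiv ℝ β (t, x) (1, 0) * k = 0)
    (hn : 0 < n) :
    ∃ b₁ b₂ : ℝ, ∀ t x, β (t, x) = β (0, 0) + b₁ * t + b₂ * t ^ 2 := by
  set u : Space n := EuclideanSpace.single ⟨0, hn⟩ 1 with hu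
  have hu1 : ‖u‖ = 1 := by simp [hu]
  -- By `inner_α_sub` with `‖u‖ = 1`, `β'` is `-2` times an increment of `⟨α, u⟩`, and that
  -- increment is affine in `t`.
  obtain ⟨c₁, c₂, hc⟩ : ∃ c₁ c₂ : ℝ, ∀ t, fderiv ℝ β (t, 0) (1, 0) = c₁ + c₂ * t := by
    refine ⟨-2 * (inner ℝ (α (0, 0 + u)) u - inner ℝ (α (0, 0)) u),
      -2 * (inner ℝ (fderiv ℝ α (0, 0 + u) (1, 0)) u - inner ℝ (fderiv ℝ α (0, 0) (1, 0)) u),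
      fun t => ?_⟩
    have h1 := D.inner_α_sub t 0 u
    rw [inner_sub_left, D.inner_α_time hJ hS hk t, D.inner_α_time hJ hS hk t 0, hu1] at h1
    linarith
  refine ⟨c₁, c₂ / 2, fun t x => ?_⟩
  rw [D.β_eq]
  have := eq_add_mul_of_hasDerivAt (f := fun t : ℝ => β (t, 0) - (c₁ * t + c₂ / 2 * t ^ 2))
    (c := 0) (fun t => by
      have h1 := (hasDerivAt_time D.contDiff_β t 0).fun_sub
        (((hasDerivAt_id t).const_mul c₁).fun_add (((hasDerivAt_id t).fun_pow 2).const_mul (c₂ / 2)))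
      refine h1.congr_deriv ?_
      rw [hc t]
      simp
      ring) t
  linarith

end

end DeterminingEquations

/-- A vector field `F` with `⟨F x - F y, x - y⟩ = 0` is an infinitesimal rigid motion. -/
theorem inner_eq_of_inner_sub_eq_zero {F : Space n → Space n}
    (hF : ∀ x u, inner ℝ (F (x + u) - F x) u = 0) (x u : Space n) :
    inner ℝ (F x) u = ∑ k, F 0 k * u k
      + ∑ j, ∑ k, (-(F (EuclideanSpace.single j 1) - F 0) k / 2) * (u j * x k - u k * x j) := by
  set G : Space n → Space n := fun x => F x - F 0 with hG
  have h0 : ∀ x, inner ℝ (G x) x = 0 := fun x => by simpa using hF 0 x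
  -- Polarisation of the hypothesis at the points `x` and `y`. Skewness alone already yields
  -- linearity: `hexp` expresses `G x` through the values of `G` on the basis.
  have hsk : ∀ x y, inner ℝ (G x) y = -inner ℝ (G y) x := by
    intro x y
    have h1 := hF y (x - y)
    have h2 : F (y + (x - y)) - F y = G x - G y := by simp [hG]
    rw [h2, inner_sub_left, inner_sub_right, inner_sub_right, h0, h0] at h1
    linarith
  have hcoord : ∀ y z : Space n, ∑ k, y k * z k = inner ℝ y z := fun y z => by
    simp [PiLp.inner_apply, mul_comm]
  have hexp : ∀ x y : Space n, inner ℝ (G x) y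
      = -∑ j, y j * inner ℝ (G (EuclideanSpace.single j 1)) x := by
    intro x y
    conv_lhs => rw [← sum_coord_smul_single y]
    rw [inner_sum, ← Finset.sum_neg_distrib]
    refine Finset.sum_congr rfl fun j _ => ?_
    rw [inner_smul_right, hsk]
    ring
  -- The double sum runs over all ordered pairs, so each rotation is counted twice; hence the factor
  -- `1/2`.
  have h1 : ∑ j, ∑ k, (-(F (EuclideanSpace.single j 1) - F 0) k / 2) * (u j * x k - u k * x j)
      = -(1 / 2) * ∑ j, u j * inner ℝ (G (EuclideanSpace.single j 1)) x
        + 1 / 2 * ∑ j, x j * inner ℝ (G (EuclideanSpace.single j 1)) u := by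
    rw [Finset.mul_sum, Finset.mul_sum, ← Finset.sum_add_distrib]
    refine Finset.sum_congr rfl fun j _ => ?_
    rw [← hcoord, ← hcoord, Finset.mul_sum, Finset.mul_sum, Finset.mul_sum, Finset.mul_sum,
      ← Finset.sum_add_distrib]
    refine Finset.sum_congr rfl fun k _ => ?_
    simp only [hG, PiLp.sub_apply]
    ring
  rw [h1, hcoord]
  have h2 := hexp x u
  have h3 := hexp u x
  have h4 := hsk x u
  have h5 : inner ℝ (F x) u = inner ℝ (F 0) u + inner ℝ (G x) u := by
    simp [hG, inner_sub_left]
  rw [h5]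
  linarith

end Euler

namespace Euler

variable {n : ℕ} {I J : Set ℝ} {P e : ℝ → ℝ → ℝ} {T T₁ T₂ : Kinematic n ℝ}
  {β : ℝ × Space n → ℝ} {α : ℝ × Space n → Space n} {h : ℝ × Space n × ℝ → ℝ}

/-! ### Standard densities -/

/-- A linear combination of mass, momentum, angular momentum, Galilean momentum, energy and
generalized entropy. -/
def standardDensity (e : ℝ → ℝ → ℝ) (m b : ℝ) (a g : Fin n → ℝ) (c : Fin n → Fin n → ℝ)
    (f : ℝ → ℝ) : Kinematic n ℝ :=
  m • mass + ∑ k, a k • momentum k + ∑ j, ∑ k, c j k • angularMomentum j k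
    + ∑ k, g k • galileanMomentum k + b • energy e + entropy f

theorem standardDensity_apply (m b : ℝ) (a g : Fin n → ℝ) (c : Fin n → Fin n → ℝ)
    (f : ℝ → ℝ) (t : ℝ) (x u : Space n) (ρ S : ℝ) :
    standardDensity e m b a g c f t x u ρ S
      = ρ * (m + ∑ k, a k * u k + ∑ j, ∑ k, c j k * (u j * x k - u k * x j)
        + ∑ k, g k * (t * u k - x k) + b * (‖u‖ ^ 2 / 2 + e ρ S) + f S) := by
  simp only [standardDensity, Pi.add_apply, Pi.smul_apply, Finset.sum_apply, smul_eq_mul, mass,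
    momentum, angularMomentum, galileanMomentum, energy, entropy, mul_add, Finset.mul_sum]
  have h1 : ∀ k, a k * (ρ * u k) = ρ * (a k * u k) := fun k => by ring
  have h2 : ∀ j k, c j k * (ρ * (u j * x k - u k * x j)) = ρ * (c j k * (u j * x k - u k * x j)) :=
    fun j k => by ring
  have h3 : ∀ k, g k * (ρ * (t * u k - x k)) = ρ * (g k * (t * u k - x k)) := fun k => by ring
  simp only [h1, h2, h3]
  ring

theorem IsTrivial.congr (h₁ : IsTrivial I J T₁)
    (h : ∀ t x, ∀ u : Space n, ∀ ρ ∈ I, ∀ S ∈ J, T₁ t x u ρ S = T₂ t x u ρ S) :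
    IsTrivial I J T₂ := by
  obtain ⟨k, Θ, hΘ, hdiv⟩ := h₁
  exact ⟨k, Θ, hΘ, fun t w hw x => (h t x _ _ (hw.2 x).1 _ (hw.2 x).2).symm.trans (hdiv t w hw x)⟩

theorem isSmoothConserved_sum {ι : Type*} (hn : 0 < n) (hI : IsOpen I) (hJ : IsOpen J)
    (s : Finset ι) {T : ι → Kinematic n ℝ} (hT : ∀ i ∈ s, IsSmoothConserved I J P (T i)) :
    IsSmoothConserved I J P (∑ i ∈ s, T i) := by
  refine Finset.sum_induction T (IsSmoothConserved I J P) (fun _ _ h₁ h₂ => h₁.add hI hJ h₂) ?_ hT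
  exact isSmoothConserved_background (g := fun _ => 0) hn contDiff_const

theorem isSmoothConserved_standardDensity (hn : 0 < n) (hI : IsOpen I) (hJ : IsOpen J)
    (hIpos : I ⊆ Ioi 0) (hP : ContDiffOn ℝ ∞ (fun q : ℝ × ℝ => P q.1 q.2) (I ×ˢ J))
    (he : IsInternalEnergy I J P e) (m b : ℝ) (a g : Fin n → ℝ) (c : Fin n → Fin n → ℝ)
    {f : ℝ → ℝ} (hf : ContDiffOn ℝ ∞ f J) :
    IsSmoothConserved I J P (standardDensity (n := n) e m b a g c f) := by
  refine IsSmoothConserved.add hI hJ (IsSmoothConserved.add hI hJ (IsSmoothConserved.add hI hJ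
    (IsSmoothConserved.add hI hJ (IsSmoothConserved.add hI hJ ?_ ?_) ?_) ?_) ?_) ?_
  · exact (mass_law hI hJ hIpos hP he).2.smul hI hJ m
  · exact isSmoothConserved_sum hn hI hJ _ fun k _ =>
      (momentum_law hI hJ hIpos hP he k).2.smul hI hJ _
  · exact isSmoothConserved_sum hn hI hJ _ fun j _ => isSmoothConserved_sum hn hI hJ _ fun k _ =>
      (angularMomentum_law hI hJ hIpos hP he j k).2.smul hI hJ _
  · exact isSmoothConserved_sum hn hI hJ _ fun k _ =>
      (galileanMomentum_law hI hJ hIpos hP he k).2.smul hI hJ _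
  · exact (energy_law hI hJ hIpos hP he).2.smul hI hJ b
  · exact (entropy_law hI hJ hIpos hP he hf).2

theorem IsStandard.isSmoothConserved (hn : 0 < n) (hI : IsOpen I) (hJ : IsOpen J)
    (hI' : I.OrdConnected) (hJ' : J.OrdConnected)
    (hIpos : I ⊆ Ioi 0) (hP : ContDiffOn ℝ ∞ (fun q : ℝ × ℝ => P q.1 q.2) (I ×ˢ J))
    (hIne : I.Nonempty) (hJne : J.Nonempty) (he : IsInternalEnergy I J P e)
    (hT : IsSmoothKinematic I J T) (hs : IsStandard I J e T) : IsSmoothConserved I J P T := by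
  obtain ⟨m, b, a, g, c, f, hf, htriv⟩ := hs
  have hst := isSmoothConserved_standardDensity hn hI hJ hIpos hP he m b a g c hf
  have hd : IsSmoothKinematic I J (T - standardDensity e m b a g c f) := ContDiffOn.sub hT hst.1
  obtain ⟨ρ₀, hρ₀⟩ := hIne
  obtain ⟨S₀, hS₀⟩ := hJne
  have := (IsTrivial.isSmoothConserved (P := P) hn hI hJ hI' hJ' (v₀ := (0, ρ₀, S₀)) ⟨hρ₀, hS₀⟩
    hd htriv).add hI hJ hst
  rwa [sub_add_cancel] at this

theorem exists_mem_ne_of_isOpen (hI : IsOpen I) {r : ℝ} (hr : r ∈ I) : ∃ s ∈ I, s ≠ r := by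
  obtain ⟨ε, hε, hball⟩ := Metric.isOpen_iff.1 hI r hr
  refine ⟨r + ε / 2, hball ?_, (lt_add_of_pos_right r (half_pos hε)).ne'⟩
  rw [Metric.mem_ball, Real.dist_eq, add_sub_cancel_left, abs_of_pos (half_pos hε)]
  exact half_lt_self hε

/-- A conserved density whose kinetic coefficient does not depend on time is standard. -/
theorem DeterminingEquations.isStandard (D : DeterminingEquations I J P e β α h) (hn : 0 < n)
    (hI : IsOpen I) (hJ : IsOpen J) (hIne : I.Nonempty) (hJne : J.Nonempty)
    (hβ : ∀ t, fderiv ℝ β (t, 0) (1, 0) = 0) {w₀ : ℝ × Space n → ℝ} (hw₀ : ContDiff ℝ ∞ w₀)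
    (hT : ∀ t x, ∀ u : Space n, ∀ ρ ∈ I, ∀ S ∈ J,
        T t x u ρ S = (background w₀ + affineDensity e β α h) t x u ρ S) :
    IsStandard I J e T := by
  obtain ⟨S₀, hS₀⟩ := hJne
  have hβ' : ∀ t x, fderiv ℝ β (t, x) (1, 0) = 0 := fun t x => by rw [D.fderiv_β_eq, hβ]
  -- For `β' = 0` the pressure equation at two distinct densities and the same entropy forces `h_t =
  -- 0`. The result is written in the form of `hk` with `k = 0`.
  have hh : ∀ S ∈ J, ∀ t x, fderiv ℝ h (t, x, S) (1, 0, 0) + fderiv ℝ β (t, x) (1, 0) * 0 = 0 := by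
    intro S hS t x
    obtain ⟨ρ₁, hρ₁⟩ := hIne
    obtain ⟨ρ₂, hρ₂, hne⟩ := exists_mem_ne_of_isOpen hI hρ₁
    have := D.pressure t x ρ₁ hρ₁ S hS ρ₂ hρ₂ S hS
    rw [hβ'] at this
    have h1 : (ρ₂ - ρ₁) * fderiv ℝ h (t, x, S) (1, 0, 0) = 0 := by linarith
    rw [mul_zero, add_zero]
    exact (mul_eq_zero.1 h1).resolve_left (sub_ne_zero.2 hne)
  have hβc : ∀ t x, β (t, x) = β (0, 0) := by
    intro t x
    rw [D.β_eq]
    have := eq_add_mul_of_hasDerivAt (f := fun t : ℝ => β (t, 0)) (c := 0)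
      (fun t => by rw [← hβ t]; exact hasDerivAt_time D.contDiff_β t 0) t
    simpa using this
  set γ : Space n → Space n := fun x => fderiv ℝ α (0, x) (1, 0) with hγ
  have hα : ∀ t x u, inner ℝ (α (t, x)) u = inner ℝ (α (0, x)) u + t * inner ℝ (γ x) u :=
    D.inner_α_time hJ hS₀ (hh S₀ hS₀)
  have hrig : ∀ x u, inner ℝ (α (0, x + u) - α (0, x)) u = 0 := fun x u => by
    rw [D.inner_α_sub, hβ]; simp
  -- The field `α` is rigid at times `0` and `1`, hence so is its increment `γ`.
  have hγrig : ∀ x u, inner ℝ (γ (x + u) - γ x) u = 0 := fun x u => by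
    have h1 := D.inner_α_sub 1 x u
    have h2 := hrig x u
    rw [inner_sub_left, hα 1, hα 1 x, hβ] at h1
    rw [inner_sub_left] at h2 ⊢
    linarith
  -- On the ray through `x` the component of `γ` along `x` is constant by rigidity. As `∇h = -γ`,
  -- the function `h` is affine in `x`; this in turn makes `γ` constant in `hγc`.
  have hhx : ∀ S ∈ J, ∀ x, h (0, x, S) = h (0, 0, S) - inner ℝ (γ 0) x := by
    intro S hS x
    have := eq_add_mul_of_hasDerivAt (f := fun s : ℝ => h (0, 0 + s • x, S))
      (c := -inner ℝ (γ 0) x) (fun s => by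
        refine (D.hasDerivAt_h_line hJ 0 0 x hS s).congr_deriv ?_
        have h1 := D.α_time 0 (0 + s • x) x S hS
        have h2 : inner ℝ (γ (0 + s • x)) x = inner ℝ (γ 0) x := by
          by_cases hs : s = 0
          · simp [hs]
          · have h3 := hγrig 0 (s • x)
            rw [inner_smul_right, inner_sub_left] at h3
            have := (mul_eq_zero.1 h3).resolve_left hs
            linarith
        rw [← h2]
        linarith) 1
    simp only [one_smul, zero_smul, zero_add, add_zero, one_mul] at this
    linarith
  have hγc : ∀ x u, inner ℝ (γ x) u = inner ℝ (γ 0) u := by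
    intro x u
    have h1 := D.α_time 0 x u S₀ hS₀
    have h2 := D.hasDerivAt_h_line hJ 0 x u hS₀ 0
    simp only [zero_smul, add_zero] at h2
    have h3 : HasDerivAt (fun s : ℝ => h (0, 0, S₀) - inner ℝ (γ 0) (x + s • u))
        (-inner ℝ (γ 0) u) 0 := by
      have h4 : HasDerivAt (fun s : ℝ => x + s • u) u 0 := by
        simpa using ((hasDerivAt_id (0 : ℝ)).smul_const u).const_add x
      simpa using ((hasDerivAt_const (0 : ℝ) (γ 0)).inner ℝ h4).const_sub (h (0, 0, S₀))
    have h5 := h2.unique (h3.congr_of_eventuallyEq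
      (Eventually.of_forall fun s => hhx S₀ hS₀ (x + s • u)))
    linarith
  -- The mass coefficient is zero because mass is absorbed by the generalized entropy `h(0, 0, S)`.
  refine ⟨0, β (0, 0), fun k => α (0, 0) k, fun k => γ 0 k,
    fun j k => -(α (0, EuclideanSpace.single j 1) - α (0, 0)) k / 2, fun S => h (0, 0, S),
    ?_, ?_⟩
  · exact D.contDiffOn_h.comp (f := fun S : ℝ => ((0 : ℝ), (0 : Space n), S)) (by fun_prop)
      fun _ hS => hS
  · refine (isTrivial_background hn hw₀).congr fun t x u ρ hρ S hS => ?_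
    have e1 : ∀ T' : Kinematic n ℝ, (T - T') t x u ρ S = T t x u ρ S - T' t x u ρ S := fun _ => rfl
    rw [e1]
    refine Eq.trans ?_ (congrArg (_ - ·) (standardDensity_apply _ _ _ _ _ _ t x u ρ S).symm)
    rw [hT t x u ρ hρ S hS]
    have e2 : (background w₀ + affineDensity e β α h) t x u ρ S
        = background w₀ t x u ρ S + affineDensity e β α h t x u ρ S := rfl
    have hr := inner_eq_of_inner_sub_eq_zero (F := fun x => α (0, x)) hrig x u
    simp only at hr
    rw [e2, affineDensity, hβc t x, hα t x u, hγc x u, D.h_eq hJ hS (hh S hS) t x, hhx S hS x, hr]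
    have hcoord : ∀ y : Space n, inner ℝ (γ 0) y = ∑ k, γ 0 k * y k := fun y => by
      simp [PiLp.inner_apply, mul_comm]
    have e3 : ∑ k, γ 0 k * (t * u k - x k) = t * inner ℝ (γ 0) u - inner ℝ (γ 0) x := by
      rw [hcoord, hcoord, Finset.mul_sum, ← Finset.sum_sub_distrib]
      exact Finset.sum_congr rfl fun k _ => by ring
    rw [e3]
    ring

/-! ### The polytropic case -/

/-- A conserved density whose kinetic coefficient depends on time forces a polytropic equation of
state. -/
theorem DeterminingEquations.exists_isShiftedPolytropic (D : DeterminingEquations I J P e β α h)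
    (hn : 0 < n) (hI : IsOpen I) (hJ : IsOpen J) (hI' : I.OrdConnected) (hIpos : I ⊆ Ioi 0)
    (hP : ContDiffOn ℝ ∞ (fun q : ℝ × ℝ => P q.1 q.2) (I ×ˢ J))
    (he : IsInternalEnergy I J P e) (hIne : I.Nonempty) (hJne : J.Nonempty) {t : ℝ}
    (hb : fderiv ℝ β (t, 0) (1, 0) ≠ 0) : ∃ κ p₀, IsShiftedPolytropic n I J P κ p₀ := by
  obtain ⟨ρ₀, hρ₀⟩ := hIne
  obtain ⟨S₀, hS₀⟩ := hJne
  set b := fderiv ℝ β (t, 0) (1, 0) with hbdef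
  -- The common value of the expression in `D.pressure`. It does not depend on the entropy, which is
  -- what makes the pressure shift a constant; `p₁` is chosen so that differentiation in `ρ` gives
  -- the homogeneous equation `ρP_ρ = γ(P + p₁)`.
  set c := ρ₀ * (b * e ρ₀ S₀ + fderiv ℝ h (t, 0, S₀) (1, 0, 0)) - n / 2 * b * P ρ₀ S₀ with hc
  have hn' : (n : ℝ) ≠ 0 := by exact_mod_cast hn.ne'
  have hn2 : (n : ℝ) + 2 ≠ 0 := by positivity
  set p₁ := 2 * c / (b * (n + 2)) with hp₁
  set γ := 1 + 2 / (n : ℝ) with hγ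
  refine ⟨fun S => (P ρ₀ S + p₁) * ρ₀ ^ (-γ), -p₁, fun ρ hρ S hS => ?_⟩
  have hF : ∀ r ∈ I, r * (b * e r S + fderiv ℝ h (t, 0, S) (1, 0, 0)) - n / 2 * b * P r S = c :=
    fun r hr => D.pressure t 0 r hr S hS ρ₀ hρ₀ S₀ hS₀
  have hPd : ∀ r ∈ I, HasDerivAt (fun r => P r S) (deriv (fun r => P r S) r) r := by
    intro r hr
    refine DifferentiableAt.hasDerivAt ?_
    have h1 : DifferentiableAt ℝ (fun q : ℝ × ℝ => P q.1 q.2) (r, S) :=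
      (hP.contDiffAt ((hI.prod hJ).mem_nhds ⟨hr, hS⟩)).differentiableAt (by simp)
    exact DifferentiableAt.comp (g := fun q : ℝ × ℝ => P q.1 q.2) (f := fun r => (r, S)) r h1
      (by fun_prop)
  have hode : ∀ r ∈ I, r * deriv (fun r => P r S) r = γ * (P r S + p₁) := by
    intro r hr
    have hr0 : r ≠ 0 := (hIpos hr).ne'
    have h1 := ((hasDerivAt_id r).fun_mul (((he.2 r hr S hS).const_mul b).add_const
      (fderiv ℝ h (t, 0, S) (1, 0, 0)))).fun_sub ((hPd r hr).const_mul (n / 2 * b))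
    have h2 : HasDerivAt (fun r => id r * (b * e r S + fderiv ℝ h (t, 0, S) (1, 0, 0))
        - n / 2 * b * P r S) 0 r := by
      refine (hasDerivAt_const r c).congr_of_eventuallyEq ?_
      filter_upwards [hI.mem_nhds hr] with s hs using hF s hs
    have h3 := h1.unique h2
    have h4 := hF r hr
    simp only [id, one_mul] at h3
    have h5 : r * (b * ((r ^ 2)⁻¹ * P r S)) * r = b * P r S := by field_simp
    have h6 : c + n / 2 * b * P r S + b * P r S - n / 2 * b * (r * deriv (fun r => P r S) r) = 0 := by
      linear_combination r * h3 - h5 - h4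
    rw [hγ, hp₁]
    field_simp
    have h7 : b * (n * (r * deriv (fun r => P r S) r)) = 2 * c + n * b * P r S + 2 * b * P r S := by
      linarith
    linear_combination h7
  have hconst : (P ρ S + p₁) * ρ ^ (-γ) = (P ρ₀ S + p₁) * ρ₀ ^ (-γ) := by
    have hder : ∀ r ∈ I, HasDerivAt (fun r => (P r S + p₁) * r ^ (-γ)) 0 r := by
      intro r hr
      have hr0 : 0 < r := hIpos hr
      have h1 := ((hPd r hr).add_const p₁).fun_mul
        (Real.hasDerivAt_rpow_const (x := r) (p := -γ) (Or.inl hr0.ne'))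
      refine h1.congr_deriv ?_
      have h2 := hode r hr
      have h3 : r ^ (-γ) = r * r ^ (-γ - 1) := by
        rw [Real.rpow_sub_one hr0.ne']; field_simp
      rw [h3]
      linear_combination r ^ (-γ - 1) * h2
    refine eq_of_fderiv_apply_sub_eq_zero hI hI'.convex
      (fun r hr => (hder r hr).differentiableAt.differentiableWithinAt) hρ₀ hρ fun r hr => ?_
    rw [(hder r hr).hasFDerivAt.fderiv]
    simp
  have hρ0 : 0 < ρ := hIpos hρ
  change P ρ S = (P ρ₀ S + p₁) * ρ₀ ^ (-γ) * ρ ^ γ + -p₁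
  rw [← hconst, mul_assoc, ← Real.rpow_add hρ0]
  simp

/-- For a polytropic equation of state the kinetic coefficient is a quadratic polynomial in
time. -/
theorem DeterminingEquations.exists_quadratic (D : DeterminingEquations I J P e β α h)
    (hn : 0 < n) (hI : IsOpen I) (hJ : IsOpen J) (hI' : I.OrdConnected) (hIpos : I ⊆ Ioi 0)
    (hP : ContDiffOn ℝ ∞ (fun q : ℝ × ℝ => P q.1 q.2) (I ×ˢ J))
    (he : IsInternalEnergy I J P e) (hIne : I.Nonempty) (hJne : J.Nonempty) {κ : ℝ → ℝ} {p₀ : ℝ}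
    (hκ : IsShiftedPolytropic n I J P κ p₀) :
    ∃ b₁ b₂ : ℝ, ∀ t x, β (t, x) = β (0, 0) + b₁ * t + b₂ * t ^ 2 := by
  obtain ⟨ρ₀, hρ₀⟩ := hIne
  obtain ⟨S, hS⟩ := hJne
  have hpe := hκ.isInternalEnergy hn hIpos hP
  -- The energies `e` and `polytropicEnergy n κ` belong to the pressures `P` and `P - p₀`, so their
  -- `ρ`-derivatives differ by `p₀ρ⁻²`. Hence `e` minus the polytropic energy, plus `p₀/ρ`, is
  -- constant in `ρ`.
  set k := e ρ₀ S - polytropicEnergy n κ ρ₀ S + p₀ * ρ₀⁻¹ with hk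
  have hek : ∀ ρ ∈ I, e ρ S - polytropicEnergy n κ ρ S + p₀ * ρ⁻¹ = k := by
    intro ρ hρ
    have hder : ∀ r ∈ I,
        HasDerivAt (fun r => e r S - polytropicEnergy n κ r S + p₀ * r⁻¹) 0 r := by
      intro r hr
      have hr0 : r ≠ 0 := (hIpos hr).ne'
      refine (((he.2 r hr S hS).fun_sub (hpe.2 r hr S hS)).fun_add
        ((hasDerivAt_inv hr0).const_mul p₀)).congr_deriv ?_
      ring
    refine eq_of_fderiv_apply_sub_eq_zero hI hI'.convex
      (f := fun r => e r S - polytropicEnergy n κ r S + p₀ * r⁻¹)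
      (fun r hr => (hder r hr).differentiableAt.differentiableWithinAt) hρ₀ hρ fun r hr => ?_
    rw [(hder r hr).hasFDerivAt.fderiv]
    simp
  refine D.exists_β_eq_quadratic hJ hS (k := k) (fun t x => ?_) hn
  obtain ⟨ρ₁, hρ₁, hne⟩ := exists_mem_ne_of_isOpen hI hρ₀
  have h1 := D.pressure t x ρ₀ hρ₀ S hS ρ₁ hρ₁ S hS
  have hρe : ∀ ρ ∈ I, ρ * e ρ S = n / 2 * (P ρ S - p₀) + ρ * k - p₀ := by
    intro ρ hρ
    have hρ0 : ρ ≠ 0 := (hIpos hρ).ne'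
    rw [← hκ.mul_polytropicEnergy hIpos hρ hS, ← hek ρ hρ]
    field_simp
    ring
  -- Inserting `hρe` in the pressure equation cancels the terms in `P`. What is left is linear in
  -- `ρ`, and comparison of two densities gives the relation `hk`.
  have h2 : (ρ₁ - ρ₀) * (fderiv ℝ h (t, x, S) (1, 0, 0) + fderiv ℝ β (t, x) (1, 0) * k) = 0 := by
    have h3 := hρe ρ₀ hρ₀
    have h4 := hρe ρ₁ hρ₁
    linear_combination fderiv ℝ β (t, x) (1, 0) * (h3 - h4) - h1
  exact (mul_eq_zero.1 h2).resolve_left (sub_ne_zero.2 hne)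

/-! ### Second differences in the velocity and independence of the additional laws. -/

theorem similarityEnergy_add_dilationalEnergy_secondDiff (e : ℝ → ℝ → ℝ) (b₁ b₂ t : ℝ)
    (x u : Space n) (ρ S : ℝ) :
    (b₁ • similarityEnergy e + b₂ • dilationalEnergy e : Kinematic n ℝ) t x u ρ S
      + (b₁ • similarityEnergy e + b₂ • dilationalEnergy e : Kinematic n ℝ) t x (-u) ρ S
      - 2 * (b₁ • similarityEnergy e + b₂ • dilationalEnergy e : Kinematic n ℝ) t x 0 ρ S
      = ρ * (b₁ * t + b₂ * t ^ 2) * ‖u‖ ^ 2 := by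
  simp only [Pi.add_apply, Pi.smul_apply, smul_eq_mul, similarityEnergy, dilationalEnergy, energy,
    inner_neg_left, inner_zero_left, norm_neg, norm_zero]
  ring

/-- A second difference at `u = 0` removes everything affine in `u`, including `w₀`, the internal
energy and `h`, and so reads `β` off the density. -/
theorem background_add_affineDensity_secondDiff (w₀ : ℝ × Space n → ℝ) (t : ℝ) (x u : Space n)
    (ρ S : ℝ) :
    (background w₀ + affineDensity e β α h) t x u ρ S
      + (background w₀ + affineDensity e β α h) t x (-u) ρ S
      - 2 * (background w₀ + affineDensity e β α h) t x 0 ρ S = ρ * β (t, x) * ‖u‖ ^ 2 := by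
  simp only [Pi.add_apply, background, affineDensity, inner_neg_right, inner_zero_right, norm_neg,
    norm_zero]
  ring

theorem standardDensity_secondDiff (m b : ℝ) (a g : Fin n → ℝ) (c : Fin n → Fin n → ℝ)
    (f : ℝ → ℝ) (t : ℝ) (x u : Space n) (ρ S : ℝ) :
    standardDensity e m b a g c f t x u ρ S + standardDensity e m b a g c f t x (-u) ρ S
      - 2 * standardDensity e m b a g c f t x 0 ρ S = ρ * b * ‖u‖ ^ 2 := by
  have h1 : ∑ k, a k * (-u) k = -∑ k, a k * u k := by simp
  have h2 : ∑ j, ∑ k, c j k * ((-u) j * x k - (-u) k * x j)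
      = -∑ j, ∑ k, c j k * (u j * x k - u k * x j) := by
    simp only [← Finset.sum_neg_distrib, PiLp.neg_apply]
    exact Finset.sum_congr rfl fun j _ => Finset.sum_congr rfl fun k _ => by ring
  have h3 : ∑ k, g k * (t * (-u) k - x k)
      = -(∑ k, g k * (t * u k - x k)) - 2 * ∑ k, g k * x k := by
    simp only [← Finset.sum_neg_distrib, PiLp.neg_apply, Finset.mul_sum, ← Finset.sum_sub_distrib]
    exact Finset.sum_congr rfl fun k _ => by ring
  simp only [standardDensity_apply, h1, h2, h3, norm_neg, norm_zero, PiLp.zero_apply, mul_zero,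
    zero_mul, sub_zero, Finset.sum_const_zero, zero_sub, mul_neg, Finset.sum_neg_distrib]
  ring

/-- A combination of the similarity and the dilational energy is standard only if it vanishes. -/
theorem eq_zero_of_isStandard (hn : 0 < n) (hI : IsOpen I) (hJ : IsOpen J)
    (hI' : I.OrdConnected) (hJ' : J.OrdConnected) (hIpos : I ⊆ Ioi 0)
    (hP : ContDiffOn ℝ ∞ (fun q : ℝ × ℝ => P q.1 q.2) (I ×ˢ J))
    (he : IsInternalEnergy I J P e) (hIne : I.Nonempty) (hJne : J.Nonempty) {κ : ℝ → ℝ} {p₀ : ℝ}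
    (hκ : IsShiftedPolytropic n I J P κ p₀) {b₁ b₂ : ℝ}
    (hs : IsStandard I J e ((b₁ • similarityEnergy (polytropicEnergy n κ)
      + b₂ • dilationalEnergy (polytropicEnergy n κ)) : Kinematic n ℝ)) : b₁ = 0 ∧ b₂ = 0 := by
  obtain ⟨ρ₀, hρ₀⟩ := hIne
  obtain ⟨S₀, hS₀⟩ := hJne
  obtain ⟨m, b, a, g, c, f, hf, htriv⟩ := hs
  have hst := isSmoothConserved_standardDensity hn hI hJ hIpos hP he m b a g c hf
  have hsd := ((similarityEnergy_law hn hI hJ hIpos hP hκ).2.smul hI hJ b₁).add hI hJ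
    ((dilationalEnergy_law hn hI hJ hIpos hP hκ).2.smul hI hJ b₂)
  set U : Kinematic n ℝ := b₁ • similarityEnergy (polytropicEnergy n κ)
      + b₂ • dilationalEnergy (polytropicEnergy n κ) with hU
  have hd : IsSmoothKinematic I J (U - standardDensity e m b a g c f) := (hsd.sub hI hJ hst).1
  -- A trivial difference does not depend on the velocity, so both densities have the same second
  -- difference and `b₁t + b₂t²` equals the constant `b`.
  have hind : ∀ t (u : Space n), U t 0 u ρ₀ S₀ - standardDensity e m b a g c f t 0 u ρ₀ S₀
      = U t 0 0 ρ₀ S₀ - standardDensity e m b a g c f t 0 0 ρ₀ S₀ := fun t u =>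
    IsTrivial.eq hI hJ hI' hJ' hd htriv t 0 (v := (u, ρ₀, S₀)) (w := (0, ρ₀, S₀)) ⟨hρ₀, hS₀⟩
      ⟨hρ₀, hS₀⟩
  have hρ0 : ρ₀ ≠ 0 := (hIpos hρ₀).ne'
  set u : Space n := EuclideanSpace.single ⟨0, hn⟩ 1 with hu
  have hu1 : ‖u‖ = 1 := by simp [hu]
  have hpoly : ∀ t, b₁ * t + b₂ * t ^ 2 = b := by
    intro t
    have h1 := similarityEnergy_add_dilationalEnergy_secondDiff (polytropicEnergy n κ) b₁ b₂ t 0 u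
      ρ₀ S₀
    have h2 := standardDensity_secondDiff (e := e) m b a g c f t 0 u ρ₀ S₀
    rw [← hU] at h1
    have h3 := hind t u
    have h4 := hind t (-u)
    rw [hu1] at h1 h2
    have h5 : ρ₀ * (b₁ * t + b₂ * t ^ 2 - b) = 0 := by linarith
    have := (mul_eq_zero.1 h5).resolve_left hρ0
    linarith
  have h0 := hpoly 0
  have h1 := hpoly 1
  have h2 := hpoly (-1)
  constructor <;> linarith

end Euler

end

/-! ### The classification theorem. -/

open Euler
theorem theorem1 (n : ℕ) (hn : 1 < n)
    -- the ranges of density and entropy: open intervals, with positive densities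
    (I J : Set ℝ) (hI : IsOpen I) (hI' : I.OrdConnected) (hIpos : I ⊆ Ioi 0)
    (hJ : IsOpen J) (hJ' : J.OrdConnected)
    (P : ℝ → ℝ → ℝ) (hP : ContDiffOn ℝ ∞ (fun q : ℝ × ℝ => P q.1 q.2) (I ×ˢ J))
    -- the equation of state is non-isentropic
    (hPS : ∃ ρ ∈ I, ∃ S ∈ J, deriv (fun s => P ρ s) S ≠ 0)
    -- on no open range of entropies is the pressure independent of the density
    (hPρ : ∀ U ⊆ J, IsOpen U → U.Nonempty → ∃ S ∈ U, ∃ ρ ∈ I, deriv (fun r => P r S) ρ ≠ 0)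
    (e : ℝ → ℝ → ℝ) (he : IsInternalEnergy I J P e) :
    -- the standard conservation laws hold for every equation of state
    (HasMovingFlux (n := n) I J P mass (fun _ _ _ _ _ => 0)
      ∧ (∀ k : Fin n, HasMovingFlux I J P (momentum k)
          (fun _ _ _ ρ S => P ρ S • EuclideanSpace.single k 1))
      ∧ (∀ j k : Fin n, HasMovingFlux I J P (angularMomentum j k)
          (fun _ x _ ρ S => P ρ S •
            (x k • EuclideanSpace.single j 1 - x j • EuclideanSpace.single k 1)))
      ∧ (∀ k : Fin n, HasMovingFlux I J P (galileanMomentum k)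
          (fun t _ _ ρ S => (t * P ρ S) • EuclideanSpace.single k 1))
      ∧ HasMovingFlux (n := n) I J P (energy e) (fun _ _ u ρ S => P ρ S • u)
      ∧ (∀ f : ℝ → ℝ, ContDiffOn ℝ ∞ f J →
          HasMovingFlux (n := n) I J P (entropy f) (fun _ _ _ _ _ => 0)))
    -- outside the polytropic case there are no others
    ∧ ((¬ ∃ κ p₀, IsShiftedPolytropic n I J P κ p₀) →
        ∀ T : Kinematic n ℝ, IsSmoothKinematic I J T →
          (IsConserved I J P T ↔ IsStandard I J e T))
    -- additional conservation laws arise exactly in the polytropic case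
    ∧ ((∃ T : Kinematic n ℝ, IsSmoothKinematic I J T ∧ IsConserved I J P T ∧ ¬ IsStandard I J e T)
        ↔ ∃ κ p₀, IsShiftedPolytropic n I J P κ p₀)
    -- in the polytropic case they are the similarity energy and the dilational energy
    ∧ (∀ κ p₀, IsShiftedPolytropic n I J P κ p₀ →
        IsInternalEnergy I J (fun ρ S => P ρ S - p₀) (polytropicEnergy n κ)
        ∧ (∀ t x, ∀ u : Space n, ∀ ρ ∈ I, ∀ S ∈ J, energy (polytropicEnergy n κ) t x u ρ S
            = ρ * ‖u‖ ^ 2 / 2 + (n : ℝ) / 2 * (P ρ S - p₀))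
        ∧ HasMovingFlux (n := n) I J P (similarityEnergy (polytropicEnergy n κ))
            (fun t x u ρ S => (P ρ S - p₀) • (t • u - (1 / 2 : ℝ) • x))
        ∧ HasMovingFlux (n := n) I J P (dilationalEnergy (polytropicEnergy n κ))
            (fun t x u ρ S => ((P ρ S - p₀) * t) • (t • u - x))
        ∧ (∀ T : Kinematic n ℝ, IsSmoothKinematic I J T →
            (IsConserved I J P T ↔ ∃ b₁ b₂ : ℝ, IsStandard I J e
              (T - (b₁ • similarityEnergy (polytropicEnergy n κ)
                + b₂ • dilationalEnergy (polytropicEnergy n κ)))))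
        ∧ (∀ b₁ b₂ : ℝ, IsStandard I J e
            ((b₁ • similarityEnergy (polytropicEnergy n κ)
                + b₂ • dilationalEnergy (polytropicEnergy n κ)) : Kinematic n ℝ) →
              b₁ = 0 ∧ b₂ = 0)) := by
  have hn0 : 0 < n := by omega
  have hIne : I.Nonempty := let ⟨ρ, hρ, _⟩ := hPS; ⟨ρ, hρ⟩
  have hJne : J.Nonempty := let ⟨_, _, S, hS, _⟩ := hPS; ⟨S, hS⟩
  have hstd : ∀ T : Kinematic n ℝ, IsSmoothKinematic I J T → IsStandard I J e T →
      IsSmoothConserved I J P T := fun T hT hs =>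
    hs.isSmoothConserved hn0 hI hJ hI' hJ' hIpos hP hIne hJne he hT
  have hdet : ∀ T : Kinematic n ℝ, IsSmoothConserved I J P T →
      ∃ (w₀ β : ℝ × Space n → ℝ) (α : ℝ × Space n → Space n) (h : ℝ × Space n × ℝ → ℝ),
        ContDiff ℝ ∞ w₀ ∧ DeterminingEquations I J P e β α h ∧
        ∀ t x, ∀ u : Space n, ∀ ρ ∈ I, ∀ S ∈ J,
          T t x u ρ S = (background w₀ + affineDensity e β α h) t x u ρ S := fun T hT =>
    hT.exists_determiningEquations hn hI hJ hI' hJ' hIpos hP hIne hJne hPρ he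
  have hnonpoly : (¬ ∃ κ p₀, IsShiftedPolytropic n I J P κ p₀) →
      ∀ T : Kinematic n ℝ, IsSmoothKinematic I J T →
        (IsConserved I J P T ↔ IsStandard I J e T) := by
    intro hnp T hT
    refine ⟨fun hc => ?_, fun hs => (hstd T hT hs).2⟩
    obtain ⟨w₀, β, α, h, hw₀, D, heq⟩ := hdet T ⟨hT, hc⟩
    refine D.isStandard hn0 hI hJ hIne hJne (fun t => ?_) hw₀ heq
    by_contra hb
    exact hnp (D.exists_isShiftedPolytropic hn0 hI hJ hI' hIpos hP he hIne hJne hb)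
  have hzero : ∀ κ p₀, IsShiftedPolytropic n I J P κ p₀ → ∀ b₁ b₂ : ℝ, IsStandard I J e
      ((b₁ • similarityEnergy (polytropicEnergy n κ)
        + b₂ • dilationalEnergy (polytropicEnergy n κ)) : Kinematic n ℝ) → b₁ = 0 ∧ b₂ = 0 :=
    fun κ p₀ hκ b₁ b₂ hs =>
      eq_zero_of_isStandard hn0 hI hJ hI' hJ' hIpos hP he hIne hJne hκ hs
  refine ⟨⟨(mass_law hI hJ hIpos hP he).1, fun k => (momentum_law hI hJ hIpos hP he k).1,
    fun j k => (angularMomentum_law hI hJ hIpos hP he j k).1,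
    fun k => (galileanMomentum_law hI hJ hIpos hP he k).1, (energy_law hI hJ hIpos hP he).1,
    fun f hf => (entropy_law hI hJ hIpos hP he hf).1⟩, hnonpoly, ⟨?_, ?_⟩, ?_⟩
  · rintro ⟨T, hT, hc, hns⟩
    by_contra hnp
    exact hns ((hnonpoly hnp T hT).1 hc)
  · rintro ⟨κ, p₀, hκ⟩
    have hl := (similarityEnergy_law hn0 hI hJ hIpos hP hκ).2
    refine ⟨_, hl.1, hl.2, fun hs => ?_⟩
    -- The similarity energy itself is the non-standard witness.
    have := hzero κ p₀ hκ 1 0 (by rwa [one_smul, zero_smul, add_zero])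
    exact one_ne_zero this.1
  · intro κ p₀ hκ
    have hsl := similarityEnergy_law hn0 hI hJ hIpos hP hκ
    have hdl := dilationalEnergy_law hn0 hI hJ hIpos hP hκ
    have hcomb : ∀ b₁ b₂ : ℝ, IsSmoothConserved I J P
        ((b₁ • similarityEnergy (polytropicEnergy n κ)
          + b₂ • dilationalEnergy (polytropicEnergy n κ)) : Kinematic n ℝ) := fun b₁ b₂ =>
      (hsl.2.smul hI hJ b₁).add hI hJ (hdl.2.smul hI hJ b₂)
    refine ⟨hκ.isInternalEnergy hn0 hIpos hP,
      fun t x u ρ hρ S hS => energy_polytropic hIpos hκ t x u hρ hS, hsl.1, hdl.1,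
      fun T hT => ⟨fun hc => ?_, ?_⟩, hzero κ p₀ hκ⟩
    · obtain ⟨w₀, β, α, h, hw₀, D, heq⟩ := hdet T ⟨hT, hc⟩
      obtain ⟨b₁, b₂, hβ⟩ := D.exists_quadratic hn0 hI hJ hI' hIpos hP he hIne hJne hκ
      refine ⟨b₁, b₂, ?_⟩
      obtain ⟨w₀', β', α', h', hw₀', D', heq'⟩ :=
        hdet _ (IsSmoothConserved.sub hI hJ ⟨hT, hc⟩ (hcomb b₁ b₂))
      -- By linearity of second differences, the remaining density has kinetic coefficient `β(t) -
      -- b₁t - b₂t²`, which is the constant `β(0, 0)`. It is therefore standard.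
      have hβ' : ∀ t, β' (t, 0) = β (0, 0) := by
        intro t
        obtain ⟨ρ₀, hρ₀⟩ := hIne
        obtain ⟨S₀, hS₀⟩ := hJne
        have hρ0 : ρ₀ ≠ 0 := (hIpos hρ₀).ne'
        set u : Space n := EuclideanSpace.single ⟨0, hn0⟩ 1 with hu
        have hu1 : ‖u‖ = 1 := by simp [hu]
        have h1 := similarityEnergy_add_dilationalEnergy_secondDiff (polytropicEnergy n κ) b₁ b₂ t
          0 u ρ₀ S₀
        have h2 := background_add_affineDensity_secondDiff (e := e) (β := β) (α := α) (h := h) w₀ t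
          0 u ρ₀ S₀
        have h3 := background_add_affineDensity_secondDiff (e := e) (β := β') (α := α') (h := h')
          w₀' t 0 u ρ₀ S₀
        rw [← heq t 0 u ρ₀ hρ₀ S₀ hS₀, ← heq t 0 (-u) ρ₀ hρ₀ S₀ hS₀,
          ← heq t 0 0 ρ₀ hρ₀ S₀ hS₀, hβ] at h2
        rw [← heq' t 0 u ρ₀ hρ₀ S₀ hS₀, ← heq' t 0 (-u) ρ₀ hρ₀ S₀ hS₀,
          ← heq' t 0 0 ρ₀ hρ₀ S₀ hS₀] at h3
        set U : Kinematic n ℝ := b₁ • similarityEnergy (polytropicEnergy n κ)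
          + b₂ • dilationalEnergy (polytropicEnergy n κ)
        simp only [Pi.sub_apply] at h3
        rw [hu1] at h1 h2 h3
        have h4 : ρ₀ * (β' (t, 0) - β (0, 0)) = 0 := by linarith
        have := (mul_eq_zero.1 h4).resolve_left hρ0
        linarith
      refine D'.isStandard hn0 hI hJ hIne hJne (fun t => ?_) hw₀' heq'
      refine (hasDerivAt_time D'.contDiff_β t 0).unique ?_
      simp_rw [hβ']
      exact hasDerivAt_const t _
    · rintro ⟨b₁, b₂, hs⟩
      have hsm : IsSmoothKinematic I J (T - (b₁ • similarityEnergy (polytropicEnergy n κ)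
          + b₂ • dilationalEnergy (polytropicEnergy n κ))) := ContDiffOn.sub hT (hcomb b₁ b₂).1
      have := (hstd _ hsm hs).add hI hJ (hcomb b₁ b₂)
      rw [sub_add_cancel] at this
      exact this.2
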